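/- **Setting.** Let $\mathbb H$ be the upper half-plane and $d_*(z,w)=|\Psi(z)-\Psi(w)|$ on $\overline{\mathbb H}\cup\{\infty\}$, where $\Psi(z)=(z-i)/(z+i)$, $\Psi(\infty)=1$. Let $\Gamma$ be the space of nonempty closed subsets of $(\overline{\mathbb H}\cup\{\infty\},d_*)$ with the Hausdorff metric and its Borel $\sigma$-algebra. Let $D\subset\mathbb C$ be a simply connected domain with a conformal (injective holomorphic) map $\varphi:D\to\mathbb H$ onto a subdomain of $\mathbb H$ (the inclusion if $D\subset\mathbb H$), through which $D$ is regarded as a part of $\mathbb H$: for $A\in\Gamma$ write $D\setminus A$ for $\{z\in D:\varphi(z)\notin A\}$. Let $H_s(D)$ be the space of smooth compactly supported real functions on $D$. Distributions on $D$ are the continuous linear functionals on $H_s(D)$, with the $\sigma$-algebra generated by the pairings $(\cdot,\rho)$, $\rho\in H_s(D)$. Let $H(D)$ be the completion of $H_s(D)$ under $(f,g)_\nabla=\int\nabla f\cdot\nabla g$. For $\rho\in H_s(D)$ let $-\Delta^{-1}\rho\in H(D)$ be determined by $(-\Delta^{-1}\rho,g)_\nabla=\int\rho g$ for all $g\in H_s(D)$.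 For open $U\subset D$ let $P_U$ be the orthogonal projection of $H(D)$ onto the closure of $H_s(U)$. The zero boundary GFF on $U$, as a random distribution on $D$, is the one whose pairing with each $\rho\in H_s(D)$ is a centered Gaussian of variance $\|P_U(-\Delta^{-1}\rho)\|_\nabla^2$. A GFF $h$ on $D$ is a zero boundary GFF on $D$ plus a deterministic harmonic function $u$ on $D$ (the harmonic extension of the boundary values). Let $A$ be a random element of $\Gamma$ coupled with $h$. For $\delta>0$ let $A_\delta=\{w\in\mathbb H: d_*(w,A)\le\delta\}$, let $\mathcal A_\delta$ be the smallest $\sigma$-algebra for which $A$ and the restriction of $h$ to the interior of $A_\delta$ (that is, to its part in $D$) are measurable, and put $\mathcal A=\bigcap_{\delta\in\mathbb Q,\,\delta>0}\mathcal A_\delta$. The set $A$ is *local* if there is an $\mathcal A$-measurable random distribution $h_1$, a.s. harmonic on $D\setminus A$, such that a regular conditional law of $h$ given $\mathcal A$ is that of $h_1+h_2$, where $h_2$ is a zero boundary GFF on $D\setminus A$. Let $\mathcal C_A$ denote the conditional expectation of $h$ given $\mathcal A$: an $\mathcal A$-measurable random distribution with $(\mathcal C_A,\rho)=\mathbb E[(h,\rho)\mid\mathcal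 A]$ a.s. for each $\rho\in H_s(D)$. **Lemma.** Let $h$ be a GFF on $D$, and let $A_1,A_2$ be random elements of $\Gamma$, defined on the same probability space as $h$, each local (when coupled with $h$), and conditionally independent given $h$. Let $A=A_1\cup A_2$ be their (conditionally independent) union, and let $\mathcal A$ be the $\sigma$-algebra defined above from $A$ and $h$. Then $A$ is local. Moreover $\mathcal C_A$ exists, and for every version of it, $\mathcal C_A$ is a.s. harmonic on $D\setminus A$, and a regular conditional law of $h$ given $\mathcal A$ *and* the pair $(A_1,A_2)$ is that of $\mathcal C_A$ plus a zero boundary GFF on $D\setminus A$. -/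

import Mathlib

open MeasureTheory ProbabilityTheory TopologicalSpace Set
open scoped Distributions LineDeriv UpperHalfPlane NNReal

noncomputable section

namespace GFF

/-! ### The compactified closed half-plane and its closed subsets -/

/-- The closed upper half-plane together with the point at infinity. -/
def HBar : Type := OnePoint {z : ℂ // 0 ≤ z.im}

/-- The Möbius map `Ψ z = (z - i) / (z + i)`, `Ψ ∞ = 1`, onto the closed unit disc. -/
def cayley : HBar → ℂ := fun p =>
  OnePoint.elim (X := {z : ℂ // 0 ≤ z.im}) p 1 fun z => ((z : ℂ) - Complex.I) / ((z : ℂ) + Complex.I)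

/-- A point of the closed half-plane, seen in `HBar`. -/
def HBar.ofClosed (z : {z : ℂ // 0 ≤ z.im}) : HBar := (OnePoint.some z : OnePoint {z : ℂ // 0 ≤ z.im})

/-- The point at infinity of `HBar`. -/
def HBar.infty : HBar := (OnePoint.infty : OnePoint {z : ℂ // 0 ≤ z.im})

/-- A point of the open upper half-plane, seen in `HBar`. -/
def HBar.ofUpper (w : ℍ) : HBar := HBar.ofClosed ⟨(w : ℂ), w.im_pos.le⟩

theorem cayley_ofClosed (z : {z : ℂ // 0 ≤ z.im}) :
    cayley (HBar.ofClosed z) = ((z : ℂ) - Complex.I) / ((z : ℂ) + Complex.I) := rfl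

theorem cayley_infty : cayley HBar.infty = 1 := rfl

theorem HBar.cases (p : HBar) : p = HBar.infty ∨ ∃ z, p = HBar.ofClosed z := by
  induction p using OnePoint.rec with
  | infty => exact Or.inl rfl
  | coe z => exact Or.inr ⟨z, rfl⟩

theorem add_I_ne_zero {z : ℂ} (hz : 0 ≤ z.im) : z + Complex.I ≠ 0 := by
  intro h
  have := congrArg Complex.im h
  simp at this
  linarith

theorem cayley_injective : Function.Injective cayley := by
  have key : ∀ z : {z : ℂ // 0 ≤ z.im}, cayley (HBar.ofClosed z) ≠ 1 := by
    intro z h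
    rw [cayley_ofClosed, div_eq_one_iff_eq (add_I_ne_zero z.2)] at h
    have := congrArg Complex.im h
    simp at this
    linarith
  intro p q h
  rcases HBar.cases p with rfl | ⟨z, rfl⟩ <;> rcases HBar.cases q with rfl | ⟨w, rfl⟩
  · rfl
  · exact absurd h.symm (key w)
  · exact absurd h (key z)
  · rw [cayley_ofClosed, cayley_ofClosed, div_eq_div_iff (add_I_ne_zero z.2)
      (add_I_ne_zero w.2)] at h
    have h2 : (2 * Complex.I) * ((z : ℂ) - w) = 0 := by linear_combination h
    have h3 : (z : ℂ) = w := by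
      have := (mul_eq_zero.mp h2).resolve_left (by simp)
      exact sub_eq_zero.mp this
    rw [Subtype.ext h3]

/-- The metric `d_*(z, w) = |Ψ z - Ψ w|`. -/
instance : MetricSpace HBar := MetricSpace.induced cayley cayley_injective inferInstance

theorem isometry_cayley : Isometry cayley := Isometry.of_dist_eq fun _ _ => rfl

theorem range_cayley : Set.range cayley = Metric.closedBall (0 : ℂ) 1 := by
  ext w
  rw [mem_closedBall_zero_iff]
  constructor
  · rintro ⟨p, rfl⟩
    rcases HBar.cases p with rfl | ⟨z, rfl⟩
    · simp [cayley_infty]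
    · rw [cayley_ofClosed, norm_div, div_le_one (norm_pos_iff.mpr (add_I_ne_zero z.2))]
      have hz := z.2
      rw [← sq_le_sq₀ (norm_nonneg _) (norm_nonneg _), ← Complex.normSq_eq_norm_sq,
        ← Complex.normSq_eq_norm_sq, Complex.normSq_apply, Complex.normSq_apply]
      simp
      nlinarith
  · intro hw
    by_cases h1 : w = 1
    · exact ⟨HBar.infty, by rw [cayley_infty, h1]⟩
    · have hne : (1 : ℂ) - w ≠ 0 := sub_ne_zero.mpr (Ne.symm h1)
      have hpos : 0 < Complex.normSq (1 - w) := Complex.normSq_pos.mpr hne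
      have hw2 : w.re * w.re + w.im * w.im ≤ 1 := by
        have : Complex.normSq w ≤ 1 := by
          rw [Complex.normSq_eq_norm_sq]; nlinarith [norm_nonneg w]
        rwa [Complex.normSq_apply] at this
      have him : 0 ≤ (Complex.I * (1 + w) / (1 - w)).im := by
        rw [Complex.div_im]
        simp
        rw [← sub_nonneg]
        have : (1 + w.re) * (1 - w.re) / Complex.normSq (1 - w) -
            -(w.im * -w.im) / Complex.normSq (1 - w) =
            (1 - (w.re * w.re + w.im * w.im)) / Complex.normSq (1 - w) := by
          field_simp; ring
        have h0 : 0 ≤ (1 - (w.re * w.re + w.im * w.im)) / Complex.normSq (1 - w) :=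
          div_nonneg (by linarith) hpos.le
        convert h0 using 1
        rw [← this]; ring
      refine ⟨HBar.ofClosed ⟨_, him⟩, ?_⟩
      rw [cayley_ofClosed, div_eq_iff (add_I_ne_zero him)]
      field_simp
      ring

instance : CompactSpace HBar := by
  rw [← isCompact_univ_iff, isometry_cayley.isEmbedding.isInducing.isCompact_iff, image_univ,
    range_cayley]
  exact isCompact_closedBall _ _

/-- The space `Γ` of nonempty closed subsets of `HBar` (as `HBar` is compact, closed sets are
compact), with the Hausdorff metric of `d_*`. -/
abbrev ClosedSets : Type := NonemptyCompacts HBar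

/-- The Borel σ-algebra of the Hausdorff metric. -/
instance : MeasurableSpace ClosedSets := borel ClosedSets

instance : BorelSpace ClosedSets := ⟨rfl⟩

/-! ### Distributions and the Dirichlet space -/

/-- The σ-algebra on the space of distributions on `D` generated by the evaluations
`T ↦ (T, ρ)`. -/
instance (D : Opens ℂ) : MeasurableSpace 𝓓'(D, ℝ) :=
  ⨆ ρ : 𝓓(D, ℝ), MeasurableSpace.comap (fun T : 𝓓'(D, ℝ) => T ρ) inferInstance

/-- The Laplacian of a test function. -/
def lap {D : Opens ℂ} (g : 𝓓(D, ℝ)) : 𝓓(D, ℝ) :=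
  ∂_{(1 : ℂ)} (∂_{(1 : ℂ)} g) + ∂_{Complex.I} (∂_{Complex.I} g)

/-- A distribution `T` on `D` is harmonic on `U` if `(T, Δ g) = 0` for all test functions `g`
supported in `U`. -/
def IsHarmonicOn {D : Opens ℂ} (T : 𝓓'(D, ℝ)) (U : Set ℂ) : Prop :=
  ∀ g : 𝓓(D, ℝ), tsupport g ⊆ U → T (lap g) = 0

/-- The space of test functions on `D`, to be equipped with the Dirichlet inner product. -/
def DirichletTest (D : Opens ℂ) : Type := 𝓓(D, ℝ)

instance (D : Opens ℂ) : AddCommGroup (DirichletTest D) := inferInstanceAs (AddCommGroup 𝓓(D, ℝ))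

instance (D : Opens ℂ) : Module ℝ (DirichletTest D) := inferInstanceAs (Module ℝ 𝓓(D, ℝ))

/-- The Dirichlet inner product `∫ ∇f · ∇g`. -/
def dirichletInner {D : Opens ℂ} (f g : 𝓓(D, ℝ)) : ℝ :=
  ∫ z, ((∂_{(1 : ℂ)} f) z * (∂_{(1 : ℂ)} g) z + (∂_{Complex.I} f) z * (∂_{Complex.I} g) z)

theorem integrable_mul {D : Opens ℂ} (f g : 𝓓(D, ℝ)) :
    Integrable (fun z => f z * g z) (volume : Measure ℂ) :=
  (f.continuous.mul g.continuous).integrable_of_hasCompactSupport f.hasCompactSupport.mul_right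

theorem dirichletInner_add {D : Opens ℂ} (f₁ f₂ g : 𝓓(D, ℝ)) :
    dirichletInner (f₁ + f₂) g = dirichletInner f₁ g + dirichletInner f₂ g := by
  unfold dirichletInner
  have hi : ∀ f : 𝓓(D, ℝ), Integrable (fun z => (∂_{(1 : ℂ)} f) z * (∂_{(1 : ℂ)} g) z +
      (∂_{Complex.I} f) z * (∂_{Complex.I} g) z) (volume : Measure ℂ) :=
    fun f => (integrable_mul _ _).add (integrable_mul _ _)
  rw [← integral_add (hi f₁) (hi f₂)]
  congr 1
  ext z
  simp only [LineDeriv.lineDerivOp_add, FunLike.coe_add, Pi.add_apply]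
  ring

theorem dirichletInner_smul {D : Opens ℂ} (c : ℝ) (f g : 𝓓(D, ℝ)) :
    dirichletInner (c • f) g = c * dirichletInner f g := by
  unfold dirichletInner
  rw [← integral_const_mul]
  congr 1
  ext z
  simp only [LineDeriv.lineDerivOp_smul, FunLike.coe_smul, Pi.smul_apply, smul_eq_mul]
  ring

/-- The Dirichlet inner product on test functions. -/
@[reducible]
def dirichletCore (D : Opens ℂ) : PreInnerProductSpace.Core ℝ (DirichletTest D) where
  inner f g := dirichletInner (D := D) f g
  conj_inner_symm f g := by
    change dirichletInner (D := D) g f = dirichletInner (D := D) f g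
    unfold dirichletInner
    congr 1
    ext z
    ring
  re_inner_nonneg f := by
    change 0 ≤ dirichletInner (D := D) f f
    exact integral_nonneg fun z => add_nonneg (mul_self_nonneg _) (mul_self_nonneg _)
  add_left f₁ f₂ g := dirichletInner_add (D := D) f₁ f₂ g
  smul_left f g c := dirichletInner_smul (D := D) c f g

instance (D : Opens ℂ) : SeminormedAddCommGroup (DirichletTest D) :=
  @InnerProductSpace.Core.toSeminormedAddCommGroup ℝ (DirichletTest D) _ _ _ (dirichletCore D)

instance (D : Opens ℂ) : InnerProductSpace ℝ (DirichletTest D) :=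
  InnerProductSpace.ofCore (dirichletCore D)

/-- The Hilbert space `H(D)`: the completion of the test functions on `D` under the Dirichlet
inner product. -/
abbrev DirichletSpace (D : Opens ℂ) : Type := UniformSpace.Completion (DirichletTest D)

/-- A test function as an element of `H(D)`. -/
def toH {D : Opens ℂ} (g : 𝓓(D, ℝ)) : DirichletSpace D :=
  UniformSpace.Completion.coe' (α := DirichletTest D) g

theorem inner_toH {D : Opens ℂ} (f g : 𝓓(D, ℝ)) :
    inner ℝ (toH f) (toH g) = dirichletInner f g :=
  UniformSpace.Completion.inner_coe (𝕜 := ℝ) (E := DirichletTest D) f g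

/-- `Supp_U`: the closure in `H(D)` of the test functions supported in `U`. -/
def suppSpace (D : Opens ℂ) (U : Set ℂ) : Submodule ℝ (DirichletSpace D) :=
  (Submodule.span ℝ {x | ∃ g : 𝓓(D, ℝ), tsupport g ⊆ U ∧ x = toH g}).topologicalClosure

instance (D : Opens ℂ) (U : Set ℂ) : CompleteSpace (suppSpace D U) :=
  (Submodule.isClosed_topologicalClosure _).completeSpace_coe

open Classical in
/-- `-Δ⁻¹ ρ ∈ H(D)`: the element `f` of `H(D)` with `(f, g)_∇ = ∫ ρ g` for all test functions `g`.
It is unique, and it exists when `D` is conformally equivalent to a bounded domain. -/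
def invLap {D : Opens ℂ} (ρ : 𝓓(D, ℝ)) : DirichletSpace D :=
  if hex : ∃ f : DirichletSpace D, ∀ g : 𝓓(D, ℝ), inner ℝ f (toH g) = ∫ z, ρ z * g z
  then hex.choose else 0

/-- `‖P (-Δ⁻¹ ρ)‖²_∇`, where `P` is the orthogonal projection of `H(D)` onto `Supp_U`. This is
`∫∫_{U × U} ρ(x) ρ(y) G_U(x, y) dx dy` with `G_U` the Dirichlet Green's function of `U`. -/
def energy {D : Opens ℂ} (U : Set ℂ) (ρ : 𝓓(D, ℝ)) : ℝ≥0 :=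
  ‖(suppSpace D U).starProjection (invLap ρ)‖₊ ^ 2

/-! ### The Gaussian free field -/

/-- `ν` is the law of the GFF on `U` with zero boundary values, as a random distribution on `D`. -/
structure IsZeroGFFLaw {D : Opens ℂ} (U : Set ℂ) (ν : Measure 𝓓'(D, ℝ)) : Prop where
  isProbabilityMeasure : IsProbabilityMeasure ν
  map_eval : ∀ ρ : 𝓓(D, ℝ), ν.map (fun T => T ρ) = gaussianReal 0 (energy U ρ)

/-- `h` is an instance of the GFF on `D` with mean `u` (with `u` harmonic in `D`: the harmonic
extension of the boundary values). -/
structure IsGFF {Ω : Type*} [MeasurableSpace Ω] (P : Measure Ω) {D : Opens ℂ} (u : ℂ → ℝ)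
    (h : Ω → 𝓓'(D, ℝ)) : Prop where
  measurable : Measurable h
  map_eval : ∀ ρ : 𝓓(D, ℝ),
    P.map (fun ω => h ω ρ) = gaussianReal (∫ z, u z * ρ z) (energy (D : Set ℂ) ρ)

/-! ### Local sets

A domain `D` is seen as a part of the upper half-plane through a map `φ`, conformal on `D`. -/

/-- `D ∖ A`. -/
def off (D : Opens ℂ) (φ : ℂ → ℍ) (A : ClosedSets) : Set ℂ :=
  {z | z ∈ D ∧ HBar.ofUpper (φ z) ∉ A}

/-- `A_δ`: the points of `ℍ` at `d_*`-distance at most `δ` from `A`. -/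
def thick (A : ClosedSets) (δ : ℝ) : Set ℍ :=
  {w | Metric.infDist (HBar.ofUpper w) (A : Set HBar) ≤ δ}

/-- The part in `D` of the interior of `A_δ`. -/
def near (D : Opens ℂ) (φ : ℂ → ℍ) (A : ClosedSets) (δ : ℝ) : Set ℂ :=
  {z | z ∈ D ∧ φ z ∈ interior (thick A δ)}

variable {Ω : Type*}

/-- The σ-algebra generated by `A`. -/
@[reducible]
def sigmaSet (A : Ω → ClosedSets) : MeasurableSpace Ω := MeasurableSpace.comap A inferInstance

open Classical in
/-- `𝒜_δ`: the smallest σ-algebra for which `A` and the restriction of `h` to the interior of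
`A_δ` are measurable. The restriction is recorded by the pairings `(h, ρ)` on the events that the
support of `ρ` lies in the interior of `A_δ`. -/
@[reducible]
def sigmaNear {D : Opens ℂ} (φ : ℂ → ℍ) (h : Ω → 𝓓'(D, ℝ)) (A : Ω → ClosedSets) (δ : ℝ) :
    MeasurableSpace Ω :=
  sigmaSet A ⊔ ⨆ ρ : 𝓓(D, ℝ), MeasurableSpace.comap
    (fun ω => if tsupport ρ ⊆ near D φ (A ω) δ then h ω ρ else 0) inferInstance

/-- `𝒜 = ⋂_{δ ∈ ℚ, δ > 0} 𝒜_δ`. -/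
@[reducible]
def sigmaGerm {D : Opens ℂ} (φ : ℂ → ℍ) (h : Ω → 𝓓'(D, ℝ)) (A : Ω → ClosedSets) :
    MeasurableSpace Ω :=
  ⨅ (δ : ℚ) (_ : 0 < δ), sigmaNear φ h A δ

/-- Given `m`, a regular conditional law of `h` is that of `h₁ + h₂`, with `h₂` a zero boundary
GFF on the random open set `U`. -/
def HasCondLaw [MeasurableSpace Ω] (P : Measure Ω) {D : Opens ℂ} (h : Ω → 𝓓'(D, ℝ))
    (m : MeasurableSpace Ω) (h₁ : Ω → 𝓓'(D, ℝ)) (U : Ω → Set ℂ) : Prop :=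
  ∃ κ : Kernel[m] Ω 𝓓'(D, ℝ), IsMarkovKernel κ ∧
    (∀ S : Set 𝓓'(D, ℝ), MeasurableSet S → (fun ω => (κ ω).real S) =ᵐ[P] P⟦h ⁻¹' S|m⟧) ∧
    ∀ᵐ ω ∂P, ∃ ν : Measure 𝓓'(D, ℝ), IsZeroGFFLaw (U ω) ν ∧ κ ω = ν.map (fun T => h₁ ω + T)

/-- The random closed set `A`, coupled with the field `h`, is local: conditioned on `𝒜`, the law
of `h` is that of `h₁ + h₂`, with `h₂` a zero boundary GFF on `D ∖ A` and `h₁` an `𝒜`-measurable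
random distribution that is a.s. harmonic on `D ∖ A`. -/
def IsLocal [MeasurableSpace Ω] (P : Measure Ω) {D : Opens ℂ} (φ : ℂ → ℍ) (h : Ω → 𝓓'(D, ℝ))
    (A : Ω → ClosedSets) : Prop :=
  ∃ h₁ : Ω → 𝓓'(D, ℝ), Measurable[sigmaGerm φ h A] h₁ ∧
    (∀ᵐ ω ∂P, IsHarmonicOn (h₁ ω) (off D φ (A ω))) ∧
    HasCondLaw P h (sigmaGerm φ h A) h₁ (fun ω => off D φ (A ω))

/-- `C` is (a version of) the conditional expectation of the random distribution `h` given `m`. -/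
def IsCondExpField [MeasurableSpace Ω] (P : Measure Ω) {D : Opens ℂ} (h : Ω → 𝓓'(D, ℝ))
    (m : MeasurableSpace Ω) (C : Ω → 𝓓'(D, ℝ)) : Prop :=
  Measurable[m] C ∧ ∀ ρ : 𝓓(D, ℝ), (fun ω => C ω ρ) =ᵐ[P] P[fun ω => h ω ρ | m]

/-- Conditioned on `h`, the random sets `A₁` and `A₂` are independent. -/
def CondIndepSets [MeasurableSpace Ω] (P : Measure Ω) {D : Opens ℂ} (h : Ω → 𝓓'(D, ℝ))
    (A₁ A₂ : Ω → ClosedSets) : Prop :=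
  ∀ S T : Set ClosedSets, MeasurableSet S → MeasurableSet T →
    P⟦A₁ ⁻¹' S ∩ A₂ ⁻¹' T|MeasurableSpace.comap h inferInstance⟧ =ᵐ[P]
      P⟦A₁ ⁻¹' S|MeasurableSpace.comap h inferInstance⟧ *
        P⟦A₂ ⁻¹' T|MeasurableSpace.comap h inferInstance⟧

end GFF

end

noncomputable section

namespace GFF

/-! ### Deterministic analysis on the Dirichlet space: cutoffs, projections, neighbourhoods of
closed sets. -/

section

open scoped ContDiff Topology

/-! ### Calculus of test functions -/

/-! The centred field is an isometry `white` from `H(D)` into `L²`, sending `-Δ⁻¹ρ` to `(h, ρ) - m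
ρ`. For a set `N` in `D`, `coSupp N` is the space of elements of `H(D)` that vanish on `N`. The
variables attached to its orthogonal complement are functions of the field in `N`, while those
attached to `coSupp N` are centred Gaussians independent of that field. This is the Markov property,
read off from characteristic functionals.

The key point is a one-sided form of locality. Fix a closed set `c`, let `N` be its
`2ε`-neighbourhood in `D` and `V` the points farther than `ε` from `c`. A cutoff argument gives
`coSupp N ≤ suppSpace V` (`coSupp_nbhd_le`). If a local set `A` avoids `V` on an event `E` of its
germ σ-algebra, then a shift of `h` along `Supp V` changes the characteristic functional on `E`
exactly as it would for a deterministic set (`setIntegral_expI_white_add`). Hence the probability of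
`E` given `h` is a function of the field in `N` only (`condExp_indicator_eq`). For two local sets
that are conditionally independent given `h`, the conditional probability of a joint event is a
product of two such functions, and so again depends only on the field in `N`. Therefore revealing
`A₁` and `A₂`, on the event that both avoid `V`, does not disturb the Gaussian law of the field
given its restriction to `N` (`setIntegral_eq_zero_of_condIndepSets`).

The union `A` is random, so it is approximated within `mesh n` by a set `disc n A` with finitely
many values. On each event `disc n A = c` the previous statement applies, and the pieces are glued
(`condExp_glue`). This gives the conditional mean and characteristic functional given the pair and
the field in a shrinking neighbourhood of `A`. As `n → ∞` the conditional means converge in `L²`,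
being projections on decreasing subspaces, and the conditional variances converge because the
projections on `coSupp` of the neighbourhoods converge to the projection on `Supp (D ∖ A)`
(`tendsto_starProjection_coSupp`). The limiting mean is measurable for the germ of `A` alone,
although the conditioning includes `(A₁, A₂)`; this is `exists_condMean`.

It remains to pass from individual pairings to random distributions. The space of distributions is
standard Borel, because it embeds measurably in the functions on a countable group of test
functions, so regular conditional laws exist. Almost surely such a law has the correct Gaussian
pairings on the countable group. Continuity of distributions extends this to all test functions and
makes the mean itself a distribution (`exists_eq_map_add`). Harmonicity off `A` holds because the
variable attached to a `g` supported off `A` has conditional mean zero. -/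

theorem lineDeriv_apply {D : Opens ℂ} (v : ℂ) (f : 𝓓(D, ℝ)) (z : ℂ) :
    (∂_{v} f) z = fderiv ℝ f z v := by
  rw [TestFunction.lineDerivOp_eq_lineDerivCLM ℝ, TestFunction.lineDerivCLM_apply,
    if_pos (by simp), (f.contDiff.differentiable (by simp)).differentiableAt.lineDeriv_eq_fderiv]

/-- The product of a test function on `D` with a function that is smooth on `D`. -/
def mulTest {D : Opens ℂ} (ψ : ℂ → ℝ) (hψ : ContDiffOn ℝ ∞ ψ D) (g : 𝓓(D, ℝ)) : 𝓓(D, ℝ) where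
  toFun z := ψ z * g z
  contDiff' := by
    refine contDiff_iff_contDiffAt.mpr fun z => ?_
    by_cases hz : z ∈ D
    · exact (hψ.contDiffAt (D.isOpen.mem_nhds hz)).mul g.contDiff.contDiffAt
    · have hz' : z ∉ tsupport g := fun h => hz (g.tsupport_subset h)
      refine (contDiffAt_const (c := (0 : ℝ))).congr_of_eventuallyEq ?_
      filter_upwards [notMem_tsupport_iff_eventuallyEq.mp hz'] with w hw
      simp [hw]
  hasCompactSupport' := g.hasCompactSupport.mul_left
  tsupport_subset' := (tsupport_mul_subset_right).trans g.tsupport_subset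

@[simp]
theorem mulTest_apply {D : Opens ℂ} (ψ : ℂ → ℝ) (hψ : ContDiffOn ℝ ∞ ψ D) (g : 𝓓(D, ℝ)) (z : ℂ) :
    mulTest ψ hψ g z = ψ z * g z := rfl

theorem tsupport_mulTest_subset {D : Opens ℂ} (ψ : ℂ → ℝ) (hψ : ContDiffOn ℝ ∞ ψ D)
    (g : 𝓓(D, ℝ)) : tsupport (mulTest ψ hψ g) ⊆ tsupport g :=
  tsupport_mul_subset_right

theorem fderiv_eq_zero_of_notMem {D : Opens ℂ} (g : 𝓓(D, ℝ)) {z : ℂ} (hz : z ∉ D) :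
    g z = 0 ∧ ∀ v : ℂ, (∂_{v} g : 𝓓(D, ℝ)) z = 0 := by
  refine ⟨image_eq_zero_of_notMem_tsupport fun h => hz (g.tsupport_subset h), fun v => ?_⟩
  exact image_eq_zero_of_notMem_tsupport fun h => hz ((∂_{v} g).tsupport_subset h)

theorem lineDeriv_mulTest {D : Opens ℂ} (ψ : ℂ → ℝ) (hψ : ContDiffOn ℝ ∞ ψ D) (g : 𝓓(D, ℝ))
    (v z : ℂ) :
    (∂_{v} (mulTest ψ hψ g)) z = fderiv ℝ ψ z v * g z + ψ z * (∂_{v} g) z := by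
  by_cases hz : z ∈ D
  · have h1 : DifferentiableAt ℝ ψ z :=
      (hψ.contDiffAt (D.isOpen.mem_nhds hz)).differentiableAt (by simp)
    have h2 : DifferentiableAt ℝ g z := (g.contDiff.differentiable (by simp)).differentiableAt
    rw [lineDeriv_apply, lineDeriv_apply]
    have : (mulTest ψ hψ g : ℂ → ℝ) = ψ * (g : ℂ → ℝ) := rfl
    rw [this, fderiv_mul h1 h2]
    simp
    ring
  · rw [(fderiv_eq_zero_of_notMem _ hz).2, (fderiv_eq_zero_of_notMem g hz).1,
      (fderiv_eq_zero_of_notMem g hz).2]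
    simp

theorem integrable_test {D : Opens ℂ} (f : 𝓓(D, ℝ)) : Integrable f (volume : Measure ℂ) :=
  f.continuous.integrable_of_hasCompactSupport f.hasCompactSupport

theorem integral_lineDeriv {D : Opens ℂ} (v : ℂ) (f : 𝓓(D, ℝ)) : ∫ z, (∂_{v} f) z = 0 := by
  obtain ⟨χ, hχ⟩ : ∃ χ : ℂ → ℝ, χ = fun _ => 1 := ⟨_, rfl⟩
  have h := integral_mul_fderiv_eq_neg_fderiv_mul_of_integrable (μ := (volume : Measure ℂ))
    (f := χ) (g := f) (v := v) ?_ ?_ ?_ ?_ ?_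
  · simpa [hχ, ← lineDeriv_apply] using h
  · simp [hχ]
  · simpa [hχ, ← lineDeriv_apply] using integrable_test (∂_{v} f)
  · simpa [hχ] using integrable_test f
  · rw [hχ]; exact fun _ _ => differentiableAt_const _
  · exact fun _ _ => (f.contDiff.differentiable (by simp)).differentiableAt

theorem integral_lineDeriv_mul {D : Opens ℂ} (v : ℂ) (f g : 𝓓(D, ℝ)) :
    ∫ z, (∂_{v} f) z * g z = - ∫ z, f z * (∂_{v} g) z := by
  have h := integral_lineDeriv v (mulTest f f.contDiff.contDiffOn g)
  simp only [lineDeriv_mulTest, ← lineDeriv_apply] at h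
  rw [integral_add (integrable_mul _ _) (integrable_mul _ _)] at h
  linarith

theorem dirichletInner_eq_neg_integral_lap {D : Opens ℂ} (f g : 𝓓(D, ℝ)) :
    dirichletInner f g = - ∫ z, lap f z * g z := by
  have h1 := integral_lineDeriv_mul (1 : ℂ) (∂_{(1 : ℂ)} f) g
  have h2 := integral_lineDeriv_mul Complex.I (∂_{Complex.I} f) g
  have h3 : ∀ z, lap f z * g z = (∂_{(1 : ℂ)} (∂_{(1 : ℂ)} f)) z * g z +
      (∂_{Complex.I} (∂_{Complex.I} f)) z * g z := fun z => by
    simp only [lap, FunLike.coe_add, Pi.add_apply]; ring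
  simp only [h3]
  rw [integral_add (integrable_mul _ _) (integrable_mul _ _), h1, h2, dirichletInner,
    integral_add (integrable_mul _ _) (integrable_mul _ _)]
  ring

/-- Green's second identity: in each direction `v`, the function `u ∂ᵥ∂ᵥg - g ∂ᵥ∂ᵥu` is the
derivative of `u ∂ᵥg - g ∂ᵥu`, which has compact support in `D`. This is what makes the mean of the
field invisible to shifts by Laplacians. -/
theorem integral_harmonic_mul_lap {D : Opens ℂ} {u : ℂ → ℝ}
    (hu : InnerProductSpace.HarmonicOnNhd u (D : Set ℂ)) (g : 𝓓(D, ℝ)) :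
    ∫ z, u z * lap g z = 0 := by
  have hs : ContDiffOn ℝ ∞ u D := fun z hz =>
    ((HarmonicAt.analyticAt (hu z hz)).contDiffAt (n := ∞)).contDiffWithinAt
  have hs' : ∀ v : ℂ, ContDiffOn ℝ ∞ (fun z => fderiv ℝ u z v) D := fun v =>
    (hs.fderiv_of_isOpen D.isOpen (by simp)).clm_apply contDiffOn_const
  have h1 : ∀ v : ℂ, ∫ z, (u z * (∂_{v} (∂_{v} g)) z -
      fderiv ℝ (fun z => fderiv ℝ u z v) z v * g z) = 0 := by
    intro v
    have e1 := integral_lineDeriv v (mulTest u hs (∂_{v} g))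
    have e2 := integral_lineDeriv v (mulTest _ (hs' v) g)
    rw [← sub_zero (∫ z, _), ← e2, ← integral_sub (integrable_test _) (integrable_test _), e2] at e1
    rw [← e1]
    congr 1
    ext z
    rw [lineDeriv_mulTest, lineDeriv_mulTest]
    ring
  have hint : ∀ v : ℂ, Integrable (fun z => u z * (∂_{v} (∂_{v} g)) z -
      fderiv ℝ (fun z => fderiv ℝ u z v) z v * g z) (volume : Measure ℂ) := fun v =>
    (integrable_test (mulTest u hs (∂_{v} (∂_{v} g)))).sub
      (integrable_test (mulTest _ ((((hs' v).fderiv_of_isOpen D.isOpen (m := ∞) (by simp)).clm_apply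
        (contDiffOn_const (c := v)))) g))
  have h2 := h1 1
  have h3 := h1 Complex.I
  rw [← add_zero (∫ z, _)] at h2
  rw [← h3, ← integral_add (hint _) (hint _), h3] at h2
  rw [← h2]
  congr 1
  ext z
  simp only [lap, FunLike.coe_add, Pi.add_apply]
  by_cases hz : z ∈ D
  · have hl := (hu z hz).2.self_of_nhds
    rw [InnerProductSpace.laplacian_eq_iteratedFDeriv_complexPlane] at hl
    simp only [iteratedFDeriv_two_apply, Pi.zero_apply] at hl
    have e : ∀ v : ℂ, fderiv ℝ (fun z => fderiv ℝ u z v) z v = fderiv ℝ (fderiv ℝ u) z v v := by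
      intro v
      have hd : DifferentiableAt ℝ (fderiv ℝ u) z :=
        ((hs.fderiv_of_isOpen D.isOpen (m := ∞) (by simp)).contDiffAt
          (D.isOpen.mem_nhds hz)).differentiableAt (by simp)
      rw [fderiv_clm_apply hd (differentiableAt_const _)]
      simp
    rw [e, e]
    simp at hl
    linear_combination hl * g z
  · rw [(fderiv_eq_zero_of_notMem g hz).1, (fderiv_eq_zero_of_notMem _ hz).2,
      (fderiv_eq_zero_of_notMem _ hz).2]
    simp

end

section

open scoped ContDiff Topology

/-! ### A weighted Poincaré inequality -/

theorem hasFDerivAt_re_comp {F : ℂ → ℂ} {F' z : ℂ} (h : HasDerivAt F F' z) :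
    HasFDerivAt (fun z => (F z).re)
      (Complex.reCLM.comp ((ContinuousLinearMap.toSpanSingleton ℂ F').restrictScalars ℝ)) z :=
  Complex.reCLM.hasFDerivAt.comp z (h.hasFDerivAt.restrictScalars ℝ)

theorem hasFDerivAt_im_comp {F : ℂ → ℂ} {F' z : ℂ} (h : HasDerivAt F F' z) :
    HasFDerivAt (fun z => (F z).im)
      (Complex.imCLM.comp ((ContinuousLinearMap.toSpanSingleton ℂ F').restrictScalars ℝ)) z :=
  Complex.imCLM.hasFDerivAt.comp z (h.hasFDerivAt.restrictScalars ℝ)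

/-- If `F` is holomorphic on `D` and bounded by `1`, then `∫ g² |F'|² ≤ 4 ∫ |∇g|²` for all test
functions `g` on `D`. -/
theorem weighted_poincare {D : Opens ℂ} {F : ℂ → ℂ} (hF : DifferentiableOn ℂ F D)
    (hF1 : ∀ z ∈ D, ‖F z‖ ≤ 1) (g : 𝓓(D, ℝ)) :
    Integrable (fun z => g z ^ 2 * ‖deriv F z‖ ^ 2) (volume : Measure ℂ) ∧
      ∫ z, g z ^ 2 * ‖deriv F z‖ ^ 2 ≤ 4 * dirichletInner g g := by
  have hF' : DifferentiableOn ℂ (deriv F) D := hF.deriv D.isOpen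
  have hre : ContDiffOn ℝ ∞ (fun z => (F z).re) D :=
    Complex.reCLM.contDiff.comp_contDiffOn ((hF.contDiffOn D.isOpen).restrict_scalars ℝ)
  have hre' : ContDiffOn ℝ ∞ (fun z => (deriv F z).re) D :=
    Complex.reCLM.contDiff.comp_contDiffOn ((hF'.contDiffOn D.isOpen).restrict_scalars ℝ)
  have him' : ContDiffOn ℝ ∞ (fun z => (deriv F z).im) D :=
    Complex.imCLM.contDiff.comp_contDiffOn ((hF'.contDiffOn D.isOpen).restrict_scalars ℝ)
  have hg : ContDiffOn ℝ ∞ g D := g.contDiff.contDiffOn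
  -- With `r = Re F`, one has `∇r = (Re F', -Im F')`, so `(f₁, -f₂) = g² r ∇r`. As `Δr = 0`, its
  -- divergence is `g² |∇r|² + 2 g r ∇g · ∇r`, and it integrates to zero.
  set f₁ := mulTest _ ((hg.mul hre).mul hre') g
  set f₂ := mulTest _ ((hg.mul hre).mul him') g
  set w := mulTest _ (hg.mul ((hre'.mul hre').add (him'.mul him'))) g
  have hw : ∀ z, g z ^ 2 * ‖deriv F z‖ ^ 2 = w z := by
    intro z
    rw [← Complex.normSq_eq_norm_sq, Complex.normSq_apply]
    simp only [w, mulTest_apply]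
    ring
  simp only [hw]
  refine ⟨integrable_test w, ?_⟩
  have e : ∫ z, ((∂_{(1 : ℂ)} f₁) z - (∂_{Complex.I} f₂) z) = 0 := by
    rw [integral_sub (integrable_test _) (integrable_test _), integral_lineDeriv,
      integral_lineDeriv, sub_zero]
  -- Young's inequality on the cross term, with `r² ≤ 1`. Half of `w` is absorbed on the left after
  -- integration, whence the constant `4`.
  have hpt : ∀ z, w z ≤ ((∂_{(1 : ℂ)} f₁) z - (∂_{Complex.I} f₂) z) + (1 / 2 * w z +
      2 * ((∂_{(1 : ℂ)} g) z * (∂_{(1 : ℂ)} g) z + (∂_{Complex.I} g) z * (∂_{Complex.I} g) z)) := by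
    intro z
    by_cases hz : z ∈ D
    · have d0 : HasDerivAt F (deriv F z) z := (hF.differentiableAt (D.isOpen.mem_nhds hz)).hasDerivAt
      have d1 : HasDerivAt (deriv F) (deriv (deriv F) z) z :=
        (hF'.differentiableAt (D.isOpen.mem_nhds hz)).hasDerivAt
      have dg : HasFDerivAt g (fderiv ℝ g z) z :=
        (g.contDiff.differentiable (by simp)).differentiableAt.hasFDerivAt
      have k1 : (∂_{(1 : ℂ)} f₁) z = g z ^ 2 * (F z).re * (deriv (deriv F) z).re +
          g z ^ 2 * (deriv F z).re ^ 2 + 2 * g z * (F z).re * (deriv F z).re *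
            (∂_{(1 : ℂ)} g) z := by
        rw [lineDeriv_mulTest]
        have := ((dg.mul (hasFDerivAt_re_comp d0)).mul (hasFDerivAt_re_comp d1)).fderiv
        simp only [Pi.mul_def] at this ⊢
        rw [this]
        simp [lineDeriv_apply]
        ring
      have k2 : (∂_{Complex.I} f₂) z = g z ^ 2 * (F z).re * (deriv (deriv F) z).re -
          g z ^ 2 * (deriv F z).im ^ 2 + 2 * g z * (F z).re * (deriv F z).im *
            (∂_{Complex.I} g) z := by
        rw [lineDeriv_mulTest]
        have := ((dg.mul (hasFDerivAt_re_comp d0)).mul (hasFDerivAt_im_comp d1)).fderiv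
        simp only [Pi.mul_def] at this ⊢
        rw [this]
        simp [lineDeriv_apply]
        ring
      have k3 : w z = g z ^ 2 * ((deriv F z).re ^ 2 + (deriv F z).im ^ 2) := by
        simp only [w, mulTest_apply]; ring
      have k4 : (F z).re ^ 2 ≤ 1 := by
        have := (Complex.abs_re_le_norm (F z)).trans (hF1 z hz)
        rw [← sq_abs]
        nlinarith [abs_nonneg (F z).re]
      rw [k1, k2, k3]
      generalize (∂_{(1 : ℂ)} g) z = a, (∂_{Complex.I} g) z = b, g z = c, (F z).re = r,
        (deriv F z).re = p, (deriv F z).im = q at *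
      nlinarith [sq_nonneg (c * p + 2 * r * a), sq_nonneg (c * q - 2 * r * b),
        mul_nonneg (sub_nonneg.mpr k4) (add_nonneg (sq_nonneg a) (sq_nonneg b))]
    · have h1 : w z = 0 := (fderiv_eq_zero_of_notMem w hz).1
      rw [h1, (fderiv_eq_zero_of_notMem f₁ hz).2, (fderiv_eq_zero_of_notMem f₂ hz).2]
      simp only [sub_zero, mul_zero, zero_add]
      exact mul_nonneg two_pos.le (add_nonneg (mul_self_nonneg _) (mul_self_nonneg _))
  have hi1 : Integrable (fun z => (∂_{(1 : ℂ)} f₁) z - (∂_{Complex.I} f₂) z)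
    (volume : Measure ℂ) := (integrable_test _).sub (integrable_test _)
  have hi2 : Integrable (fun z => 1 / 2 * w z) (volume : Measure ℂ) :=
    (integrable_test w).const_mul _
  have hi3 : Integrable (fun z => 2 * ((∂_{(1 : ℂ)} g) z * (∂_{(1 : ℂ)} g) z +
      (∂_{Complex.I} g) z * (∂_{Complex.I} g) z)) (volume : Measure ℂ) :=
    ((integrable_mul _ _).add (integrable_mul _ _)).const_mul _
  have := integral_mono (integrable_test w) (hi1.add (hi2.add hi3)) hpt
  rw [integral_add' hi1 (hi2.add hi3), integral_add' hi2 hi3, e, integral_const_mul,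
    integral_const_mul] at this
  unfold dirichletInner
  linarith

/-! ### Cutoffs -/

theorem contDiffOn_comp_holomorphic {D : Opens ℂ} {F : ℂ → ℂ} (hF : DifferentiableOn ℂ F D)
    {η : ℂ → ℝ} (hη : ContDiff ℝ ∞ η) : ContDiffOn ℝ ∞ (fun z => η (F z)) D :=
  hη.comp_contDiffOn ((hF.contDiffOn D.isOpen).restrict_scalars ℝ)

/-- Multiplication by `η ∘ F` is bounded in the Dirichlet norm. The term in which the derivative
falls on the cutoff is at most `C |F'| |g|`, which is exactly what `weighted_poincare` controls. No
regularity of `D` or of `F` at the boundary is needed. -/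
theorem dirichletInner_cutoff_le {D : Opens ℂ} {F : ℂ → ℂ} (hF : DifferentiableOn ℂ F D)
    (hF1 : ∀ z ∈ D, ‖F z‖ ≤ 1) {η : ℂ → ℝ} (hη : ContDiff ℝ ∞ η) (h1 : ∀ w, |η w| ≤ 1) {C : ℝ}
    (hC : ∀ w, ‖fderiv ℝ η w‖ ≤ C) (g : 𝓓(D, ℝ)) :
    dirichletInner (mulTest _ (contDiffOn_comp_holomorphic hF hη) g)
      (mulTest _ (contDiffOn_comp_holomorphic hF hη) g) ≤
        (16 * C ^ 2 + 2) * dirichletInner g g := by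
  obtain ⟨hwi, hwp⟩ := weighted_poincare hF hF1 g
  have hC0 : 0 ≤ C := (norm_nonneg _).trans (hC 0)
  set f := mulTest _ (contDiffOn_comp_holomorphic hF hη) g
  have hpt : ∀ z, (∂_{(1 : ℂ)} f) z * (∂_{(1 : ℂ)} f) z + (∂_{Complex.I} f) z * (∂_{Complex.I} f) z ≤
      4 * C ^ 2 * (g z ^ 2 * ‖deriv F z‖ ^ 2) +
      2 * ((∂_{(1 : ℂ)} g) z * (∂_{(1 : ℂ)} g) z + (∂_{Complex.I} g) z * (∂_{Complex.I} g) z) := by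
    intro z
    by_cases hz : z ∈ D
    · have d0 : HasDerivAt F (deriv F z) z := (hF.differentiableAt (D.isOpen.mem_nhds hz)).hasDerivAt
      have dη : HasFDerivAt η (fderiv ℝ η (F z)) (F z) :=
        (hη.differentiable (by simp)).differentiableAt.hasFDerivAt
      have hv : ∀ v : ℂ, ‖v‖ = 1 → |fderiv ℝ (fun z => η (F z)) z v| ≤ C * ‖deriv F z‖ := by
        intro v hv
        have := (dη.comp z (d0.hasFDerivAt.restrictScalars ℝ)).fderiv
        simp only [Function.comp_def] at this
        rw [this, ← Real.norm_eq_abs]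
        simp only [ContinuousLinearMap.comp_apply]
        refine (ContinuousLinearMap.le_opNorm _ _).trans ?_
        refine mul_le_mul (hC _) ?_ (norm_nonneg _) hC0
        simp [hv]
      have b1 := hv 1 (by simp)
      have b2 := hv Complex.I (by simp)
      have b3 := h1 (F z)
      simp only [f, lineDeriv_mulTest]
      generalize fderiv ℝ (fun z => η (F z)) z 1 = x1, fderiv ℝ (fun z => η (F z)) z Complex.I = x2,
        (∂_{(1 : ℂ)} g) z = a, (∂_{Complex.I} g) z = b, g z = c, η (F z) = r, ‖deriv F z‖ = p at *
      have c1 : x1 ^ 2 ≤ (C * p) ^ 2 := by rw [← sq_abs x1]; gcongr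
      have c2 : x2 ^ 2 ≤ (C * p) ^ 2 := by rw [← sq_abs x2]; gcongr
      have c3 : r ^ 2 ≤ 1 := by rw [← sq_abs]; nlinarith [abs_nonneg r]
      have e1 : (x1 * c + r * a) * (x1 * c + r * a) ≤ 2 * (x1 ^ 2 * c ^ 2) + 2 * (r ^ 2 * a ^ 2) := by
        nlinarith [sq_nonneg (x1 * c - r * a)]
      have e2 : (x2 * c + r * b) * (x2 * c + r * b) ≤ 2 * (x2 ^ 2 * c ^ 2) + 2 * (r ^ 2 * b ^ 2) := by
        nlinarith [sq_nonneg (x2 * c - r * b)]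
      have e3 := mul_le_mul_of_nonneg_right c1 (sq_nonneg c)
      have e4 := mul_le_mul_of_nonneg_right c2 (sq_nonneg c)
      have e5 := mul_le_mul_of_nonneg_right c3 (sq_nonneg a)
      have e6 := mul_le_mul_of_nonneg_right c3 (sq_nonneg b)
      nlinarith
    · rw [(fderiv_eq_zero_of_notMem f hz).2, (fderiv_eq_zero_of_notMem f hz).2]
      simp only [mul_zero, add_zero]
      exact add_nonneg (by positivity)
        (mul_nonneg two_pos.le (add_nonneg (mul_self_nonneg _) (mul_self_nonneg _)))
  have hi1 : Integrable (fun z => 4 * C ^ 2 * (g z ^ 2 * ‖deriv F z‖ ^ 2))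
    (volume : Measure ℂ) := hwi.const_mul _
  have hi3 : Integrable (fun z => 2 * ((∂_{(1 : ℂ)} g) z * (∂_{(1 : ℂ)} g) z +
      (∂_{Complex.I} g) z * (∂_{Complex.I} g) z)) (volume : Measure ℂ) :=
    ((integrable_mul _ _).add (integrable_mul _ _)).const_mul _
  have := integral_mono ((integrable_mul _ _).add (integrable_mul _ _)) (hi1.add hi3) hpt
  rw [integral_add' hi1 hi3, integral_const_mul, integral_const_mul] at this
  change dirichletInner f f ≤ _ + 2 * dirichletInner g g at this
  nlinarith [sq_nonneg C]

/-! ### The inverse Laplacian -/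

/-- Every test function has an inverse Laplacian in `H(D)`. -/
def HasInvLap (D : Opens ℂ) : Prop :=
  ∀ ρ : 𝓓(D, ℝ), ∃ f : DirichletSpace D, ∀ g : 𝓓(D, ℝ), inner ℝ f (toH g) = ∫ z, ρ z * g z

theorem denseRange_toH (D : Opens ℂ) : DenseRange (toH : 𝓓(D, ℝ) → DirichletSpace D) :=
  UniformSpace.Completion.denseRange_coe (α := DirichletTest D)

theorem toH_add {D : Opens ℂ} (f g : 𝓓(D, ℝ)) : toH (f + g) = toH f + toH g :=
  UniformSpace.Completion.coe_add (α := DirichletTest D) f g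

theorem toH_smul {D : Opens ℂ} (c : ℝ) (f : 𝓓(D, ℝ)) : toH (c • f) = c • toH f :=
  UniformSpace.Completion.coe_smul (X := DirichletTest D) c f

theorem norm_toH_sq {D : Opens ℂ} (g : 𝓓(D, ℝ)) : ‖toH g‖ ^ 2 = dirichletInner g g := by
  rw [← inner_toH, real_inner_self_eq_norm_sq]

theorem ext_inner_toH {D : Opens ℂ} {x y : DirichletSpace D}
    (h : ∀ g : 𝓓(D, ℝ), inner ℝ x (toH g) = inner ℝ y (toH g)) : x = y := by
  have : (fun z => inner ℝ x z) = fun z => inner ℝ y z :=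
    (denseRange_toH D).equalizer (continuous_const.inner continuous_id)
      (continuous_const.inner continuous_id) (funext h)
  exact ext_inner_right ℝ fun z => congrFun this z

theorem inner_invLap {D : Opens ℂ} (hI : HasInvLap D) (ρ g : 𝓓(D, ℝ)) :
    inner ℝ (invLap ρ) (toH g) = ∫ z, ρ z * g z := by
  rw [invLap, dif_pos (hI ρ)]
  exact (hI ρ).choose_spec g

/-- `-Δ⁻¹` as a linear map. -/
def invLapHom {D : Opens ℂ} (hI : HasInvLap D) : 𝓓(D, ℝ) →ₗ[ℝ] DirichletSpace D where
  toFun := invLap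
  map_add' f g := ext_inner_toH fun k => by
    rw [inner_add_left, inner_invLap hI, inner_invLap hI, inner_invLap hI,
      ← integral_add (integrable_mul _ _) (integrable_mul _ _)]
    congr 1; ext z; simp only [FunLike.coe_add, Pi.add_apply]; ring
  map_smul' c f := ext_inner_toH fun k => by
    rw [RingHom.id_apply, real_inner_smul_left, inner_invLap hI, inner_invLap hI,
      ← integral_const_mul]
    congr 1; ext z; simp only [FunLike.coe_smul, Pi.smul_apply, smul_eq_mul]; ring

theorem inner_invLapHom {D : Opens ℂ} (hI : HasInvLap D) (ρ g : 𝓓(D, ℝ)) :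
    inner ℝ (invLapHom hI ρ) (toH g) = ∫ z, ρ z * g z := inner_invLap hI ρ g

theorem invLapHom_lap {D : Opens ℂ} (hI : HasInvLap D) (g : 𝓓(D, ℝ)) :
    invLapHom hI (lap g) = - toH g :=
  ext_inner_toH fun k => by
    rw [inner_invLapHom, inner_neg_left, inner_toH, dirichletInner_eq_neg_integral_lap, neg_neg]

theorem denseRange_invLapHom {D : Opens ℂ} (hI : HasInvLap D) : DenseRange (invLapHom hI) := by
  refine (denseRange_toH D).mono ?_
  rintro _ ⟨g, rfl⟩
  exact ⟨lap (-g), by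
    rw [invLapHom_lap, ← neg_one_smul ℝ g, toH_smul, neg_one_smul, neg_neg]⟩

/-- The orthogonal complement of the inverse Laplacians of the test functions supported in `N`. -/
def coSupp {D : Opens ℂ} (hI : HasInvLap D) (N : Set ℂ) : Submodule ℝ (DirichletSpace D) :=
  (Submodule.span ℝ {x | ∃ ρ : 𝓓(D, ℝ), tsupport ρ ⊆ N ∧ x = invLapHom hI ρ})ᗮ

instance {D : Opens ℂ} (hI : HasInvLap D) (N : Set ℂ) : CompleteSpace (coSupp hI N) :=
  (Submodule.isClosed_orthogonal _).completeSpace_coe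

theorem mem_coSupp_iff {D : Opens ℂ} (hI : HasInvLap D) (N : Set ℂ) (x : DirichletSpace D) :
    x ∈ coSupp hI N ↔ ∀ ρ : 𝓓(D, ℝ), tsupport ρ ⊆ N → inner ℝ (invLapHom hI ρ) x = 0 := by
  rw [coSupp, Submodule.mem_orthogonal]
  constructor
  · exact fun h ρ hρ => h _ (Submodule.subset_span ⟨ρ, hρ, rfl⟩)
  · intro h y hy
    induction hy using Submodule.span_induction with
    | mem y hy => obtain ⟨ρ, hρ, rfl⟩ := hy; exact h ρ hρ
    | zero => simp
    | add y z _ _ hy hz => rw [inner_add_left, hy, hz, add_zero]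
    | smul c y _ hy => rw [real_inner_smul_left, hy, mul_zero]

theorem toH_mem_suppSpace {D : Opens ℂ} {U : Set ℂ} {g : 𝓓(D, ℝ)} (hg : tsupport g ⊆ U) :
    toH g ∈ suppSpace D U :=
  Submodule.le_topologicalClosure _ (Submodule.subset_span ⟨g, hg, rfl⟩)

/-- The inner product with `-Δ⁻¹ρ` is integration against `ρ`, so `coSupp N` should be read as the
elements of `H(D)` that vanish on `N`. -/
theorem toH_mem_coSupp {D : Opens ℂ} (hI : HasInvLap D) {N : Set ℂ} {g : 𝓓(D, ℝ)}
    (hg : Disjoint (tsupport g) N) : toH g ∈ coSupp hI N := by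
  rw [mem_coSupp_iff]
  intro ρ hρ
  rw [inner_invLapHom]
  refine integral_eq_zero_of_ae (.of_forall fun z => ?_)
  by_cases hz : z ∈ tsupport g
  · have : ρ z = 0 := image_eq_zero_of_notMem_tsupport fun h =>
      Set.disjoint_left.mp hg hz (hρ h)
    simp [this]
  · simp [image_eq_zero_of_notMem_tsupport hz]

/-- An element of `H(D)` orthogonal to the inverse Laplacians of the test functions supported in a
neighbourhood of `D ∖ V` lies in `Supp_V`. -/
theorem coSupp_le_suppSpace {D : Opens ℂ} (hI : HasInvLap D) {F : ℂ → ℂ}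
    (hF : DifferentiableOn ℂ F D) (hF1 : ∀ z ∈ D, ‖F z‖ ≤ 1) {η : ℂ → ℝ} (hη : ContDiff ℝ ∞ η)
    (h1 : ∀ w, |η w| ≤ 1) {C : ℝ} (hC : ∀ w, ‖fderiv ℝ η w‖ ≤ C) {V' N' : Set ℂ}
    (hV : tsupport η ⊆ V') (hN : tsupport (fun w => 1 - η w) ⊆ N') :
    coSupp hI {z | z ∈ D ∧ F z ∈ N'} ≤ suppSpace D {z | z ∈ D ∧ F z ∈ V'} := by
  have hsub : ∀ (θ : ℂ → ℝ) (hθ : ContDiff ℝ ∞ θ) (S : Set ℂ), tsupport θ ⊆ S → ∀ g : 𝓓(D, ℝ),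
      tsupport (mulTest _ (contDiffOn_comp_holomorphic hF hθ) g) ⊆ {z | z ∈ D ∧ F z ∈ S} := by
    intro θ hθ S hS g z hz
    have hzg := tsupport_mulTest_subset _ _ _ hz
    have hzD := g.tsupport_subset hzg
    refine ⟨hzD, hS ?_⟩
    by_contra hcon
    refine (notMem_tsupport_iff_eventuallyEq.mpr ?_) hz
    have h2 := notMem_tsupport_iff_eventuallyEq.mp hcon
    have h3 : ContinuousAt F z := (hF.differentiableAt (D.isOpen.mem_nhds hzD)).continuousAt
    filter_upwards [h3.eventually h2] with w hw
    simp only [mulTest_apply, Pi.zero_apply] at hw ⊢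
    rw [hw, zero_mul]
  -- Multiplication by the cutoff, defined on test functions and extended by boundedness to an
  -- operator `T` on `H(D)` with range in `Supp_V`. It is then enough that `T x = x`.
  let M : 𝓓(D, ℝ) →ₗ[ℝ] DirichletSpace D :=
    { toFun := fun g => toH (mulTest _ (contDiffOn_comp_holomorphic hF hη) g)
      map_add' := fun f g => by
        rw [← toH_add]; congr 1; ext z
        simp only [mulTest_apply, FunLike.coe_add, Pi.add_apply]; ring
      map_smul' := fun c f => by
        rw [RingHom.id_apply, ← toH_smul]; congr 1; ext z
        simp only [mulTest_apply, FunLike.coe_smul, Pi.smul_apply, smul_eq_mul]; ring }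
  let e : 𝓓(D, ℝ) →ₗ[ℝ] DirichletSpace D :=
    { toFun := toH, map_add' := toH_add, map_smul' := toH_smul }
  have hM : ∀ g, ‖M g‖ ≤ Real.sqrt (16 * C ^ 2 + 2) * ‖e g‖ := by
    intro g
    refine abs_le_of_sq_le_sq' ?_ (by positivity) |>.2
    rw [mul_pow, Real.sq_sqrt (by positivity)]
    change ‖toH _‖ ^ 2 ≤ _ * ‖toH g‖ ^ 2
    rw [norm_toH_sq, norm_toH_sq]
    exact dirichletInner_cutoff_le hF hF1 hη h1 hC g
  set T := M.extendOfNorm e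
  have hT : ∀ g, T (toH g) = toH (mulTest _ (contDiffOn_comp_holomorphic hF hη) g) :=
    LinearMap.extendOfNorm_eq (f := M) (e := e) (denseRange_toH D) ⟨_, hM⟩
  have hTV : ∀ x, T x ∈ suppSpace D {z | z ∈ D ∧ F z ∈ V'} := by
    intro x
    induction x using (denseRange_toH D).induction_on with
    | hp => exact (Submodule.isClosed_topologicalClosure _).preimage T.continuous
    | ih g => rw [hT]; exact toH_mem_suppSpace (hsub η hη V' hV g)
  intro x hx
  have hTi : ∀ (ρ : 𝓓(D, ℝ)) (y : DirichletSpace D), inner ℝ (invLapHom hI ρ) (T y) =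
      inner ℝ (invLapHom hI (mulTest _ (contDiffOn_comp_holomorphic hF hη) ρ)) y := by
    intro ρ y
    induction y using (denseRange_toH D).induction_on with
    | hp => exact isClosed_eq (continuous_const.inner T.continuous)
              (continuous_const.inner continuous_id)
    | ih g =>
      rw [hT, inner_invLapHom, inner_invLapHom]
      congr 1; ext z; simp only [mulTest_apply]; ring
  -- Tested against `-Δ⁻¹ρ`, the operator moves to the test function `ρ`. The difference `ρ - (η ∘
  -- F) ρ` is supported in the neighbourhood on which `x` vanishes.
  have hxT : T x = x := by
    refine ext_inner_left ℝ fun y => ?_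
    induction y using (denseRange_invLapHom hI).induction_on with
    | hp => exact isClosed_eq (continuous_id.inner continuous_const)
              (continuous_id.inner continuous_const)
    | ih ρ =>
      rw [hTi]
      have hθ : ContDiff ℝ ∞ fun w => 1 - η w := contDiff_const.sub hη
      have h0 := (mem_coSupp_iff hI _ x).mp hx _ (hsub _ hθ N' hN ρ)
      have : ρ = mulTest _ (contDiffOn_comp_holomorphic hF hη) ρ +
          mulTest _ (contDiffOn_comp_holomorphic hF hθ) ρ := by
        ext z; simp only [mulTest_apply, FunLike.coe_add, Pi.add_apply]; ring
      conv_rhs => rw [this, map_add, inner_add_left, h0, add_zero]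
  rw [← hxT]
  exact hTV x

end

section

open scoped Topology

/-! ### Neighbourhoods of closed sets in `D` -/

/-- The part of `D` at `d_*`-distance less than `r` from `a`. -/
def nbhd (D : Opens ℂ) (φ : ℂ → ℍ) (a : ClosedSets) (r : ℝ) : Set ℂ :=
  {z | z ∈ D ∧ Metric.infDist (HBar.ofUpper (φ z)) (a : Set HBar) < r}

/-- The part of `D` at `d_*`-distance more than `r` from `a`. -/
def far (D : Opens ℂ) (φ : ℂ → ℍ) (a : ClosedSets) (r : ℝ) : Set ℂ :=
  {z | z ∈ D ∧ r < Metric.infDist (HBar.ofUpper (φ z)) (a : Set HBar)}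

theorem infDist_le_infDist_add_dist (p : HBar) (A B : ClosedSets) :
    Metric.infDist p (A : Set HBar) ≤ Metric.infDist p (B : Set HBar) + dist A B := by
  have := (Metric.lipschitz_infDist_set p).dist_le_mul A B
  rw [Real.dist_eq, NNReal.coe_one, one_mul] at this
  linarith [le_abs_self (Metric.infDist p (A : Set HBar) - Metric.infDist p (B : Set HBar))]

theorem infDist_eq_zero_of_mem {p : HBar} {A : ClosedSets} (h : p ∈ A) :
    Metric.infDist p (A : Set HBar) = 0 := Metric.infDist_zero_of_mem h

theorem continuous_infDist_left (A : ClosedSets) :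
    Continuous fun p : HBar => Metric.infDist p (A : Set HBar) := Metric.continuous_infDist_pt _

theorem continuous_ofUpper : Continuous HBar.ofUpper := by
  rw [isometry_cayley.isEmbedding.isInducing.continuous_iff]
  have : (cayley ∘ HBar.ofUpper) = fun w : ℍ => ((w : ℂ) - Complex.I) / ((w : ℂ) + Complex.I) := rfl
  rw [this]
  exact (UpperHalfPlane.continuous_coe.sub continuous_const).div
    (UpperHalfPlane.continuous_coe.add continuous_const) fun w => add_I_ne_zero w.im_pos.le

theorem near_subset_nbhd {D : Opens ℂ} {φ : ℂ → ℍ} {A a : ClosedSets} {δ r : ℝ}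
    (h : δ + dist A a < r) : near D φ A δ ⊆ nbhd D φ a r := by
  rintro z ⟨hz, hz'⟩
  refine ⟨hz, ?_⟩
  have h1 : Metric.infDist (HBar.ofUpper (φ z)) (A : Set HBar) ≤ δ := (interior_subset hz' : φ z ∈ thick A δ)
  have h2 := infDist_le_infDist_add_dist (HBar.ofUpper (φ z)) a A
  rw [dist_comm] at h2
  linarith

theorem nbhd_subset_near {D : Opens ℂ} {φ : ℂ → ℍ} {A a : ClosedSets} {δ r : ℝ}
    (h : r + dist A a ≤ δ) : nbhd D φ a r ⊆ near D φ A δ := by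
  rintro z ⟨hz, hz'⟩
  refine ⟨hz, ?_⟩
  rw [mem_interior]
  refine ⟨{w | Metric.infDist (HBar.ofUpper w) (a : Set HBar) < r}, ?_,
    isOpen_lt ((continuous_infDist_left a).comp continuous_ofUpper) continuous_const, hz'⟩
  intro w hw
  have h2 := infDist_le_infDist_add_dist (HBar.ofUpper w) A a
  have h3 : Metric.infDist (HBar.ofUpper w) (a : Set HBar) < r := hw
  change Metric.infDist (HBar.ofUpper w) (A : Set HBar) ≤ δ
  linarith

theorem nbhd_subset_nbhd {D : Opens ℂ} {φ : ℂ → ℍ} {a b : ClosedSets} {r s : ℝ}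
    (h : r + dist a b ≤ s) : nbhd D φ a r ⊆ nbhd D φ b s := by
  rintro z ⟨hz, hz'⟩
  refine ⟨hz, ?_⟩
  have h2 := infDist_le_infDist_add_dist (HBar.ofUpper (φ z)) b a
  rw [dist_comm] at h2
  linarith

theorem far_subset_off {D : Opens ℂ} {φ : ℂ → ℍ} {A a : ClosedSets} {r : ℝ}
    (h : (A : Set HBar) ⊆ {p | Metric.infDist p (a : Set HBar) ≤ r}) :
    far D φ a r ⊆ off D φ A := by
  rintro z ⟨hz, hz'⟩
  exact ⟨hz, fun hA => not_lt_of_ge (h hA) hz'⟩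

theorem subset_thickening_of_dist_le {A a : ClosedSets} {r : ℝ} (h : dist A a ≤ r) :
    (A : Set HBar) ⊆ {p | Metric.infDist p (a : Set HBar) ≤ r} := by
  intro p hp
  have h2 := infDist_le_infDist_add_dist p a A
  rw [infDist_eq_zero_of_mem hp, dist_comm] at h2
  change Metric.infDist p (a : Set HBar) ≤ r
  linarith

theorem measurableSet_subset_thickening (a : ClosedSets) (r : ℝ) :
    MeasurableSet {A : ClosedSets | (A : Set HBar) ⊆ {p | Metric.infDist p (a : Set HBar) ≤ r}} :=
  (NonemptyCompacts.isClosed_subsets_of_isClosed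
    (isClosed_le (continuous_infDist_left a) continuous_const)).measurableSet

theorem measurable_sup_closedSets {Ω : Type*} {m : MeasurableSpace Ω} {A₁ A₂ : Ω → ClosedSets}
    (h₁ : Measurable A₁) (h₂ : Measurable A₂) : Measurable fun ω => A₁ ω ⊔ A₂ ω :=
  h₁.sup h₂

/-- Compactness of the Hausdorff metric space leaves only finitely many values, so arguments about a
random closed set reduce to finitely many deterministic ones. -/
theorem exists_simpleFunc_dist_lt {ε : ℝ} (hε : 0 < ε) :
    ∃ J : SimpleFunc ClosedSets ClosedSets, ∀ A, dist A (J A) < ε := by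
  have : Nonempty ClosedSets := ⟨{HBar.infty}⟩
  obtain ⟨t, ht⟩ := isCompact_univ.elim_finite_subcover
    (fun k : ℕ => Metric.ball (denseSeq ClosedSets k) ε) (fun _ => Metric.isOpen_ball)
    (fun A _ => by
      obtain ⟨k, hk⟩ := Metric.denseRange_iff.mp (denseRange_denseSeq ClosedSets) A ε hε
      exact mem_iUnion.mpr ⟨k, hk⟩)
  refine ⟨SimpleFunc.nearestPt (denseSeq ClosedSets) (t.sup id), fun A => ?_⟩
  obtain ⟨k, hk, hA⟩ := mem_iUnion₂.mp (ht (mem_univ A))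
  have h1 := SimpleFunc.edist_nearestPt_le (denseSeq ClosedSets) A (Finset.le_sup (f := id) hk)
  rw [edist_dist, edist_dist, ENNReal.ofReal_le_ofReal_iff dist_nonneg] at h1
  rw [dist_comm]
  refine h1.trans_lt ?_
  rw [dist_comm]
  exact hA

theorem continuousOn_chart {D : Opens ℂ} {φ : ℂ → ℍ}
    (hφ : DifferentiableOn ℂ (fun z => (φ z : ℂ)) D) : ContinuousOn φ D :=
  UpperHalfPlane.isOpenEmbedding_coe.isInducing.continuousOn_iff.mpr hφ.continuousOn

theorem isOpen_setOf_subset_off {D : Opens ℂ} {φ : ℂ → ℍ} (hφ : ContinuousOn φ D) {K : Set ℂ}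
    (hK : IsCompact K) (hKD : K ⊆ D) : IsOpen {A : ClosedSets | K ⊆ off D φ A} := by
  have hc : IsCompact ((fun z => HBar.ofUpper (φ z)) '' K) :=
    hK.image_of_continuousOn (continuous_ofUpper.comp_continuousOn (hφ.mono hKD))
  have := NonemptyCompacts.isOpen_subsets_of_isOpen hc.isClosed.isOpen_compl
  convert this using 1
  ext A
  constructor
  · rintro h p hp ⟨z, hz, rfl⟩
    exact (h hz).2 hp
  · intro h z hz
    exact ⟨hKD hz, fun hA => h hA ⟨z, hz, rfl⟩⟩

/-- The compact set `φ '' K` lies in the interior of `A_δ` if and only if one of its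
`1/(n+1)`-thickenings lies in `A_δ`. For fixed `n` this is a closed condition on `A`, since the
distance to `A` is continuous in `A`. -/
theorem measurableSet_subset_near {D : Opens ℂ} {φ : ℂ → ℍ} (hφ : ContinuousOn φ D) {K : Set ℂ}
    (hK : IsCompact K) (hKD : K ⊆ D) (δ : ℝ) :
    MeasurableSet {A : ClosedSets | K ⊆ near D φ A δ} := by
  have hc : IsCompact (φ '' K) := hK.image_of_continuousOn (hφ.mono hKD)
  have key : {A : ClosedSets | K ⊆ near D φ A δ} = ⋃ n : ℕ, ⋂ w ∈ Metric.thickening (1 / (n + 1 : ℝ)) (φ '' K),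
      {A : ClosedSets | Metric.infDist (HBar.ofUpper w) (A : Set HBar) ≤ δ} := by
    ext A
    simp only [mem_iUnion, mem_iInter, mem_ofPred_eq]
    constructor
    · intro h
      have h1 : φ '' K ⊆ interior (thick A δ) := by
        rintro _ ⟨z, hz, rfl⟩
        exact (h hz).2
      obtain ⟨r, hr, hr'⟩ := hc.exists_thickening_subset_open isOpen_interior h1
      obtain ⟨n, hn⟩ := exists_nat_one_div_lt hr
      exact ⟨n, fun w hw =>
        (interior_subset (hr' (Metric.thickening_mono hn.le _ hw)) : w ∈ thick A δ)⟩
    · rintro ⟨n, hn⟩ z hz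
      refine ⟨hKD hz, mem_interior.mpr ⟨_, hn, Metric.isOpen_thickening, ?_⟩⟩
      exact Metric.self_subset_thickening (by positivity) _ ⟨z, hz, rfl⟩
  rw [key]
  refine MeasurableSet.iUnion fun n => IsClosed.measurableSet ?_
  exact isClosed_biInter fun w _ => isClosed_le
    (Metric.lipschitz_infDist_set (HBar.ofUpper w)).continuous continuous_const

/-! ### Projections -/

theorem exists_test_of_mem_span {D : Opens ℂ} {U : Set ℂ} {x : DirichletSpace D}
    (hx : x ∈ Submodule.span ℝ {x | ∃ g : 𝓓(D, ℝ), tsupport g ⊆ U ∧ x = toH g}) :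
    ∃ g : 𝓓(D, ℝ), tsupport g ⊆ U ∧ x = toH g := by
  induction hx using Submodule.span_induction with
  | mem x hx => exact hx
  | zero => exact ⟨0, by simp [FunLike.coe_zero], (UniformSpace.Completion.coe_zero (α := DirichletTest D)).symm⟩
  | add x y _ _ hx hy =>
    obtain ⟨f, hf, rfl⟩ := hx
    obtain ⟨g, hg, rfl⟩ := hy
    refine ⟨f + g, ?_, (toH_add f g).symm⟩
    rw [FunLike.coe_add]
    exact (tsupport_add (f : ℂ → ℝ) (g : ℂ → ℝ)).trans (union_subset hf hg)
  | smul c x _ hx =>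
    obtain ⟨f, hf, rfl⟩ := hx
    refine ⟨c • f, ?_, (toH_smul c f).symm⟩
    rw [FunLike.coe_smul]
    exact (tsupport_smul_subset_right (fun _ => c) f).trans hf

theorem suppSpace_subset_closure (D : Opens ℂ) (U : Set ℂ) :
    (suppSpace D U : Set (DirichletSpace D)) ⊆
      closure {x | ∃ g : 𝓓(D, ℝ), tsupport g ⊆ U ∧ x = toH g} := by
  rw [suppSpace, Submodule.topologicalClosure_coe]
  exact closure_mono fun x hx => exists_test_of_mem_span hx

theorem suppSpace_mono (D : Opens ℂ) {U V : Set ℂ} (h : U ⊆ V) : suppSpace D U ≤ suppSpace D V := by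
  refine Submodule.topologicalClosure_mono (Submodule.span_mono ?_)
  rintro x ⟨g, hg, rfl⟩
  exact ⟨g, hg.trans h, rfl⟩

theorem suppSpace_self (D : Opens ℂ) : suppSpace D D = ⊤ := by
  have hc : IsClosed (suppSpace D D : Set (DirichletSpace D)) :=
    Submodule.isClosed_topologicalClosure _
  refine eq_top_iff.mpr fun x _ => ?_
  exact hc.closure_subset_iff.mpr
    (by rintro _ ⟨g, rfl⟩; exact toH_mem_suppSpace g.tsupport_subset) (denseRange_toH D x)

section Hilbert

variable {E : Type*} [NormedAddCommGroup E] [InnerProductSpace ℝ E]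

theorem inner_starProjection_of_mem (K : Submodule ℝ E) [K.HasOrthogonalProjection] (x : E) {s : E}
    (hs : s ∈ K) : inner ℝ (K.starProjection x) s = inner ℝ x s := by
  have := K.starProjection_inner_eq_zero x s hs
  rw [inner_sub_left, sub_eq_zero] at this
  exact this.symm

/-- This yields the variational formula: `‖P_K x‖²` is the maximum over `s ∈ K` of `2⟨x, s⟩ - ‖s‖²`.
-/
theorem norm_starProjection_sub_sq (K : Submodule ℝ E) [K.HasOrthogonalProjection] (x : E) {s : E}
    (hs : s ∈ K) :
    ‖K.starProjection x‖ ^ 2 - (2 * inner ℝ x s - ‖s‖ ^ 2) = ‖K.starProjection x - s‖ ^ 2 := by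
  rw [norm_sub_sq_real, inner_starProjection_of_mem K x hs]
  ring

/-- The subspaces need not be nested. Since `Kn n ≤ K`, only the vector `v = P_K x` matters; it is
close to some `s ∈ S`, and `s` is eventually fixed by the projections, which are contractions. -/
theorem tendsto_starProjection (K : Submodule ℝ E) [K.HasOrthogonalProjection]
    (Kn : ℕ → Submodule ℝ E) [∀ n, (Kn n).HasOrthogonalProjection] (hle : ∀ n, Kn n ≤ K) (S : Set E)
    (hS : (K : Set E) ⊆ closure S) (hev : ∀ s ∈ S, ∀ᶠ n in Filter.atTop, s ∈ Kn n) (x : E) :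
    Filter.Tendsto (fun n => (Kn n).starProjection x) Filter.atTop (𝓝 (K.starProjection x)) := by
  rw [Metric.tendsto_nhds]
  intro ε hε
  obtain ⟨s, hs, hd⟩ := Metric.mem_closure_iff.mp (hS (K.starProjection_apply_mem x)) (ε / 2)
    (half_pos hε)
  filter_upwards [hev s hs] with n hn
  have e1 : (Kn n).starProjection x = (Kn n).starProjection (K.starProjection x) := by
    have : (Kn n).starProjection (x - K.starProjection x) = 0 := by
      rw [Submodule.starProjection_apply_eq_zero_iff, Submodule.mem_orthogonal']
      exact fun y hy => K.starProjection_inner_eq_zero x y (hle n hy)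
    rwa [map_sub, sub_eq_zero] at this
  have e2 : (Kn n).starProjection s = s := Submodule.starProjection_eq_self_iff.mpr hn
  rw [e1, dist_eq_norm]
  set v := K.starProjection x
  have e3 : (Kn n).starProjection v - v = (Kn n).starProjection (v - s) - (v - s) := by
    rw [map_sub, e2]; abel
  rw [e3]
  rw [dist_eq_norm] at hd
  have := (Kn n).norm_starProjection_apply_le (v - s)
  linarith [norm_sub_le ((Kn n).starProjection (v - s)) (v - s)]

end Hilbert

theorem energy_eq {D : Opens ℂ} (hI : HasInvLap D) (U : Set ℂ) (ρ : 𝓓(D, ℝ)) :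
    (energy U ρ : ℝ) = ‖(suppSpace D U).starProjection (invLapHom hI ρ)‖ ^ 2 := rfl

theorem energy_self {D : Opens ℂ} (hI : HasInvLap D) (ρ : 𝓓(D, ℝ)) :
    (energy (D : Set ℂ) ρ : ℝ) = ‖invLapHom hI ρ‖ ^ 2 := by
  rw [energy_eq hI, Submodule.starProjection_eq_self_iff.mpr]
  rw [suppSpace_self]
  trivial

/-- The energy is lower semicontinuous in `A`. By the variational formula and density of test
functions, it exceeds `c` exactly when some test function supported off `A` witnesses this, and a
compact support that avoids `A` also avoids nearby closed sets. The union over test functions is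
uncountable but is a union of open sets. -/
theorem measurable_energy_off {D : Opens ℂ} {φ : ℂ → ℍ} (hφ : ContinuousOn φ D) (ρ : 𝓓(D, ℝ)) :
    Measurable fun A : ClosedSets => energy (off D φ A) ρ := by
  refine measurable_of_Ioi fun c => ?_
  have key : ((fun A : ClosedSets => energy (off D φ A) ρ) ⁻¹' Ioi c) =
      ⋃ (g : 𝓓(D, ℝ)) (_ : (c : ℝ) < 2 * inner ℝ (invLap ρ) (toH g) - ‖toH g‖ ^ 2),
        {A : ClosedSets | tsupport g ⊆ off D φ A} := by
    ext A
    simp only [mem_preimage, mem_Ioi, mem_iUnion, mem_ofPred_eq, exists_prop]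
    rw [← NNReal.coe_lt_coe]
    change (c : ℝ) < ‖_‖ ^ 2 ↔ _
    set K := suppSpace D (off D φ A)
    constructor
    · intro h
      have hcont : Continuous fun s : DirichletSpace D => 2 * inner ℝ (invLap ρ) s - ‖s‖ ^ 2 := by
        fun_prop
      have h1 := norm_starProjection_sub_sq K (invLap ρ) (K.starProjection_apply_mem (invLap ρ))
      rw [sub_self, norm_zero, zero_pow two_ne_zero, sub_eq_zero] at h1
      rw [h1] at h
      obtain ⟨x, hx, g, hg, rfl⟩ := mem_closure_iff.mp
        (suppSpace_subset_closure D _ (K.starProjection_apply_mem (invLap ρ))) _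
        (isOpen_lt continuous_const hcont) h
      exact ⟨g, hx, hg⟩
    · rintro ⟨g, hg, hs⟩
      have := norm_starProjection_sub_sq K (invLap ρ) (toH_mem_suppSpace hs)
      nlinarith [sq_nonneg ‖K.starProjection (invLap ρ) - toH g‖]
  rw [key]
  exact (isOpen_iUnion fun g => isOpen_iUnion fun _ =>
    isOpen_setOf_subset_off hφ g.hasCompactSupport g.tsupport_subset).measurableSet

/-! ### Locality of the projections near a closed set -/

theorem differentiableOn_cayley_chart {D : Opens ℂ} {φ : ℂ → ℍ}
    (hφ : DifferentiableOn ℂ (fun z => (φ z : ℂ)) D) :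
    DifferentiableOn ℂ (fun z => cayley (HBar.ofUpper (φ z))) D := by
  have : (fun z => cayley (HBar.ofUpper (φ z))) =
    fun z => ((φ z : ℂ) - Complex.I) / ((φ z : ℂ) + Complex.I) := rfl
  rw [this]
  exact (hφ.sub_const _).div (hφ.add_const _) fun z _ => add_I_ne_zero (φ z).im_pos.le

theorem norm_cayley_le_one (p : HBar) : ‖cayley p‖ ≤ 1 := by
  have : cayley p ∈ Set.range cayley := ⟨p, rfl⟩
  rw [range_cayley] at this
  exact mem_closedBall_zero_iff.mp this

theorem exists_cutoff {K : Set ℂ} (hK : IsCompact K) (hne : K.Nonempty) {ε : ℝ} (hε : 0 < ε) :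
    ∃ η : ℂ → ℝ, ContDiff ℝ (⊤ : ℕ∞) η ∧ (∀ w, |η w| ≤ 1) ∧ (∃ C, ∀ w, ‖fderiv ℝ η w‖ ≤ C) ∧
      tsupport η ⊆ {w | ε < Metric.infDist w K} ∧
      tsupport (fun w => 1 - η w) ⊆ {w | Metric.infDist w K < 2 * ε} := by
  have hc : Continuous fun w : ℂ => Metric.infDist w K := Metric.continuous_infDist_pt K
  -- The values `5/4` and `7/4` leave room strictly inside `(1, 2)`, so that the closed supports of
  -- `η` and `1 - η` satisfy the two strict inequalities.
  set s : Set ℂ := {w | Metric.infDist w K ≤ 5 / 4 * ε} with hs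
  set t : Set ℂ := {w | Metric.infDist w K ≤ 7 / 4 * ε} with ht
  have hst : s ⊆ interior t := by
    intro w hw
    rw [hs, mem_ofPred_eq] at hw
    refine mem_interior.mpr ⟨{w | Metric.infDist w K < 7 / 4 * ε}, ?_,
      isOpen_lt hc continuous_const, ?_⟩
    · intro x hx
      rw [mem_ofPred_eq] at hx
      exact hx.le
    · rw [mem_ofPred_eq]
      linarith
  obtain ⟨ζ, h1, h0, hr⟩ := exists_contMDiffMap_one_nhds_of_subset_interior
    (modelWithCornersSelf ℝ ℂ) (n := ⊤) (isClosed_le hc continuous_const : IsClosed s) hst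
  have hζ : ContDiff ℝ (⊤ : ℕ∞) ζ := ζ.contMDiff.contDiff
  have htc : IsClosed t := isClosed_le hc continuous_const
  have hζt : tsupport ζ ⊆ t := closure_minimal (fun w hw => by
    by_contra hwt
    exact hw (h0 w hwt)) htc
  have hcomp : HasCompactSupport ζ := by
    obtain ⟨x, hx⟩ := hne
    obtain ⟨R, hR⟩ := hK.isBounded.subset_closedBall x
    refine (isCompact_closedBall x (7 / 4 * ε + R)).of_isClosed_subset (isClosed_tsupport _) ?_
    intro w hw
    have hw' : Metric.infDist w K ≤ 7 / 4 * ε := hζt hw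
    obtain ⟨y, hy, hwy⟩ := hK.exists_infDist_eq_dist ⟨x, hx⟩ w
    rw [hwy] at hw'
    have := hR hy
    rw [Metric.mem_closedBall] at this ⊢
    linarith [dist_triangle w y x]
  obtain ⟨C, hC⟩ := (hcomp.fderiv ℝ).exists_bound_of_continuous (hζ.continuous_fderiv (by simp))
  refine ⟨fun w => 1 - ζ w, contDiff_const.sub hζ, fun w => ?_, ⟨C, fun w => ?_⟩, ?_, ?_⟩
  · have := hr w
    rw [mem_Icc] at this
    rw [abs_le]
    constructor <;> linarith
  · rw [fderiv_const_sub, norm_neg]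
    exact hC w
  · intro w hw
    by_contra hcon
    rw [mem_ofPred_eq, not_lt] at hcon
    have hws : w ∈ s := by rw [hs, mem_ofPred_eq]; linarith
    refine (notMem_tsupport_iff_eventuallyEq.mpr ?_) hw
    filter_upwards [h1.filter_mono (nhds_le_nhdsSet hws)] with x hx
    simp [hx]
  · simp only [sub_sub_cancel]
    intro w hw
    have hw' : Metric.infDist w K ≤ 7 / 4 * ε := hζt hw
    rw [mem_ofPred_eq]
    linarith

/-- The cutoff is a function on the disc composed with the bounded holomorphic map `Ψ ∘ φ`. As `Ψ`
is an isometry for `d_*`, Euclidean neighbourhoods of `Ψ(a)` correspond to `d_*`-neighbourhoods of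
`a`. -/
theorem coSupp_nbhd_le {D : Opens ℂ} (hI : HasInvLap D) {φ : ℂ → ℍ}
    (hφ : DifferentiableOn ℂ (fun z => (φ z : ℂ)) D) (a : ClosedSets) {ε : ℝ} (hε : 0 < ε) :
    coSupp hI (nbhd D φ a (2 * ε)) ≤ suppSpace D (far D φ a ε) := by
  obtain ⟨η, hη, h1, ⟨C, hC⟩, hV, hN⟩ := exists_cutoff (K := cayley '' (a : Set HBar))
    (a.isCompact.image isometry_cayley.continuous) (a.nonempty.image _) hε
  have := coSupp_le_suppSpace hI (differentiableOn_cayley_chart hφ)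
    (fun z _ => norm_cayley_le_one _) hη h1 hC hV hN
  simp only [mem_ofPred_eq, Metric.infDist_image isometry_cayley] at this
  exact this

/-- As `r → 0` and `a → A`, the projections off the `r`-neighbourhoods of `a` converge to the
projection on `Supp (D ∖ A)`. -/
theorem eventually_disjoint_nbhd {D : Opens ℂ} {φ : ℂ → ℍ} (hφ : ContinuousOn φ D)
    (A : ClosedSets) (a : ℕ → ClosedSets) {ε : ℕ → ℝ}
    (hε0 : Filter.Tendsto ε Filter.atTop (𝓝 0)) (ha : ∀ n, dist A (a n) < ε n) {g : 𝓓(D, ℝ)}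
    (hg : tsupport g ⊆ off D φ A) :
    ∀ᶠ n in Filter.atTop, Disjoint (tsupport g) (nbhd D φ (a n) (2 * ε n)) := by
  have hc := continuous_ofUpper.comp_continuousOn (hφ.mono g.tsupport_subset)
  obtain ⟨r, hr, hr'⟩ : ∃ r > 0, ∀ z ∈ tsupport g,
      r ≤ Metric.infDist (HBar.ofUpper (φ z)) (A : Set HBar) := by
    rcases (tsupport g).eq_empty_or_nonempty with h0 | hne
    · exact ⟨1, one_pos, by simp [h0]⟩
    · obtain ⟨z, hz, hmin⟩ := IsCompact.exists_isMinOn g.hasCompactSupport hne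
        ((continuous_infDist_left A).comp_continuousOn hc)
      refine ⟨_, ?_, fun w hw => hmin hw⟩
      exact (A.isCompact.isClosed.notMem_iff_infDist_pos A.nonempty).mp (hg hz).2
  -- A point within `2 ε n` of `a n` is within `3 ε n` of `A`.
  filter_upwards [hε0.eventually (gt_mem_nhds (show (0 : ℝ) < r / 3 by positivity))] with n hn
  refine Set.disjoint_left.mpr fun z hz hz' => ?_
  have h1 := hr' z hz
  have h2 := infDist_le_infDist_add_dist (HBar.ofUpper (φ z)) A (a n)
  have h3 := hz'.2
  linarith [ha n]

/-- The spaces `coSupp` are squeezed: they lie in `Supp (D ∖ A)` by the cutoff argument, and each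
test function supported off `A` eventually belongs to them. -/
theorem tendsto_starProjection_coSupp {D : Opens ℂ} (hI : HasInvLap D) {φ : ℂ → ℍ}
    (hφ : DifferentiableOn ℂ (fun z => (φ z : ℂ)) D) (A : ClosedSets) (a : ℕ → ClosedSets)
    {ε : ℕ → ℝ} (hε : ∀ n, 0 < ε n) (hε0 : Filter.Tendsto ε Filter.atTop (𝓝 0))
    (ha : ∀ n, dist A (a n) < ε n) (x : DirichletSpace D) :
    Filter.Tendsto (fun n => (coSupp hI (nbhd D φ (a n) (2 * ε n))).starProjection x) Filter.atTop
      (𝓝 ((suppSpace D (off D φ A)).starProjection x)) := by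
  refine tendsto_starProjection _ _ (fun n => ?_) _ (suppSpace_subset_closure D _) ?_ x
  · exact (coSupp_nbhd_le hI hφ (a n) (hε n)).trans
      (suppSpace_mono D (far_subset_off (subset_thickening_of_dist_le (ha n).le)))
  · rintro _ ⟨g, hg, rfl⟩
    filter_upwards [eventually_disjoint_nbhd (continuousOn_chart hφ) A a hε0 ha hg] with n hn
    exact toH_mem_coSupp hI hn

end

/-! ### The field as a Gaussian Hilbert space, through characteristic functionals. -/

section

open scoped Topology ENNReal

/-! ### The functions `e^{i x}` and conditional expectations -/

/-- `e^{i x}`. -/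
def expI (x : ℝ) : ℂ := Complex.exp (x * Complex.I)

theorem norm_expI (x : ℝ) : ‖expI x‖ = 1 := Complex.norm_exp_ofReal_mul_I x

theorem expI_zero : expI 0 = 1 := by simp [expI]

theorem expI_add (x y : ℝ) : expI (x + y) = expI x * expI y := by
  simp only [expI]; rw [← Complex.exp_add]; push_cast; ring_nf

theorem conj_expI (x : ℝ) : (starRingEnd ℂ) (expI x) = expI (-x) := by
  simp [expI, ← Complex.exp_conj]

theorem continuous_expI : Continuous expI :=
  Complex.continuous_exp.comp (Complex.continuous_ofReal.mul continuous_const)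

theorem measurable_expI : Measurable expI := continuous_expI.measurable

theorem norm_expI_sub_le (x y : ℝ) : ‖expI x - expI y‖ ≤ |x - y| := by
  have h : expI x - expI y = expI y * (expI (x - y) - 1) := by
    rw [mul_sub, ← expI_add]; simp
  rw [h, norm_mul, norm_expI, one_mul]
  have := Real.norm_exp_I_mul_ofReal_sub_one_le (x := x - y)
  rw [Real.norm_eq_abs, mul_comm Complex.I] at this
  exact this

theorem charFun_eq_integral_expI (μ : Measure ℝ) (t : ℝ) : charFun μ t = ∫ x, expI (t * x) ∂μ := by
  rw [charFun_apply_real]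
  simp [expI]

section CondExp

variable {Ω : Type*} {mΩ : MeasurableSpace Ω} {P : Measure Ω}

theorem integrable_of_bounded [IsFiniteMeasure P] {Z : Ω → ℂ} (hZ : AEStronglyMeasurable Z P) {C : ℝ}
    (h : ∀ ω, ‖Z ω‖ ≤ C) : Integrable Z P :=
  Integrable.of_bound hZ C (.of_forall h)

theorem aestronglyMeasurable_expI {m : MeasurableSpace Ω} {f : Ω → ℝ}
    (hf : AEStronglyMeasurable[m] f P) : AEStronglyMeasurable[m] (fun ω => expI (f ω)) P :=
  continuous_expI.comp_aestronglyMeasurable hf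

theorem condExp_mul_eq_zero {m : MeasurableSpace Ω} {f Z : Ω → ℂ} (hZ : Integrable Z P)
    (h0 : P[Z | m] =ᵐ[P] 0) (hf : AEStronglyMeasurable[m] f P)
    (hfZ : Integrable (fun ω => f ω * Z ω) P) : P[fun ω => f ω * Z ω | m] =ᵐ[P] 0 := by
  refine (condExp_bilin_of_aestronglyMeasurable_left (ContinuousLinearMap.mul ℝ ℂ) hf hfZ hZ).trans ?_
  filter_upwards [h0] with ω hω
  simp [hω]

theorem integral_mul_eq_zero [IsFiniteMeasure P] {m : MeasurableSpace Ω} (hm : m ≤ mΩ) {f Z : Ω → ℂ}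
    (hZ : Integrable Z P) (h0 : P[Z | m] =ᵐ[P] 0) (hf : AEStronglyMeasurable[m] f P)
    (hfZ : Integrable (fun ω => f ω * Z ω) P) : ∫ ω, f ω * Z ω ∂P = 0 := by
  rw [← integral_condExp hm, integral_congr_ae (condExp_mul_eq_zero hZ h0 hf hfZ)]
  simp

theorem condExp_eq_zero_iff [IsFiniteMeasure P] {E : Type*} [NormedAddCommGroup E] [NormedSpace ℝ E] [CompleteSpace E]
    {m : MeasurableSpace Ω} (hm : m ≤ mΩ) {Z : Ω → E} (hZ : Integrable Z P) :
    P[Z | m] =ᵐ[P] 0 ↔ ∀ F, MeasurableSet[m] F → ∫ ω in F, Z ω ∂P = 0 := by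
  constructor
  · intro h F hF
    rw [← setIntegral_condExp hm hZ hF, setIntegral_congr_ae (g := 0)]
    · simp
    · exact hm _ hF
    · filter_upwards [h] with ω hω _ using hω
  · intro h
    refine (ae_eq_condExp_of_forall_setIntegral_eq hm hZ (g := 0) ?_ ?_ ?_).symm
    · exact fun _ _ _ => (integrable_zero _ _ _).integrableOn
    · intro F hF _
      rw [h F hF]
      simp
    · exact aestronglyMeasurable_zero

/-- If `f` is close to `g` in `L²`, then `∫ Z e^{i f}` is close to `∫ Z e^{i g}`, for bounded `Z`. -/
theorem continuous_integral_mul_expI [IsProbabilityMeasure P] {Z : Ω → ℂ} (hZ : AEStronglyMeasurable Z P) {C : ℝ}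
    (hC : ∀ ω, ‖Z ω‖ ≤ C) : Continuous fun f : Lp ℝ 2 P => ∫ ω, Z ω * expI (f ω) ∂P := by
  have hC0 : 0 ≤ C := by
    have : Nonempty Ω := nonempty_of_isProbabilityMeasure P
    exact (norm_nonneg _).trans (hC (Classical.arbitrary Ω))
  have hint : ∀ f : Lp ℝ 2 P, Integrable (fun ω => Z ω * expI (f ω)) P := fun f =>
    integrable_of_bounded (hZ.mul (aestronglyMeasurable_expI (Lp.aestronglyMeasurable f))) (C := C)
      fun ω => by rw [norm_mul, norm_expI, mul_one]; exact hC ω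
  refine (LipschitzWith.of_dist_le_mul (K := ⟨C, hC0⟩) fun f g => ?_).continuous
  rw [dist_eq_norm, ← integral_sub (hint f) (hint g)]
  have hfg : Integrable (fun ω => |(f - g : Lp ℝ 2 P) ω|) P :=
    ((Lp.memLp (f - g)).integrable one_le_two).abs
  calc ‖∫ ω, (Z ω * expI (f ω) - Z ω * expI (g ω)) ∂P‖
      ≤ ∫ ω, C * |(f - g : Lp ℝ 2 P) ω| ∂P := by
        refine norm_integral_le_of_norm_le (hfg.const_mul C) ?_
        filter_upwards [Lp.coeFn_sub f g] with ω hω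
        rw [← mul_sub, norm_mul, hω]
        exact mul_le_mul (hC ω) (norm_expI_sub_le _ _) (norm_nonneg _) hC0
    _ ≤ C * dist f g := by
        rw [integral_const_mul]
        refine mul_le_mul_of_nonneg_left ?_ hC0
        rw [dist_eq_norm]
        have h1 : ∫ ω, |(f - g : Lp ℝ 2 P) ω| ∂P = (eLpNorm (f - g : Lp ℝ 2 P) 1 P).toReal := by
          rw [eLpNorm_one_eq_lintegral_enorm,
            ← integral_norm_eq_lintegral_enorm (Lp.aestronglyMeasurable _)]
          rfl
        rw [h1, Lp.norm_def]
        refine ENNReal.toReal_mono (Lp.eLpNorm_ne_top _) ?_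
        exact eLpNorm_le_eLpNorm_of_exponent_le one_le_two (Lp.aestronglyMeasurable _)

end CondExp

/-! ### σ-algebras generated by pairings -/

/-- The test functions supported in `N`. -/
def testIn (D : Opens ℂ) (N : Set ℂ) : Submodule ℝ 𝓓(D, ℝ) where
  carrier := {ρ | tsupport ρ ⊆ N}
  zero_mem' := by simp [FunLike.coe_zero]
  add_mem' {f g} hf hg := by
    rw [mem_ofPred_eq, FunLike.coe_add] at *
    exact (tsupport_add (f : ℂ → ℝ) (g : ℂ → ℝ)).trans (union_subset hf hg)
  smul_mem' c f hf := by
    rw [mem_ofPred_eq, FunLike.coe_smul] at *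
    exact (tsupport_smul_subset_right (fun _ => c) f).trans hf

variable {Ω : Type*}

/-- The σ-algebra generated by the pairings of `h` with the test functions in `L`. -/
@[reducible]
def sigmaTest {D : Opens ℂ} (h : Ω → 𝓓'(D, ℝ)) (L : Submodule ℝ 𝓓(D, ℝ)) : MeasurableSpace Ω :=
  ⨆ ρ : L, MeasurableSpace.comap (fun ω => h ω ρ) inferInstance

theorem measurable_sigmaTest {D : Opens ℂ} (h : Ω → 𝓓'(D, ℝ)) {L : Submodule ℝ 𝓓(D, ℝ)}
    {ρ : 𝓓(D, ℝ)} (hρ : ρ ∈ L) : Measurable[sigmaTest h L] fun ω => h ω ρ := by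
  rw [measurable_iff_comap_le]
  exact le_iSup (fun ρ : L => MeasurableSpace.comap (fun ω => h ω ρ) inferInstance) ⟨ρ, hρ⟩

theorem sigmaTest_mono {D : Opens ℂ} (h : Ω → 𝓓'(D, ℝ)) {L L' : Submodule ℝ 𝓓(D, ℝ)}
    (hL : L ≤ L') : sigmaTest h L ≤ sigmaTest h L' :=
  iSup_le fun ρ => (measurable_sigmaTest h (hL ρ.2)).comap_le

theorem sigmaTest_top {D : Opens ℂ} (h : Ω → 𝓓'(D, ℝ)) :
    sigmaTest h ⊤ = MeasurableSpace.comap h inferInstance := by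
  change _ = MeasurableSpace.comap h (⨆ ρ : 𝓓(D, ℝ), MeasurableSpace.comap _ _)
  rw [MeasurableSpace.comap_iSup]
  refine le_antisymm (iSup_le fun ρ => ?_) (iSup_le fun ρ => ?_)
  · refine le_iSup_of_le ρ.1 ?_
    rw [MeasurableSpace.comap_comp]
    rfl
  · refine le_iSup_of_le ⟨ρ, trivial⟩ ?_
    rw [MeasurableSpace.comap_comp]
    rfl

theorem measurable_eval {D : Opens ℂ} (ρ : 𝓓(D, ℝ)) : Measurable fun T : 𝓓'(D, ℝ) => T ρ := by
  rw [measurable_iff_comap_le]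
  exact le_iSup (fun ρ : 𝓓(D, ℝ) => MeasurableSpace.comap (fun T : 𝓓'(D, ℝ) => T ρ) inferInstance) ρ

theorem measurable_distribution_iff {D : Opens ℂ} {m : MeasurableSpace Ω} {h : Ω → 𝓓'(D, ℝ)} :
    Measurable h ↔ ∀ ρ, Measurable fun ω => h ω ρ := by
  refine ⟨fun hh ρ => (measurable_eval ρ).comp hh, fun hh => ?_⟩
  rw [measurable_iff_comap_le, ← sigmaTest_top]
  exact iSup_le fun ρ => (hh ρ).comap_le

theorem sigmaTest_le {D : Opens ℂ} {m : MeasurableSpace Ω} {h : Ω → 𝓓'(D, ℝ)} (hh : Measurable h)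
    (L : Submodule ℝ 𝓓(D, ℝ)) : sigmaTest h L ≤ m :=
  iSup_le fun ρ => ((measurable_eval ρ.1).comp hh).comap_le

/-! ### Uniqueness of characteristic functionals -/

/-- The positive and negative parts of `Z` are densities of two finite measures. Their images under
the family of pairings have the same characteristic functions on finitely many coordinates, hence
the same finite-dimensional marginals, hence coincide. -/
theorem setIntegral_eq_zero_of_expI_real {mΩ : MeasurableSpace Ω} {P : Measure Ω}
    [IsProbabilityMeasure P] {D : Opens ℂ} {h : Ω → 𝓓'(D, ℝ)} (hh : Measurable h)
    (L : Submodule ℝ 𝓓(D, ℝ)) {Z : Ω → ℝ} (hZ : Integrable Z P)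
    (h0 : ∀ ρ ∈ L, ∫ ω, (Z ω : ℂ) * expI (h ω ρ) ∂P = 0) {F : Set Ω}
    (hF : MeasurableSet[sigmaTest h L] F) : ∫ ω in F, Z ω ∂P = 0 := by
  classical
  have hev : ∀ ρ, Measurable fun ω => h ω ρ := fun ρ => (measurable_eval ρ).comp hh
  let H : Ω → (L → ℝ) := fun ω ρ => h ω ρ
  have hH : Measurable H := measurable_pi_lambda _ fun ρ => hev ρ
  set μ := P.withDensity fun ω => ENNReal.ofReal (Z ω) with hμ
  set ν := P.withDensity fun ω => ENNReal.ofReal (-Z ω) with hν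
  have : IsFiniteMeasure μ := isFiniteMeasure_withDensity_ofReal hZ.2
  have : IsFiniteMeasure ν := isFiniteMeasure_withDensity_ofReal hZ.neg.2
  have hint : ∀ (W : Ω → ℝ) (_ : Integrable W P) (f : Ω → ℂ) (_ : Measurable f),
      ∫ ω, f ω ∂(P.withDensity fun ω => ENNReal.ofReal (W ω)) =
        ∫ ω, ((max (W ω) 0 : ℝ) : ℂ) * f ω ∂P := by
    intro W hW f hf
    rw [integral_withDensity_eq_integral_toReal_smul₀ hW.aemeasurable.ennreal_ofReal
      (.of_forall fun _ => ENNReal.ofReal_lt_top)]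
    simp only [ENNReal.toReal_ofReal', Complex.real_smul]
  have hmap : μ.map H = ν.map H := by
    refine IsProjectiveLimit.unique (P := fun I => (ν.map H).map I.restrict) (fun I => ?_)
      fun I => rfl
    have hr : Measurable (I.restrict : (L → ℝ) → (I → ℝ)) :=
      measurable_pi_lambda _ fun _ => measurable_pi_apply _
    change (μ.map H).map I.restrict = (ν.map H).map I.restrict
    refine Measure.ext_of_charFunDual ?_
    ext ℓ
    rw [charFunDual_apply, charFunDual_apply, Measure.map_map hr hH, Measure.map_map hr hH]
    have hm : Measurable fun x : I → ℝ => Complex.exp (ℓ x * Complex.I) := by fun_prop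
    rw [integral_map (hr.comp hH).aemeasurable hm.aestronglyMeasurable,
      integral_map (hr.comp hH).aemeasurable hm.aestronglyMeasurable]
    -- A linear functional of finitely many pairings is itself one pairing, because `L` is a linear
    -- space.
    set ρ : 𝓓(D, ℝ) := ∑ i : I, ℓ (Pi.single i (1 : ℝ)) • (i : L).1 with hρ
    have hρL : ρ ∈ L := L.sum_mem fun i _ => L.smul_mem _ (i : L).2
    have key : ∀ ω, ℓ ((I.restrict ∘ H) ω) = h ω ρ := by
      intro ω
      have : (I.restrict ∘ H) ω = ∑ i : I, h ω (i : L).1 • (Pi.single i (1 : ℝ) : I → ℝ) := by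
        ext j
        simp [Finset.sum_apply, Pi.single_apply, H]
      rw [this, map_sum, hρ, map_sum]
      refine Finset.sum_congr rfl fun i _ => ?_
      rw [map_smul, map_smul, smul_eq_mul, smul_eq_mul, mul_comm]
    simp only [key]
    have hmeas : Measurable fun ω => expI (h ω ρ) := measurable_expI.comp (hev ρ)
    change ∫ ω, expI (h ω ρ) ∂μ = ∫ ω, expI (h ω ρ) ∂ν
    rw [hμ, hν, hint Z hZ _ hmeas, hint (fun ω => -Z ω) hZ.neg _ hmeas, ← sub_eq_zero]
    have hb : ∀ W : Ω → ℝ, Integrable W P →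
        Integrable (fun ω => ((max (W ω) 0 : ℝ) : ℂ) * expI (h ω ρ)) P := fun W hW =>
      (hW.pos_part.ofReal (𝕜 := ℂ)).mul_bdd (c := 1) hmeas.aestronglyMeasurable
        (.of_forall fun ω => (norm_expI _).le)
    rw [← integral_sub (hb Z hZ) (hb (fun ω => -Z ω) hZ.neg), ← h0 ρ hρL]
    congr 1
    ext ω
    rw [← sub_mul, ← Complex.ofReal_sub]
    congr 2
    rcases le_total (Z ω) 0 with hz | hz
    · rw [max_eq_right hz, max_eq_left (by linarith)]; ring
    · rw [max_eq_left hz, max_eq_right (by linarith)]; ring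
  have hsig : sigmaTest h L = MeasurableSpace.comap H MeasurableSpace.pi := by
    rw [MeasurableSpace.pi, MeasurableSpace.comap_iSup]
    simp only [MeasurableSpace.comap_comp]
    rfl
  rw [hsig] at hF
  obtain ⟨S, hS, rfl⟩ := hF
  have e := congrArg (fun μ => μ S) hmap
  rw [Measure.map_apply hH hS, Measure.map_apply hH hS, hμ, hν,
    withDensity_apply _ (hH hS), withDensity_apply _ (hH hS)] at e
  rw [integral_eq_lintegral_pos_part_sub_lintegral_neg_part hZ.integrableOn, e, sub_self]

theorem condExp_eq_zero_of_expI {mΩ : MeasurableSpace Ω} {P : Measure Ω}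
    [IsProbabilityMeasure P] {D : Opens ℂ} {h : Ω → 𝓓'(D, ℝ)} (hh : Measurable h)
    (L : Submodule ℝ 𝓓(D, ℝ)) {Z : Ω → ℂ} (hZ : Integrable Z P)
    (h0 : ∀ ρ ∈ L, ∫ ω, Z ω * expI (h ω ρ) ∂P = 0) : P[Z | sigmaTest h L] =ᵐ[P] 0 := by
  have hev : ∀ ρ, Measurable fun ω => h ω ρ := fun ρ => (measurable_eval ρ).comp hh
  have hi : ∀ (W : Ω → ℂ) (_ : Integrable W P) ρ, Integrable (fun ω => W ω * expI (h ω ρ)) P :=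
    fun W hW ρ => hW.mul_bdd (c := 1) (measurable_expI.comp (hev ρ)).aestronglyMeasurable
        (.of_forall fun ω => (norm_expI _).le)
  have hZc : Integrable (fun ω => (starRingEnd ℂ) (Z ω)) P :=
    Complex.conjCLE.toContinuousLinearMap.integrable_comp hZ
  have h1 : ∀ ρ ∈ L, ∫ ω, (starRingEnd ℂ) (Z ω) * expI (h ω ρ) ∂P = 0 := by
    intro ρ hρ
    -- Conjugating the hypothesis at `-ρ` gives it for the conjugate of `Z` at `ρ`, and hence for
    -- the real and imaginary parts separately.
    have := congrArg (starRingEnd ℂ) (h0 (-ρ) (L.neg_mem hρ))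
    rw [← integral_conj, map_zero] at this
    simpa [conj_expI] using this
  rw [condExp_eq_zero_iff (sigmaTest_le hh L) hZ]
  intro F hF
  have hre := setIntegral_eq_zero_of_expI_real hh L hZ.re (fun ρ hρ => by
    have : ∀ ω, ((RCLike.re (Z ω) : ℝ) : ℂ) * expI (h ω ρ) = (1 / 2 : ℂ) *
        (Z ω * expI (h ω ρ) + (starRingEnd ℂ) (Z ω) * expI (h ω ρ)) := fun ω => by
      have : ((RCLike.re (Z ω) : ℝ) : ℂ) = (Z ω + (starRingEnd ℂ) (Z ω)) / 2 :=
        Complex.re_eq_add_conj _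
      rw [this]; ring
    simp only [this]
    rw [integral_const_mul, integral_add (hi Z hZ ρ) (hi _ hZc ρ), h0 ρ hρ, h1 ρ hρ]
    simp) hF
  have him := setIntegral_eq_zero_of_expI_real hh L hZ.im (fun ρ hρ => by
    have : ∀ ω, ((RCLike.im (Z ω) : ℝ) : ℂ) * expI (h ω ρ) = (1 / (2 * Complex.I) : ℂ) *
        (Z ω * expI (h ω ρ) - (starRingEnd ℂ) (Z ω) * expI (h ω ρ)) := fun ω => by
      have : ((RCLike.im (Z ω) : ℝ) : ℂ) = (Z ω - (starRingEnd ℂ) (Z ω)) / (2 * Complex.I) :=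
        Complex.im_eq_sub_conj _
      rw [this]; ring
    simp only [this]
    rw [integral_const_mul, integral_sub (hi Z hZ ρ) (hi _ hZc ρ), h0 ρ hρ, h1 ρ hρ]
    simp) hF
  rw [← integral_re_add_im hZ.integrableOn, hre, him]
  simp

end

section

open scoped Topology ENNReal

/-! ### Existence of the inverse Laplacian -/

/-- Dividing `F` repeatedly by `z - a`, after subtracting the value at `a`, keeps it holomorphic and
bounded on `D`. Injectivity makes `F` nonconstant near `a`, so after finitely many divisions the
linear coefficient at `a` is nonzero. -/
theorem exists_bounded_deriv_ne_zero {D : Opens ℂ} {F : ℂ → ℂ} (hF : DifferentiableOn ℂ F D)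
    (hF1 : ∀ z ∈ D, ‖F z‖ ≤ 1) (hinj : InjOn F D) {a : ℂ} (ha : a ∈ D) :
    ∃ G : ℂ → ℂ, DifferentiableOn ℂ G D ∧ (∀ z ∈ D, ‖G z‖ ≤ 1) ∧ deriv G a ≠ 0 := by
  have hD : (D : Set ℂ) ∈ 𝓝 a := D.isOpen.mem_nhds ha
  have hiter : ∀ n : ℕ, DifferentiableOn ℂ ((Function.swap dslope a)^[n] F) D ∧
      ∃ C, ∀ z ∈ D, ‖(Function.swap dslope a)^[n] F z‖ ≤ C := by
    intro n
    induction n with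
    | zero => exact ⟨hF, 1, hF1⟩
    | succ n ih =>
      obtain ⟨hd, C, hC⟩ := ih
      rw [Function.iterate_succ_apply']
      set f := (Function.swap dslope a)^[n] F
      have hd' : DifferentiableOn ℂ (dslope f a) D := (Complex.differentiableOn_dslope hD).2 hd
      refine ⟨hd', ?_⟩
      have hb : ∀ᶠ z in 𝓝 a, ‖dslope f a z‖ < ‖dslope f a a‖ + 1 :=
        ((hd'.differentiableAt hD).continuousAt.norm).eventually_lt_const (lt_add_one _)
      obtain ⟨r, hr, hrb⟩ := Metric.eventually_nhds_iff.1 hb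
      refine ⟨max (‖dslope f a a‖ + 1) (r⁻¹ * (C + C)), fun z hz => ?_⟩
      rcases lt_or_ge (dist z a) r with hza | hza
      · exact (hrb hza).le.trans (le_max_left _ _)
      · refine le_trans ?_ (le_max_right _ _)
        have hne : z ≠ a := fun h => by
          rw [h, dist_self] at hza
          exact absurd hza (not_le.2 hr)
        change ‖dslope f a z‖ ≤ _
        rw [dslope_of_ne _ hne, slope_def_module, norm_smul, norm_inv]
        rw [dist_eq_norm] at hza
        exact mul_le_mul (inv_anti₀ hr hza)
          ((norm_sub_le _ _).trans (add_le_add (hC z hz) (hC a ha))) (norm_nonneg _)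
          (inv_nonneg.2 hr.le)
  obtain ⟨p, hp⟩ := (hF.analyticAt hD)
  have hq : p.fslope ≠ 0 := by
    intro h0
    have h1 := hp.has_fpower_series_dslope_fslope
    rw [h0] at h1
    have h2 := h1.eventually_eq_zero
    obtain ⟨b, hb, hbD, hba⟩ : ∃ b, dslope F a b = 0 ∧ b ∈ D ∧ b ≠ a := by
      have h3 : ∀ᶠ z in 𝓝[≠] a, dslope F a z = 0 ∧ z ∈ D ∧ z ≠ a := by
        filter_upwards [nhdsWithin_le_nhds h2, nhdsWithin_le_nhds hD, self_mem_nhdsWithin]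
          with z h4 h5 h6 using ⟨h4, h5, h6⟩
      exact h3.exists
    rw [dslope_of_ne _ hba, slope_def_module, smul_eq_zero, inv_eq_zero, sub_eq_zero,
      sub_eq_zero] at hb
    exact hb.elim hba fun h => hba (hinj hbD ha h)
  have hne := hp.has_fpower_series_dslope_fslope.iterate_dslope_fslope_ne_zero hq
  obtain ⟨hd, C, hC⟩ := hiter p.fslope.order
  set f := (Function.swap dslope a)^[p.fslope.order] F
  have hf : deriv f a ≠ 0 := by
    have e : (Function.swap dslope a)^[p.fslope.order] (dslope F a) = dslope f a :=
      (Function.iterate_succ_apply (Function.swap dslope a) p.fslope.order F).symm.trans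
        (Function.iterate_succ_apply' (Function.swap dslope a) p.fslope.order F)
    rwa [e, dslope_same] at hne
  have hC0 : 0 < |C| + 1 := by positivity
  refine ⟨fun z => ((|C| + 1 : ℝ) : ℂ)⁻¹ * f z, hd.const_mul _, fun z hz => ?_, ?_⟩
  · rw [norm_mul, norm_inv, Complex.norm_real, Real.norm_eq_abs, abs_of_pos hC0,
      inv_mul_le_one₀ hC0]
    linarith [hC z hz, le_abs_self C]
  · rw [deriv_const_mul_field]
    exact mul_ne_zero (inv_ne_zero (Complex.ofReal_ne_zero.2 hC0.ne')) hf

/-- A local Poincaré inequality: if `D` carries an injective bounded holomorphic function, then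
the `L²` norm on a compact subset of `D` is bounded by the Dirichlet norm. -/
theorem exists_setIntegral_sq_le {D : Opens ℂ} {F : ℂ → ℂ} (hF : DifferentiableOn ℂ F D)
    (hF1 : ∀ z ∈ D, ‖F z‖ ≤ 1) (hinj : InjOn F D) {K : Set ℂ} (hK : IsCompact K) (hKD : K ⊆ D) :
    ∃ C : ℝ, 0 ≤ C ∧ ∀ g : 𝓓(D, ℝ), ∫ z in K, g z ^ 2 ≤ C * dirichletInner g g := by
  have hint : ∀ g : 𝓓(D, ℝ), Integrable (fun z => g z ^ 2) (volume : Measure ℂ) := fun g => by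
    simpa only [sq] using integrable_mul g g
  have hnn : ∀ g : 𝓓(D, ℝ), 0 ≤ dirichletInner g g := fun g =>
    integral_nonneg fun z => add_nonneg (mul_self_nonneg _) (mul_self_nonneg _)
  refine hK.induction_on (p := fun K : Set ℂ => ∃ C : ℝ, 0 ≤ C ∧ ∀ g : 𝓓(D, ℝ),
    ∫ z in K, g z ^ 2 ≤ C * dirichletInner g g) ⟨0, le_rfl, by simp⟩ ?_ ?_ ?_
  · rintro s t hst ⟨C, hC, h⟩
    refine ⟨C, hC, fun g => le_trans ?_ (h g)⟩
    exact integral_mono_measure (Measure.restrict_mono hst le_rfl)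
      (.of_forall fun z => sq_nonneg _) (hint g).integrableOn
  · rintro s t ⟨C, hC, h⟩ ⟨C', hC', h'⟩
    refine ⟨C + C', add_nonneg hC hC', fun g => ?_⟩
    calc ∫ z in s ∪ t, g z ^ 2
        ≤ ∫ z, g z ^ 2 ∂(volume.restrict s + volume.restrict t) :=
          integral_mono_measure (Measure.restrict_union_le s t) (.of_forall fun z => sq_nonneg _)
            ((hint g).restrict.add_measure (hint g).restrict)
      _ = (∫ z in s, g z ^ 2) + ∫ z in t, g z ^ 2 :=
          integral_add_measure (hint g).integrableOn (hint g).integrableOn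
      _ ≤ (C + C') * dirichletInner g g := by rw [add_mul]; exact add_le_add (h g) (h' g)
  · intro a haK
    have ha : a ∈ D := hKD haK
    -- The weight in `weighted_poincare` for this `G` is bounded below near `a`, so it dominates the
    -- plain `L²` norm there.
    obtain ⟨G, hG, hG1, hGa⟩ := exists_bounded_deriv_ne_zero hF hF1 hinj ha
    have hc : ContinuousAt (fun z => ‖deriv G z‖) a :=
      ((hG.deriv D.isOpen).differentiableAt (D.isOpen.mem_nhds ha)).continuousAt.norm
    have hpos : 0 < ‖deriv G a‖ / 2 := half_pos (norm_pos_iff.2 hGa)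
    have hev : ∀ᶠ z in 𝓝 a, ‖deriv G a‖ / 2 < ‖deriv G z‖ :=
      hc.eventually_const_lt (half_lt_self (norm_pos_iff.2 hGa))
    obtain ⟨V, hV, hVo, haV⟩ := eventually_nhds_iff.1 hev
    refine ⟨V, mem_nhdsWithin_of_mem_nhds (hVo.mem_nhds haV),
      ((‖deriv G a‖ / 2) ^ 2)⁻¹ * 4, by positivity, fun g => ?_⟩
    obtain ⟨hwi, hw⟩ := weighted_poincare hG hG1 g
    rw [mul_assoc]
    refine le_trans ?_ (mul_le_mul_of_nonneg_left hw (by positivity))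
    rw [← integral_const_mul]
    refine le_trans (setIntegral_mono_on (hint g).integrableOn (hwi.const_mul _).integrableOn
      hVo.measurableSet fun z hz => ?_) (setIntegral_le_integral (hwi.const_mul _)
        (.of_forall fun z => by positivity))
    rw [inv_mul_eq_div, le_div_iff₀ (by positivity)]
    exact mul_le_mul_of_nonneg_left (pow_le_pow_left₀ hpos.le (hV z hz).le 2) (sq_nonneg _)

/-- `-Δ⁻¹` is defined on a domain that carries an injective bounded holomorphic function. -/
theorem hasInvLap_of_injOn {D : Opens ℂ} {F : ℂ → ℂ} (hF : DifferentiableOn ℂ F D)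
    (hF1 : ∀ z ∈ D, ‖F z‖ ≤ 1) (hinj : InjOn F D) : HasInvLap D := by
  intro ρ
  obtain ⟨C, hC, hCg⟩ := exists_setIntegral_sq_le hF hF1 hinj ρ.hasCompactSupport ρ.tsupport_subset
  have hint : ∀ g : 𝓓(D, ℝ), Integrable (fun z => g z ^ 2) (volume : Measure ℂ) := fun g => by
    simpa only [sq] using integrable_mul g g
  let ℓ : 𝓓(D, ℝ) →ₗ[ℝ] ℝ :=
    { toFun := fun g => ∫ z, ρ z * g z
      map_add' := fun f g => by
        rw [← integral_add (integrable_mul ρ f) (integrable_mul ρ g)]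
        congr 1; ext z; simp only [FunLike.coe_add, Pi.add_apply]; ring
      map_smul' := fun c g => by
        rw [RingHom.id_apply, smul_eq_mul, ← integral_const_mul]
        congr 1; ext z; simp only [FunLike.coe_smul, Pi.smul_apply, smul_eq_mul]; ring }
  have hle : ∀ g : 𝓓(D, ℝ), ℓ g ≤ ((∫ z, ρ z ^ 2) + C * ‖toH g‖ ^ 2) / 2 := by
    intro g
    have h1 : ℓ g = ∫ z in tsupport ρ, ρ z * g z :=
      (setIntegral_eq_integral_of_forall_compl_eq_zero fun z hz => by
        rw [image_eq_zero_of_notMem_tsupport hz, zero_mul]).symm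
    have h2 : ∫ z in tsupport ρ, ρ z * g z ≤
        ∫ z in tsupport ρ, (ρ z ^ 2 / 2 + g z ^ 2 / 2) :=
      integral_mono (integrable_mul ρ g).integrableOn
        (((hint ρ).div_const 2).add ((hint g).div_const 2)).integrableOn fun z => by
          nlinarith [sq_nonneg (ρ z - g z)]
    rw [integral_add ((hint ρ).div_const 2).integrableOn ((hint g).div_const 2).integrableOn,
      integral_div, integral_div] at h2
    have h3 : ∫ z in tsupport ρ, ρ z ^ 2 ≤ ∫ z, ρ z ^ 2 :=
      setIntegral_le_integral (hint ρ) (.of_forall fun z => sq_nonneg _)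
    have h4 := hCg g
    rw [← norm_toH_sq] at h4
    linarith
  have hbound : ∀ g : 𝓓(D, ℝ), ‖ℓ g‖ ≤ √((∫ z, ρ z ^ 2) * C) * ‖toH g‖ := by
    intro g
    -- Applying the additive bound to all multiples `t • g` and optimizing in `t` turns it into a
    -- multiplicative one; Riesz representation then applies.
    have hdis := discrim_le_zero (a := C * ‖toH g‖ ^ 2 / 2) (b := -ℓ g) (c := (∫ z, ρ z ^ 2) / 2)
      fun t => by
        have := hle (t • g)
        rw [map_smul, smul_eq_mul, toH_smul, norm_smul, mul_pow, Real.norm_eq_abs, sq_abs] at this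
        nlinarith
    rw [discrim] at hdis
    rw [Real.norm_eq_abs]
    refine abs_le_of_sq_le_sq ?_ (by positivity)
    rw [mul_pow, Real.sq_sqrt (mul_nonneg (integral_nonneg fun z => sq_nonneg _) hC)]
    nlinarith
  let e : 𝓓(D, ℝ) →ₗ[ℝ] DirichletSpace D := ⟨⟨toH, toH_add⟩, toH_smul⟩
  refine ⟨(InnerProductSpace.toDual ℝ _).symm (ℓ.extendOfNorm e), fun g => ?_⟩
  rw [InnerProductSpace.toDual_symm_apply]
  exact LinearMap.extendOfNorm_eq (e := e) (denseRange_toH D) ⟨_, hbound⟩ g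

/-- `-Δ⁻¹` is defined on a domain that embeds conformally into the upper half-plane. -/
theorem hasInvLap_of_chart {D : Opens ℂ} {φ : ℂ → ℍ}
    (hφ : DifferentiableOn ℂ (fun z => (φ z : ℂ)) D) (hinj : InjOn φ D) : HasInvLap D := by
  refine hasInvLap_of_injOn (differentiableOn_cayley_chart hφ) (fun z _ => norm_cayley_le_one _) ?_
  intro z hz w hw hzw
  refine hinj hz hw (UpperHalfPlane.ext ?_)
  have h1 : HBar.ofUpper (φ z) = HBar.ofUpper (φ w) := cayley_injective hzw
  exact congrArg Subtype.val (OnePoint.coe_injective h1)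

/-! ### The field as an isometry of `H(D)` into `L²` -/

/-- Integration against a harmonic function. -/
def meanHom {D : Opens ℂ} {u : ℂ → ℝ} (hu : InnerProductSpace.HarmonicOnNhd u (D : Set ℂ)) :
    𝓓(D, ℝ) →ₗ[ℝ] ℝ :=
  have hs : ContDiffOn ℝ (⊤ : ℕ∞) u D := fun z hz =>
    ((HarmonicAt.analyticAt (hu z hz)).contDiffAt (n := (⊤ : ℕ∞))).contDiffWithinAt
  { toFun := fun ρ => ∫ z, u z * ρ z
    map_add' := fun f g => by
      refine Eq.trans ?_
        (integral_add (integrable_test (mulTest u hs f)) (integrable_test (mulTest u hs g)))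
      simp [mul_add]
    map_smul' := fun c f => by
      simp only [FunLike.coe_smul, Pi.smul_apply, smul_eq_mul, RingHom.id_apply]
      rw [← integral_const_mul]
      congr 1; ext z; ring }

theorem meanHom_apply {D : Opens ℂ} {u : ℂ → ℝ}
    (hu : InnerProductSpace.HarmonicOnNhd u (D : Set ℂ)) (ρ : 𝓓(D, ℝ)) :
    meanHom hu ρ = ∫ z, u z * ρ z := rfl

variable {Ω : Type*} {mΩ : MeasurableSpace Ω} {P : Measure Ω}

/-- A random distribution whose pairing with `ρ` is Gaussian with mean `m ρ` and variance
`‖-Δ⁻¹ρ‖²`. -/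
structure IsGaussianField (P : Measure Ω) {D : Opens ℂ} (hI : HasInvLap D) (m : 𝓓(D, ℝ) →ₗ[ℝ] ℝ)
    (h : Ω → 𝓓'(D, ℝ)) : Prop where
  measurable : Measurable h
  map_eval : ∀ ρ, P.map (fun ω => h ω ρ) = gaussianReal (m ρ) (‖invLapHom hI ρ‖₊ ^ 2)

theorem IsGFF.isGaussianField {D : Opens ℂ} {u : ℂ → ℝ}
    (hu : InnerProductSpace.HarmonicOnNhd u (D : Set ℂ)) {h : Ω → 𝓓'(D, ℝ)} (hh : IsGFF P u h)
    (hI : HasInvLap D) : IsGaussianField P hI (meanHom hu) h := by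
  refine ⟨hh.measurable, fun ρ => ?_⟩
  rw [hh.map_eval, meanHom_apply]
  congr 1
  rw [← NNReal.coe_inj, energy_self hI]
  simp

namespace IsGaussianField

variable {D : Opens ℂ} {hI : HasInvLap D} {m : 𝓓(D, ℝ) →ₗ[ℝ] ℝ} {h : Ω → 𝓓'(D, ℝ)}

theorem measurable_pairing (hG : IsGaussianField P hI m h) (ρ : 𝓓(D, ℝ)) :
    Measurable fun ω => h ω ρ :=
  (measurable_eval ρ).comp hG.measurable

theorem map_centred (hG : IsGaussianField P hI m h) (ρ : 𝓓(D, ℝ)) :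
    P.map (fun ω => h ω ρ - m ρ) = gaussianReal 0 (‖invLapHom hI ρ‖₊ ^ 2) := by
  have := (gaussianReal_sub_const ⟨(hG.measurable_pairing ρ).aemeasurable, hG.map_eval ρ⟩
    (m ρ)).map_eq
  rwa [sub_self] at this

theorem measurable_centred (hG : IsGaussianField P hI m h) (ρ : 𝓓(D, ℝ)) :
    Measurable fun ω => h ω ρ - m ρ := (hG.measurable_pairing ρ).sub_const _

theorem memLp_centred (hG : IsGaussianField P hI m h) (ρ : 𝓓(D, ℝ)) :
    MemLp (fun ω => h ω ρ - m ρ) 2 P := by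
  have := memLp_id_gaussianReal' (μ := 0) (v := ‖invLapHom hI ρ‖₊ ^ 2) 2 (by simp)
  rw [← hG.map_centred ρ] at this
  exact (memLp_map_measure_iff aestronglyMeasurable_id
    (hG.measurable_centred ρ).aemeasurable).1 this

theorem integral_centred_sq (hG : IsGaussianField P hI m h) (ρ : 𝓓(D, ℝ)) :
    ∫ ω, (h ω ρ - m ρ) ^ 2 ∂P = ‖invLapHom hI ρ‖ ^ 2 := by
  have h1 := variance_fun_id_gaussianReal (μ := 0) (v := ‖invLapHom hI ρ‖₊ ^ 2)
  rw [variance_of_integral_eq_zero aemeasurable_id' (by simp), ← hG.map_centred ρ,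
    integral_map (hG.measurable_centred ρ).aemeasurable
      (by fun_prop)] at h1
  simpa using h1

/-- The centred pairings as a linear map into `L²`. -/
def pairingHom (hG : IsGaussianField P hI m h) : 𝓓(D, ℝ) →ₗ[ℝ] Lp ℝ 2 P where
  toFun ρ := (hG.memLp_centred ρ).toLp _
  map_add' f g := by
    rw [← MemLp.toLp_add]
    congr 1
    ext ω
    simp only [map_add, Pi.add_apply]
    ring
  map_smul' c f := by
    rw [RingHom.id_apply, ← MemLp.toLp_const_smul]
    congr 1
    ext ω
    simp only [map_smul, Pi.smul_apply, smul_eq_mul]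
    ring

theorem coeFn_pairingHom (hG : IsGaussianField P hI m h) (ρ : 𝓓(D, ℝ)) :
    hG.pairingHom ρ =ᵐ[P] fun ω => h ω ρ - m ρ :=
  MemLp.coeFn_toLp (hG.memLp_centred ρ)

theorem integral_sq_eq_norm_sq (f : Lp ℝ 2 P) : ∫ ω, f ω ^ 2 ∂P = ‖f‖ ^ 2 := by
  rw [← real_inner_self_eq_norm_sq, L2.inner_def]
  simp [sq]

theorem norm_pairingHom (hG : IsGaussianField P hI m h) (ρ : 𝓓(D, ℝ)) :
    ‖hG.pairingHom ρ‖ = ‖invLapHom hI ρ‖ := by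
  rw [← sq_eq_sq₀ (norm_nonneg _) (norm_nonneg _), ← hG.integral_centred_sq,
    ← integral_sq_eq_norm_sq]
  refine integral_congr_ae ?_
  filter_upwards [hG.coeFn_pairingHom ρ] with ω hω
  rw [hω]

/-- The Gaussian variable `(x, h)_∇`, centred, for `x ∈ H(D)`. -/
def white (hG : IsGaussianField P hI m h) : DirichletSpace D →L[ℝ] Lp ℝ 2 P :=
  hG.pairingHom.extendOfNorm (invLapHom hI)

theorem white_invLapHom (hG : IsGaussianField P hI m h) (ρ : 𝓓(D, ℝ)) :
    hG.white (invLapHom hI ρ) = hG.pairingHom ρ :=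
  LinearMap.extendOfNorm_eq (denseRange_invLapHom hI)
    ⟨1, fun x => by rw [one_mul, hG.norm_pairingHom]⟩ ρ

theorem coeFn_white_invLapHom (hG : IsGaussianField P hI m h) (ρ : 𝓓(D, ℝ)) :
    hG.white (invLapHom hI ρ) =ᵐ[P] fun ω => h ω ρ - m ρ := by
  rw [white_invLapHom]; exact hG.coeFn_pairingHom ρ

theorem integral_expI_gaussianReal (v : ℝ≥0) :
    ∫ x, expI x ∂(gaussianReal 0 v) = Real.exp (-(v / 2)) := by
  have := charFun_gaussianReal (μ := 0) (v := v) 1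
  rw [charFun_eq_integral_expI] at this
  simp only [one_mul] at this
  rw [this]
  push_cast
  congr 1
  simp

variable [IsProbabilityMeasure P]

theorem integral_expI_white (hG : IsGaussianField P hI m h) (x : DirichletSpace D) :
    ∫ ω, expI (hG.white x ω) ∂P = Real.exp (-(‖x‖ ^ 2 / 2)) := by
  have hc := (continuous_integral_mul_expI (P := P) (Z := fun _ => 1) (C := 1)
    aestronglyMeasurable_const (by simp)).comp hG.white.continuous
  simp only [one_mul, Function.comp_def] at hc
  refine (denseRange_invLapHom hI).induction_on x (isClosed_eq hc (by fun_prop)) fun ρ => ?_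
  have : ∫ ω, expI (hG.white (invLapHom hI ρ) ω) ∂P = ∫ ω, expI (h ω ρ - m ρ) ∂P :=
    integral_congr_ae (by
      filter_upwards [hG.coeFn_white_invLapHom ρ] with ω hω
      rw [hω])
  rw [this, ← integral_map (φ := fun ω => h ω ρ - m ρ) (f := expI)
    (hG.measurable_centred ρ).aemeasurable measurable_expI.aestronglyMeasurable, hG.map_centred,
    integral_expI_gaussianReal]
  simp

omit [IsProbabilityMeasure P] in
-- The double orthogonal complement is the closed span of the `-Δ⁻¹ρ` with `ρ` supported in `N`, so
-- `white x` is an `L²` limit of centred pairings with such `ρ`.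
theorem aestronglyMeasurable_white (hG : IsGaussianField P hI m h) {N : Set ℂ}
    {x : DirichletSpace D} (hx : x ∈ (coSupp hI N)ᗮ) :
    AEStronglyMeasurable[sigmaTest h (testIn D N)] (hG.white x) P := by
  have hm := sigmaTest_le hG.measurable (testIn D N)
  rw [coSupp, Submodule.orthogonal_orthogonal_eq_closure] at hx
  have hcl : IsClosed {x | AEStronglyMeasurable[sigmaTest h (testIn D N)] (hG.white x) P} :=
    (isClosed_aestronglyMeasurable (F := ℝ) (p := 2) (μ := P) hm).preimage hG.white.continuous
  refine closure_minimal ?_ hcl hx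
  intro y hy
  change AEStronglyMeasurable[sigmaTest h (testIn D N)] (hG.white y) P
  obtain ⟨ρ, hρ, rfl⟩ : ∃ ρ : 𝓓(D, ℝ), ρ ∈ testIn D N ∧ y = invLapHom hI ρ := by
    have : Submodule.span ℝ {x | ∃ ρ : 𝓓(D, ℝ), tsupport ρ ⊆ N ∧ x = invLapHom hI ρ} ≤
        (testIn D N).map (invLapHom hI) := by
      rw [Submodule.span_le]
      rintro _ ⟨ρ, hρ, rfl⟩
      exact ⟨ρ, hρ, rfl⟩
    obtain ⟨ρ, hρ, rfl⟩ := this hy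
    exact ⟨ρ, hρ, rfl⟩
  refine AEStronglyMeasurable.congr ?_ (hG.coeFn_white_invLapHom ρ).symm
  have hρ' : Measurable[sigmaTest h (testIn D N)] fun ω => h ω ρ - m ρ :=
    (measurable_id.sub_const (m ρ)).comp (measurable_sigmaTest h hρ)
  exact ⟨_, hρ'.stronglyMeasurable, Filter.EventuallyEq.rfl⟩

omit [IsProbabilityMeasure P] in
theorem coSupp_univ : coSupp hI univ = ⊥ := by
  rw [Submodule.eq_bot_iff]
  intro x hx
  rw [mem_coSupp_iff] at hx
  have : inner ℝ x x = 0 := (denseRange_invLapHom hI).induction_on (p := fun y => inner ℝ y x = 0) x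
    (isClosed_eq (by fun_prop) (by fun_prop)) fun ρ => hx ρ (subset_univ _)
  exact inner_self_eq_zero.1 this

omit [IsProbabilityMeasure P] in
theorem aestronglyMeasurable_white_comap (hG : IsGaussianField P hI m h) (x : DirichletSpace D) :
    AEStronglyMeasurable[MeasurableSpace.comap h inferInstance] (hG.white x) P := by
  have := hG.aestronglyMeasurable_white (N := univ) (x := x) (by simp [coSupp_univ])
  refine this.mono ?_
  rw [← sigmaTest_top]
  exact sigmaTest_mono h le_top

/-- Given the field in `N`, the variable attached to `y ∈ coSupp N` is a centred Gaussian of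
variance `‖y‖²`. -/
theorem condExp_expI_white_sub (hG : IsGaussianField P hI m h) {N : Set ℂ} {y : DirichletSpace D}
    (hy : y ∈ coSupp hI N) :
    P[fun ω => expI (hG.white y ω) - (Real.exp (-(‖y‖ ^ 2 / 2)) : ℂ) |
      sigmaTest h (testIn D N)] =ᵐ[P] 0 := by
  have hi : ∀ x, Integrable (fun ω => expI (hG.white x ω)) P := fun x =>
    integrable_of_bounded (C := 1) (aestronglyMeasurable_expI (Lp.aestronglyMeasurable _))
      fun ω => (norm_expI _).le
  refine condExp_eq_zero_of_expI hG.measurable _ ((hi y).sub (integrable_const _)) ?_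
  intro ρ hρ
  have e : ∀ᵐ ω ∂P, (expI (hG.white y ω) - (Real.exp (-(‖y‖ ^ 2 / 2)) : ℂ)) * expI (h ω ρ) =
      expI (m ρ) * (expI (hG.white (y + invLapHom hI ρ) ω) -
        (Real.exp (-(‖y‖ ^ 2 / 2)) : ℂ) * expI (hG.white (invLapHom hI ρ) ω)) := by
    have h1 : hG.white (y + invLapHom hI ρ) =ᵐ[P] hG.white y + hG.white (invLapHom hI ρ) := by
      rw [map_add]; exact Lp.coeFn_add _ _
    filter_upwards [h1, hG.coeFn_white_invLapHom ρ] with ω h1 h2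
    rw [h1, Pi.add_apply, expI_add, h2]
    have : expI (h ω ρ) = expI (m ρ) * expI (h ω ρ - m ρ) := by rw [← expI_add]; ring_nf
    rw [this]; ring
  rw [integral_congr_ae e, integral_const_mul, integral_sub (hi _) ((hi _).const_mul _),
    integral_const_mul, integral_expI_white, integral_expI_white, ← Complex.ofReal_mul,
    ← Real.exp_add]
  -- Orthogonality removes the cross term in the Gaussian exponent, so the characteristic functional
  -- factorizes.
  have h0 : inner ℝ y (invLapHom hI ρ) = 0 := by
    rw [real_inner_comm]; exact (mem_coSupp_iff hI N y).1 hy ρ hρ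
  have : ‖y + invLapHom hI ρ‖ ^ 2 = ‖y‖ ^ 2 + ‖invLapHom hI ρ‖ ^ 2 := by
    rw [norm_add_sq_real, h0]; ring
  rw [this]
  ring_nf

/-- On each event `F` of the field in `N`, applying `condExp_expI_white_sub` to all multiples `t •
y` shows that the law of `white y` restricted to `F` is `P F` times a centred Gaussian. -/
theorem condExp_white_eq_zero (hG : IsGaussianField P hI m h) {N : Set ℂ} {y : DirichletSpace D}
    (hy : y ∈ coSupp hI N) : P[hG.white y | sigmaTest h (testIn D N)] =ᵐ[P] 0 := by
  have hm := sigmaTest_le hG.measurable (testIn D N)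
  have hint : Integrable (hG.white y) P := (Lp.memLp _).integrable one_le_two
  have hae : ∀ F, AEMeasurable (hG.white y) (P.restrict F) := fun F =>
    (Lp.aestronglyMeasurable _).aemeasurable.restrict
  rw [condExp_eq_zero_iff hm hint]
  intro F hF
  have hlaw : (P.restrict F).map (hG.white y) = P F • gaussianReal 0 (‖y‖₊ ^ 2) := by
    have : IsFiniteMeasure ((P.restrict F).map (hG.white y)) := inferInstance
    have : IsFiniteMeasure (P F • gaussianReal 0 (‖y‖₊ ^ 2)) :=
      (gaussianReal 0 (‖y‖₊ ^ 2)).smul_finite (measure_ne_top P F)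
    refine Measure.ext_of_charFun (funext fun t => ?_)
    have h1 := (condExp_eq_zero_iff hm (((integrable_of_bounded (C := 1) (aestronglyMeasurable_expI
      (Lp.aestronglyMeasurable _)) fun ω => (norm_expI _).le)).sub (integrable_const _))).1
      (hG.condExp_expI_white_sub (Submodule.smul_mem _ t hy)) F hF
    simp only [Pi.sub_apply] at h1
    rw [integral_sub, sub_eq_zero, integral_const] at h1
    · rw [charFun_eq_integral_expI, integral_map (hae F)
        (f := fun x => expI (t * x))
        ((measurable_expI.comp (measurable_const_mul t)).aestronglyMeasurable)]
      have h2 : ∫ ω in F, expI (t * hG.white y ω) ∂P = ∫ ω in F, expI (hG.white (t • y) ω) ∂P := by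
        refine integral_congr_ae (ae_restrict_of_ae ?_)
        have : hG.white (t • y) =ᵐ[P] t • hG.white y := by rw [map_smul]; exact Lp.coeFn_smul _ _
        filter_upwards [this] with ω hω
        rw [hω]; rfl
      rw [h2, h1, charFun_eq_integral_expI, integral_smul_measure, ← charFun_eq_integral_expI,
        charFun_gaussianReal]
      simp [norm_smul, mul_pow, Measure.real]
      left
      congr 1
      ring
    · exact (integrable_of_bounded (C := 1) (aestronglyMeasurable_expI
        (Lp.aestronglyMeasurable _)) fun ω => (norm_expI _).le).integrableOn
    · exact integrable_const _
  have := integral_map (hae F) (f := fun x : ℝ => x) (by fun_prop)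
  rw [← this, hlaw, integral_smul_measure]
  simp

end IsGaussianField

end

/-! ### Local sets, conditionally independent unions, and the limit along discretizations. -/

section

open scoped Topology ENNReal

variable {Ω : Type*} {mΩ : MeasurableSpace Ω} {P : Measure Ω}

/-! ### The σ-algebras of a coupled set -/

section Sigma

variable {D : Opens ℂ} {φ : ℂ → ℍ} {h : Ω → 𝓓'(D, ℝ)} {A : Ω → ClosedSets}

theorem measurableSet_setOf_tsupport_subset_near (hφ : ContinuousOn φ D) (ρ : 𝓓(D, ℝ)) (δ : ℝ) :
    MeasurableSet[sigmaSet A] {ω | tsupport ρ ⊆ near D φ (A ω) δ} :=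
  ⟨_, measurableSet_subset_near hφ ρ.hasCompactSupport ρ.tsupport_subset δ, rfl⟩

theorem sigmaNear_le (hφ : ContinuousOn φ D) (hh : Measurable h) (hA : Measurable A) (δ : ℝ) :
    sigmaNear φ h A δ ≤ mΩ := by
  refine sup_le hA.comap_le (iSup_le fun ρ => ?_)
  rw [← measurable_iff_comap_le]
  exact Measurable.ite (hA.comap_le _ (measurableSet_setOf_tsupport_subset_near hφ ρ δ))
    ((measurable_eval ρ).comp hh) measurable_const

theorem sigmaGerm_le_sigmaNear (φ : ℂ → ℍ) (h : Ω → 𝓓'(D, ℝ)) (A : Ω → ClosedSets) {δ : ℚ}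
    (hδ : 0 < δ) : sigmaGerm φ h A ≤ sigmaNear φ h A δ := iInf₂_le δ hδ

theorem sigmaGerm_le (hφ : ContinuousOn φ D) (hh : Measurable h) (hA : Measurable A) :
    sigmaGerm φ h A ≤ mΩ :=
  (sigmaGerm_le_sigmaNear φ h A one_pos).trans (sigmaNear_le hφ hh hA _)

theorem sigmaSet_le_sigmaGerm (φ : ℂ → ℍ) (h : Ω → 𝓓'(D, ℝ)) (A : Ω → ClosedSets) :
    sigmaSet A ≤ sigmaGerm φ h A := le_iInf₂ fun _ _ => le_sup_left

end Sigma

/-! ### Conditional characteristic functionals -/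

theorem measurable_const_add_distribution {D : Opens ℂ} (T₀ : 𝓓'(D, ℝ)) :
    Measurable fun T : 𝓓'(D, ℝ) => T₀ + T :=
  measurable_distribution_iff.2 fun ρ => (measurable_eval ρ).const_add (T₀ ρ)

theorem integral_expI_of_isZeroGFFLaw {D : Opens ℂ} {U : Set ℂ} {ν : Measure 𝓓'(D, ℝ)}
    (hν : IsZeroGFFLaw U ν) (T₀ : 𝓓'(D, ℝ)) (ρ : 𝓓(D, ℝ)) :
    ∫ T, expI (T ρ) ∂(ν.map fun T => T₀ + T) =
      expI (T₀ ρ) * Real.exp (-(energy U ρ / 2)) := by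
  have hme : Measurable fun T : 𝓓'(D, ℝ) => expI (T ρ) := measurable_expI.comp (measurable_eval ρ)
  rw [integral_map (measurable_const_add_distribution T₀).aemeasurable hme.aestronglyMeasurable]
  have : ∀ T : 𝓓'(D, ℝ), expI ((T₀ + T) ρ) = expI (T₀ ρ) * expI (T ρ) := fun T => by
    rw [← expI_add]; rfl
  simp only [this]
  rw [integral_const_mul, ← IsGaussianField.integral_expI_gaussianReal, ← hν.map_eval,
    integral_map (measurable_eval ρ).aemeasurable measurable_expI.aestronglyMeasurable]

/-- This is the only form in which the conditional laws of the given local sets are used. Restricted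
to `E`, the law of `h` is the mixture of the kernel, and each kernel value has an explicit
characteristic functional. -/
theorem HasCondLaw.setIntegral_expI {m mΩ : MeasurableSpace Ω} {P : Measure Ω}
    [IsProbabilityMeasure P] {D : Opens ℂ} {h : Ω → 𝓓'(D, ℝ)}
    (hh : Measurable h) (hm : m ≤ mΩ) {h₁ : Ω → 𝓓'(D, ℝ)} {U : Ω → Set ℂ}
    (hc : HasCondLaw P h m h₁ U) {E : Set Ω} (hE : MeasurableSet[m] E) (ρ : 𝓓(D, ℝ)) :
    ∫ ω in E, expI (h ω ρ) ∂P =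
      ∫ ω in E, expI (h₁ ω ρ) * Real.exp (-(energy (U ω) ρ / 2)) ∂P := by
  obtain ⟨κ, hκ, hS, hν⟩ := hc
  let κ' : Kernel Ω 𝓓'(D, ℝ) := ⟨κ, κ.measurable.mono hm le_rfl⟩
  have hκ' : IsMarkovKernel κ' := ⟨fun ω => hκ.isProbabilityMeasure ω⟩
  have hmap : (P.restrict E).map h = κ' ∘ₘ (P.restrict E) := by
    ext S hSm
    rw [Measure.map_apply hh hSm, Measure.bind_apply hSm κ'.aemeasurable,
      Measure.restrict_apply (hh hSm)]
    have hi : Integrable (fun ω => (κ' ω).real S) P :=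
      Integrable.of_bound (κ'.measurable_coe hSm).ennreal_toReal.aestronglyMeasurable 1
        (.of_forall fun ω => by
          rw [Real.norm_of_nonneg measureReal_nonneg]; exact measureReal_le_one)
    have h1 : ∫ ω in E, (κ' ω).real S ∂P = P.real (h ⁻¹' S ∩ E) := by
      have e := setIntegral_condExp hm (f := (h ⁻¹' S).indicator fun _ => (1 : ℝ)) (μ := P)
        ((integrable_const _).indicator (hh hSm)) hE
      rw [setIntegral_congr_ae (hm _ hE) (g := P⟦h ⁻¹' S|m⟧), e,
        integral_indicator (hh hSm), Measure.restrict_restrict (hh hSm)]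
      · simp
      · filter_upwards [hS S hSm] with ω hω _ using hω
    have h2 : ∫⁻ ω in E, κ' ω S ∂P = ENNReal.ofReal (∫ ω in E, (κ' ω).real S ∂P) := by
      rw [ofReal_integral_eq_lintegral_ofReal hi.integrableOn
        (.of_forall fun _ => measureReal_nonneg)]
      congr 1; ext ω; simp [Measure.real]
    rw [h2, h1]
    simp [Measure.real]
  have hme : Measurable fun T : 𝓓'(D, ℝ) => expI (T ρ) := measurable_expI.comp (measurable_eval ρ)
  rw [← integral_map hh.aemeasurable hme.aestronglyMeasurable, hmap, ← Measure.snd_compProd,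
    Measure.snd, integral_map measurable_snd.aemeasurable hme.aestronglyMeasurable,
    Measure.integral_compProd]
  · refine integral_congr_ae (ae_restrict_of_ae ?_)
    filter_upwards [hν] with ω ⟨ν, hν, hω⟩
    change ∫ T, expI (T ρ) ∂(κ ω) = _
    rw [hω, integral_expI_of_isZeroGFFLaw hν]
  · exact Integrable.of_bound (hme.comp measurable_snd).aestronglyMeasurable 1
      (.of_forall fun _ => (norm_expI _).le)

namespace IsGaussianField

variable [IsProbabilityMeasure P] {D : Opens ℂ} {hI : HasInvLap D} {m : 𝓓(D, ℝ) →ₗ[ℝ] ℝ}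
  {h : Ω → 𝓓'(D, ℝ)} {φ : ℂ → ℍ} {A : Ω → ClosedSets}

theorem integrable_expI_white (hG : IsGaussianField P hI m h) (x : DirichletSpace D) :
    Integrable (fun ω => expI (hG.white x ω)) P :=
  integrable_of_bounded (C := 1) (aestronglyMeasurable_expI (Lp.aestronglyMeasurable _))
    fun _ => (norm_expI _).le

theorem integrable_expI (hG : IsGaussianField P hI m h) (ρ : 𝓓(D, ℝ)) :
    Integrable (fun ω => expI (h ω ρ)) P :=
  integrable_of_bounded (C := 1) (measurable_expI.comp (hG.measurable_pairing ρ)).aestronglyMeasurable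
    fun _ => (norm_expI _).le

omit [IsProbabilityMeasure P] in
theorem expI_pairing_ae_eq (hG : IsGaussianField P hI m h) (ρ : 𝓓(D, ℝ)) :
    ∀ᵐ ω ∂P, expI (h ω ρ) = expI (m ρ) * expI (hG.white (invLapHom hI ρ) ω) := by
  filter_upwards [hG.coeFn_white_invLapHom ρ] with ω hω
  rw [hω, ← expI_add]; ring_nf

/-- Shifting a test function away from a local set `A` acts on the characteristic functional as if
`A` were deterministic. -/
theorem setIntegral_expI_sub_lap (hG : IsGaussianField P hI m h) (hφ : ContinuousOn φ D)
    (hA : Measurable A) (hloc : IsLocal P φ h A) {E : Set Ω} (hE : MeasurableSet[sigmaGerm φ h A] E)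
    {V : Set ℂ} (hV : ∀ ω ∈ E, V ⊆ off D φ (A ω)) {g : 𝓓(D, ℝ)} (hg : tsupport g ⊆ V)
    (ρ : 𝓓(D, ℝ)) :
    ∫ ω in E, expI (h ω (ρ - lap g)) ∂P =
      Real.exp (-(inner ℝ (invLapHom hI ρ) (toH g) + ‖toH g‖ ^ 2 / 2)) *
        ∫ ω in E, expI (h ω ρ) ∂P := by
  obtain ⟨h₁, -, hharm, hc⟩ := hloc
  have hm := sigmaGerm_le hφ hG.measurable hA
  rw [hc.setIntegral_expI hG.measurable hm hE, hc.setIntegral_expI hG.measurable hm hE,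
    ← integral_const_mul]
  refine setIntegral_congr_ae (hm _ hE) ?_
  filter_upwards [hharm] with ω hω hωE
  -- Harmonicity of `h₁` off `A` removes the pairing with `Δg`. In the energy, `-Δ⁻¹(ρ - Δg) = -Δ⁻¹ρ
  -- + g` and the projection fixes `g`, so the change is `2⟨-Δ⁻¹ρ, g⟩ + ‖g‖²`, which no longer
  -- depends on `ω`.
  rw [map_sub, hω g (hg.trans (hV ω hωE)), sub_zero, energy_eq hI, energy_eq hI, map_sub,
    invLapHom_lap, sub_neg_eq_add, map_add,
    Submodule.starProjection_eq_self_iff.2 (toH_mem_suppSpace (hg.trans (hV ω hωE))),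
    norm_add_sq_real, inner_starProjection_of_mem _ _ (toH_mem_suppSpace (hg.trans (hV ω hωE))),
    mul_left_comm, ← Complex.ofReal_mul, ← Real.exp_add]
  congr 3
  ring

/-- The shift identity `setIntegral_expI_sub_lap` extends by continuity, since both the elements
`-Δ⁻¹ρ` in `H(D)` and the test functions in `Supp_V` are dense. -/
theorem setIntegral_expI_white_add (hG : IsGaussianField P hI m h) (hm : ∀ g, m (lap g) = 0)
    (hφ : ContinuousOn φ D)
    (hA : Measurable A) (hloc : IsLocal P φ h A) {E : Set Ω} (hE : MeasurableSet[sigmaGerm φ h A] E)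
    {V : Set ℂ} (hV : ∀ ω ∈ E, V ⊆ off D φ (A ω)) (x : DirichletSpace D) {y : DirichletSpace D}
    (hy : y ∈ suppSpace D V) :
    ∫ ω in E, expI (hG.white (x + y) ω) ∂P =
      Real.exp (-(inner ℝ x y + ‖y‖ ^ 2 / 2)) * ∫ ω in E, expI (hG.white x ω) ∂P := by
  have hE' := sigmaGerm_le hφ hG.measurable hA _ hE
  have hc : Continuous fun x => ∫ ω in E, expI (hG.white x ω) ∂P := by
    have := (continuous_integral_mul_expI (P := P) (Z := E.indicator fun _ => 1) (C := 1)
      ((stronglyMeasurable_const.indicator hE').aestronglyMeasurable) (fun ω => by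
        by_cases hω : ω ∈ E <;> simp [hω])).comp hG.white.continuous
    refine this.congr fun x => ?_
    rw [← integral_indicator hE', Function.comp_apply]
    congr 1
    ext ω
    by_cases hω : ω ∈ E <;> simp [hω]
  refine closure_minimal (s := {x | ∃ g : 𝓓(D, ℝ), tsupport g ⊆ V ∧ x = toH g})
    (t := {y | ∫ ω in E, expI (hG.white (x + y) ω) ∂P =
      Real.exp (-(inner ℝ x y + ‖y‖ ^ 2 / 2)) * ∫ ω in E, expI (hG.white x ω) ∂P}) ?_
    (isClosed_eq (hc.comp (by fun_prop)) (by fun_prop)) (suppSpace_subset_closure D V hy)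
  rintro _ ⟨g, hg, rfl⟩
  change ∫ ω in E, expI (hG.white (x + toH g) ω) ∂P = _
  refine (denseRange_invLapHom hI).induction_on x
    (isClosed_eq (hc.comp (by fun_prop)) (by fun_prop)) fun ρ => ?_
  have e : ∀ σ, ∫ ω in E, expI (hG.white (invLapHom hI σ) ω) ∂P =
      expI (-m σ) * ∫ ω in E, expI (h ω σ) ∂P := fun σ => by
    rw [← integral_const_mul]
    refine integral_congr_ae (ae_restrict_of_ae ?_)
    filter_upwards [hG.expI_pairing_ae_eq σ] with ω hω
    rw [hω, ← mul_assoc, ← expI_add]; simp [expI_zero]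
  have h1 : invLapHom hI ρ + toH g = invLapHom hI (ρ - lap g) := by
    rw [map_sub, invLapHom_lap, sub_neg_eq_add]
  rw [h1, e, e, hG.setIntegral_expI_sub_lap hφ hA hloc hE hV hg, map_sub, hm, sub_zero]
  ring

end IsGaussianField

end

section

open scoped Topology ENNReal

/-! ### Conditionally independent local sets -/

theorem integrable_complex_ofReal {Ω : Type*} {mΩ : MeasurableSpace Ω} {P : Measure Ω} {Z : Ω → ℝ}
    (hZ : Integrable Z P) : Integrable (fun ω => (Z ω : ℂ)) P := hZ.ofReal

theorem aestronglyMeasurable_indicator {Ω E : Type*} [TopologicalSpace E] [Zero E]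
    {m mΩ : MeasurableSpace Ω} {P : Measure Ω} {Z : Ω → E} (hZ : AEStronglyMeasurable[m] Z P)
    {F : Set Ω} (hF : MeasurableSet[m] F) : AEStronglyMeasurable[m] (F.indicator Z) P :=
  ⟨_, hZ.stronglyMeasurable_mk.indicator hF, by
    filter_upwards [hZ.ae_eq_mk] with ω hω
    simp only [indicator, hω]⟩

theorem condExp_ofReal_eq_zero {Ω : Type*} {m mΩ : MeasurableSpace Ω} {P : Measure Ω}
    [IsFiniteMeasure P] (hm : m ≤ mΩ) {Z : Ω → ℝ} (hZ : Integrable Z P) (h0 : P[Z | m] =ᵐ[P] 0) :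
    P[fun ω => (Z ω : ℂ) | m] =ᵐ[P] 0 := by
  rw [condExp_eq_zero_iff hm (integrable_complex_ofReal hZ)]
  intro F hF
  rw [integral_complex_ofReal, (condExp_eq_zero_iff hm hZ).1 h0 F hF, Complex.ofReal_zero]

theorem condExp_sub_condExp {Ω : Type*} {m mΩ : MeasurableSpace Ω} {P : Measure Ω}
    [IsFiniteMeasure P] (hm : m ≤ mΩ) {Z : Ω → ℝ} (hZ : Integrable Z P) :
    P[Z - P[Z | m] | m] =ᵐ[P] 0 := by
  refine (condExp_sub hZ integrable_condExp m).trans ?_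
  rw [condExp_of_stronglyMeasurable hm stronglyMeasurable_condExp integrable_condExp]
  exact .of_forall fun ω => by simp

theorem setIntegral_eq_zero_sup {Ω : Type*} {m₁ m₂ mΩ : MeasurableSpace Ω} {P : Measure Ω}
    (h₁ : m₁ ≤ mΩ) (h₂ : m₂ ≤ mΩ) {Z : Ω → ℂ} (hZ : Integrable Z P)
    (h : ∀ F₁ F₂, MeasurableSet[m₁] F₁ → MeasurableSet[m₂] F₂ → ∫ ω in F₁ ∩ F₂, Z ω ∂P = 0)
    {F : Set Ω} (hF : MeasurableSet[m₁ ⊔ m₂] F) : ∫ ω in F, Z ω ∂P = 0 := by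
  have hle : m₁ ⊔ m₂ ≤ mΩ := sup_le h₁ h₂
  have h0 : ∫ ω, Z ω ∂P = 0 := by
    simpa using h univ univ MeasurableSet.univ MeasurableSet.univ
  have hgen : m₁ ⊔ m₂ = MeasurableSpace.generateFrom
      {F | ∃ F₁ F₂, MeasurableSet[m₁] F₁ ∧ MeasurableSet[m₂] F₂ ∧ F = F₁ ∩ F₂} := by
    refine le_antisymm (sup_le ?_ ?_) (MeasurableSpace.generateFrom_le ?_)
    · exact fun F hF => MeasurableSpace.measurableSet_generateFrom
        ⟨F, univ, hF, MeasurableSet.univ, (inter_univ F).symm⟩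
    · exact fun F hF => MeasurableSpace.measurableSet_generateFrom
        ⟨univ, F, MeasurableSet.univ, hF, (univ_inter F).symm⟩
    · rintro _ ⟨F₁, F₂, hF₁, hF₂, rfl⟩
      exact MeasurableSet.inter (m := m₁ ⊔ m₂) ((le_sup_left : m₁ ≤ m₁ ⊔ m₂) _ hF₁)
        ((le_sup_right : m₂ ≤ m₁ ⊔ m₂) _ hF₂)
  refine MeasurableSpace.induction_on_inter (m := m₁ ⊔ m₂)
    (C := fun F _ => ∫ ω in F, Z ω ∂P = 0) hgen ?_ ?_ ?_ ?_ ?_ F hF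
  · rintro _ ⟨F₁, F₂, hF₁, hF₂, rfl⟩ _ ⟨F₁', F₂', hF₁', hF₂', rfl⟩ -
    exact ⟨F₁ ∩ F₁', F₂ ∩ F₂', MeasurableSet.inter (m := m₁) hF₁ hF₁',
      MeasurableSet.inter (m := m₂) hF₂ hF₂', by rw [inter_inter_inter_comm]⟩
  · simp
  · rintro _ ⟨F₁, F₂, hF₁, hF₂, rfl⟩
    exact h _ _ hF₁ hF₂
  · intro t ht e
    have := integral_add_compl (hle _ ht) hZ
    rwa [e, zero_add, h0] at this
  · intro f hd hf e
    rw [integral_iUnion (fun i => hle _ (hf i)) hd hZ.integrableOn]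
    simp [e]

namespace IsGaussianField

variable {Ω : Type*} {mΩ : MeasurableSpace Ω} {P : Measure Ω}
variable [IsProbabilityMeasure P] {D : Opens ℂ} {hI : HasInvLap D} {m : 𝓓(D, ℝ) →ₗ[ℝ] ℝ}
  {h : Ω → 𝓓'(D, ℝ)} {φ : ℂ → ℍ} {A A₁ A₂ : Ω → ClosedSets}

/-- An event on which the local set `A` avoids `V` depends on `h` through its restriction to a
neighbourhood `N` of the complement of `V` only. -/
theorem condExp_indicator_eq (hG : IsGaussianField P hI m h) (hm : ∀ g, m (lap g) = 0)
    (hφ : ContinuousOn φ D) (hA : Measurable A) (hloc : IsLocal P φ h A) {E : Set Ω}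
    (hE : MeasurableSet[sigmaGerm φ h A] E) {V N : Set ℂ} (hV : ∀ ω ∈ E, V ⊆ off D φ (A ω))
    (hNV : coSupp hI N ≤ suppSpace D V) :
    P⟦E | MeasurableSpace.comap h inferInstance⟧ =ᵐ[P] P⟦E | sigmaTest h (testIn D N)⟧ := by
  have hE' := sigmaGerm_le hφ hG.measurable hA _ hE
  have hN := sigmaTest_le hG.measurable (testIn D N)
  have hle : sigmaTest h (testIn D N) ≤ MeasurableSpace.comap h inferInstance := by
    rw [← sigmaTest_top]; exact sigmaTest_mono h le_top
  have h1E : Integrable (E.indicator fun _ => (1 : ℝ)) P := (integrable_const _).indicator hE'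
  set q := P⟦E | sigmaTest h (testIn D N)⟧ with hq
  have hqi : Integrable q P := integrable_condExp
  have hZi : Integrable (E.indicator (fun _ => (1 : ℝ)) - q) P := h1E.sub hqi
  have hZ0 : P[E.indicator (fun _ => (1 : ℝ)) - q | sigmaTest h (testIn D N)] =ᵐ[P] 0 :=
    condExp_sub_condExp hN h1E
  have hZc := condExp_ofReal_eq_zero hN hZi hZ0
  have hbdd : ∀ {f : Ω → ℂ}, Integrable f P → ∀ x,
      Integrable (fun ω => f ω * expI (hG.white x ω)) P := fun hf x =>
    hf.mul_bdd (c := 1) (aestronglyMeasurable_expI (Lp.aestronglyMeasurable _))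
      (.of_forall fun _ => (norm_expI _).le)
  have key : ∀ ρ ∈ (⊤ : Submodule ℝ 𝓓(D, ℝ)),
      ∫ ω, (((E.indicator (fun _ => (1 : ℝ)) - q) ω : ℝ) : ℂ) * expI (h ω ρ) ∂P = 0 := by
    intro ρ _
    -- Here `white x` is known from the field in `N`. The factor `exp(-‖y‖²/2)` of `y` comes out of
    -- the integral both for the indicator of `E`, by locality, and for its conditional expectation
    -- `q`, by independence of `white y` from that field. What is left pairs `1_E - q` with a
    -- function of the field in `N`, and vanishes.
    obtain ⟨x, hx, y, hy, hxy⟩ : ∃ x ∈ (coSupp hI N)ᗮ, ∃ y ∈ coSupp hI N,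
        x + y = invLapHom hI ρ :=
      ⟨_, Submodule.sub_starProjection_mem_orthogonal (K := coSupp hI N) (invLapHom hI ρ), _,
        Submodule.starProjection_apply_mem (coSupp hI N) (invLapHom hI ρ), sub_add_cancel _ _⟩
    have hxN := aestronglyMeasurable_expI (hG.aestronglyMeasurable_white hx)
    set c : ℂ := (Real.exp (-(‖y‖ ^ 2 / 2)) : ℂ) with hc
    have hadd : hG.white (x + y) =ᵐ[P] hG.white x + hG.white y := by
      rw [map_add]; exact Lp.coeFn_add _ _
    have e1 : ∫ ω, ((E.indicator (fun _ => (1 : ℝ)) ω : ℝ) : ℂ) * expI (hG.white (x + y) ω) ∂P =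
        c * ∫ ω, ((E.indicator (fun _ => (1 : ℝ)) ω : ℝ) : ℂ) * expI (hG.white x ω) ∂P := by
      have e : ∀ x, ∫ ω, ((E.indicator (fun _ => (1 : ℝ)) ω : ℝ) : ℂ) * expI (hG.white x ω) ∂P =
          ∫ ω in E, expI (hG.white x ω) ∂P := fun x => by
        rw [← integral_indicator hE']
        congr 1
        ext ω
        by_cases hω : ω ∈ E <;> simp [hω]
      rw [e, e, hG.setIntegral_expI_white_add hm hφ hA hloc hE hV x (hNV hy),
        Submodule.inner_left_of_mem_orthogonal hy hx, zero_add]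
    have e2 : ∫ ω, (q ω : ℂ) * expI (hG.white (x + y) ω) ∂P =
        c * ∫ ω, (q ω : ℂ) * expI (hG.white x ω) ∂P := by
      have hi := hbdd (integrable_complex_ofReal hqi) x
      have hi2 : Integrable (fun ω => (q ω : ℂ) * expI (hG.white x ω) *
          (expI (hG.white y ω) - c)) P := by
        simp only [mul_sub]
        exact (hbdd hi y).sub (hi.mul_const c)
      have := integral_mul_eq_zero hN ((hG.integrable_expI_white y).sub (integrable_const c))
        (hG.condExp_expI_white_sub hy) (f := fun ω => (q ω : ℂ) * expI (hG.white x ω))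
        ((Complex.continuous_ofReal.comp_aestronglyMeasurable
          ⟨q, stronglyMeasurable_condExp, Filter.EventuallyEq.rfl⟩).mul hxN) hi2
      have e : ∫ ω, (q ω : ℂ) * expI (hG.white (x + y) ω) ∂P =
          ∫ ω, ((q ω : ℂ) * expI (hG.white x ω) * (expI (hG.white y ω) - c) +
            c * ((q ω : ℂ) * expI (hG.white x ω))) ∂P := by
        refine integral_congr_ae ?_
        filter_upwards [hadd] with ω hω
        rw [hω, Pi.add_apply, expI_add]
        ring
      rw [e]
      refine (integral_add hi2 (hi.const_mul c)).trans ?_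
      rw [integral_const_mul]
      exact add_eq_right.2 this
    have e3 : ∫ ω, (((E.indicator (fun _ => (1 : ℝ)) - q) ω : ℝ) : ℂ) * expI (h ω ρ) ∂P =
        expI (m ρ) * (∫ ω, ((E.indicator (fun _ => (1 : ℝ)) ω : ℝ) : ℂ) *
          expI (hG.white (x + y) ω) ∂P - ∫ ω, (q ω : ℂ) * expI (hG.white (x + y) ω) ∂P) := by
      rw [← integral_sub (hbdd (integrable_complex_ofReal h1E) _) (hbdd (integrable_complex_ofReal hqi) _), ← integral_const_mul]
      refine integral_congr_ae ?_
      filter_upwards [hG.expI_pairing_ae_eq ρ] with ω hω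
      rw [hω, hxy, Pi.sub_apply, Complex.ofReal_sub]
      ring
    have e4 := integral_mul_eq_zero hN (integrable_complex_ofReal hZi) hZc hxN (by
      simp only [mul_comm (expI _)]; exact hbdd (integrable_complex_ofReal hZi) x)
    simp only [Pi.sub_apply, Complex.ofReal_sub, mul_comm (expI _), sub_mul] at e4
    rw [integral_sub (hbdd (integrable_complex_ofReal h1E) _) (hbdd (integrable_complex_ofReal hqi) _)] at e4
    rw [e3, e1, e2, ← mul_sub, e4]
    simp
  have hz : P[E.indicator (fun _ => (1 : ℝ)) - q | MeasurableSpace.comap h inferInstance]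
      =ᵐ[P] 0 := by
    rw [condExp_eq_zero_iff hG.measurable.comap_le hZi, ← sigmaTest_top]
    exact fun F hF => setIntegral_eq_zero_of_expI_real hG.measurable ⊤ hZi key hF
  have h2 := (condExp_sub h1E hqi (MeasurableSpace.comap h inferInstance)).symm.trans hz
  rw [condExp_of_stronglyMeasurable hG.measurable.comap_le
    (stronglyMeasurable_condExp.mono hle) hqi] at h2
  filter_upwards [h2] with ω hω
  exact sub_eq_zero.1 hω

/-- Given `h`, the probability of a joint event of `A₁` and `A₂` inside `G` depends only on the
field in `N`. A function `Z` of `h` with zero conditional mean given that field therefore still has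
zero mean when the two sets are also revealed. -/
theorem setIntegral_eq_zero_of_condIndepSets (hG : IsGaussianField P hI m h)
    (hm : ∀ g, m (lap g) = 0) (hφ : ContinuousOn φ D) (hA₁ : Measurable A₁) (hA₂ : Measurable A₂)
    (hloc₁ : IsLocal P φ h A₁) (hloc₂ : IsLocal P φ h A₂) (hind : CondIndepSets P h A₁ A₂)
    {V N : Set ℂ} (hNV : coSupp hI N ≤ suppSpace D V) {G : Set ClosedSets} (hGm : MeasurableSet G)
    (hGV : ∀ a ∈ G, V ⊆ off D φ a) {Z : Ω → ℂ} (hZ : Integrable Z P)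
    (hZm : AEStronglyMeasurable[MeasurableSpace.comap h inferInstance] Z P)
    (h0 : P[Z | sigmaTest h (testIn D N)] =ᵐ[P] 0) {B : Set Ω}
    (hB : MeasurableSet[(sigmaSet A₁ ⊔ sigmaSet A₂) ⊔ sigmaTest h (testIn D N)] B) :
    ∫ ω in B ∩ (A₁ ⁻¹' G ∩ A₂ ⁻¹' G), Z ω ∂P = 0 := by
  have hN := sigmaTest_le hG.measurable (testIn D N)
  have hle : sigmaTest h (testIn D N) ≤ MeasurableSpace.comap h inferInstance := by
    rw [← sigmaTest_top]; exact sigmaTest_mono h le_top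
  have basic : ∀ S T F, MeasurableSet S → MeasurableSet T →
      MeasurableSet[sigmaTest h (testIn D N)] F →
      ∫ ω in F ∩ (A₁ ⁻¹' (S ∩ G) ∩ A₂ ⁻¹' (T ∩ G)), Z ω ∂P = 0 := by
    intro S T F hS hT hF
    have hSm := hA₁ (hS.inter hGm)
    have hTm := hA₂ (hT.inter hGm)
    set r := P⟦A₁ ⁻¹' (S ∩ G) ∩ A₂ ⁻¹' (T ∩ G) | MeasurableSpace.comap h inferInstance⟧ with hr
    set q₁ := P⟦A₁ ⁻¹' (S ∩ G) | sigmaTest h (testIn D N)⟧ with hq₁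
    set q₂ := P⟦A₂ ⁻¹' (T ∩ G) | sigmaTest h (testIn D N)⟧ with hq₂
    -- Conditional independence given `h` splits the probability; locality replaces conditioning on
    -- `h` by conditioning on the field in `N`, for each factor.
    have hrq : r =ᵐ[P] q₁ * q₂ := by
      refine (hind _ _ (hS.inter hGm) (hT.inter hGm)).trans (Filter.EventuallyEq.mul ?_ ?_)
      · exact hG.condExp_indicator_eq hm hφ hA₁ hloc₁
          (sigmaSet_le_sigmaGerm φ h A₁ _ ⟨_, hS.inter hGm, rfl⟩) (fun ω hω => hGV _ hω.2) hNV
      · exact hG.condExp_indicator_eq hm hφ hA₂ hloc₂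
          (sigmaSet_le_sigmaGerm φ h A₂ _ ⟨_, hT.inter hGm, rfl⟩) (fun ω hω => hGV _ hω.2) hNV
    set I : Ω → ℝ := (A₁ ⁻¹' (S ∩ G) ∩ A₂ ⁻¹' (T ∩ G)).indicator fun _ => (1 : ℝ) with hI'
    have hIi : Integrable I P := (integrable_const _).indicator (hSm.inter hTm)
    have hI1 : ∀ ω, |I ω| ≤ 1 := fun ω => by
      simp only [hI', indicator]; split_ifs <;> simp
    have hr1 : ∀ᵐ ω ∂P, |r ω| ≤ 1 :=
      ae_bdd_abs_condExp_of_ae_bdd_abs (R := 1) (f := I) (.of_forall hI1)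
    have hFZ : Integrable (F.indicator Z) P := hZ.indicator (hN _ hF)
    have hIZ : Integrable (fun ω => F.indicator Z ω * ((I ω : ℝ) : ℂ)) P :=
      hFZ.mul_bdd (c := 1) (integrable_complex_ofReal hIi).aestronglyMeasurable
        (.of_forall fun ω => by simpa using hI1 ω)
    have hrZ : Integrable (fun ω => F.indicator Z ω * ((r ω : ℝ) : ℂ)) P :=
      hFZ.mul_bdd (c := 1) (integrable_complex_ofReal integrable_condExp).aestronglyMeasurable
        (hr1.mono fun ω hω => by simpa using hω)
    -- As `Z` and `F` depend on `h` only, the indicator may be replaced by its conditional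
    -- expectation given `h`.
    have e1 : ∫ ω, F.indicator Z ω * ((I ω : ℝ) : ℂ) ∂P =
        ∫ ω, F.indicator Z ω * ((r ω : ℝ) : ℂ) ∂P := by
      have := integral_mul_eq_zero hG.measurable.comap_le
        (integrable_complex_ofReal (hIi.sub integrable_condExp))
        (condExp_ofReal_eq_zero hG.measurable.comap_le (hIi.sub integrable_condExp)
          (condExp_sub_condExp hG.measurable.comap_le hIi)) (f := F.indicator Z)
        (aestronglyMeasurable_indicator hZm (hle _ hF)) (by
          simp only [Pi.sub_apply, Complex.ofReal_sub, mul_sub]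
          exact hIZ.sub hrZ)
      simp only [Pi.sub_apply, Complex.ofReal_sub, mul_sub] at this
      rwa [integral_sub hIZ hrZ, sub_eq_zero] at this
    have e2 : ∫ ω, F.indicator Z ω * ((r ω : ℝ) : ℂ) ∂P = 0 := by
      have hc : ∀ᵐ ω ∂P, F.indicator Z ω * ((r ω : ℝ) : ℂ) =
          F.indicator (fun ω => ((q₁ ω * q₂ ω : ℝ) : ℂ)) ω * Z ω := by
        filter_upwards [hrq] with ω hω
        rw [hω]
        by_cases hωF : ω ∈ F <;> simp [hωF, mul_comm]
      rw [integral_congr_ae hc]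
      refine integral_mul_eq_zero hN hZ h0 ?_ (hrZ.congr hc)
      refine aestronglyMeasurable_indicator ?_ hF
      exact Complex.continuous_ofReal.comp_aestronglyMeasurable
        ⟨_, stronglyMeasurable_condExp.mul stronglyMeasurable_condExp, Filter.EventuallyEq.rfl⟩
    rw [← integral_indicator ((hN _ hF).inter (hSm.inter hTm)), ← e2, ← e1]
    congr 1
    ext ω
    rw [hI']
    generalize A₁ ⁻¹' (S ∩ G) ∩ A₂ ⁻¹' (T ∩ G) = E
    by_cases hω : ω ∈ F <;> by_cases hω' : ω ∈ E <;> simp [hω, hω']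
  have hGm' : MeasurableSet (A₁ ⁻¹' G ∩ A₂ ⁻¹' G) := (hA₁ hGm).inter (hA₂ hGm)
  have hrestr : ∀ {B : Set Ω} {Z : Ω → ℂ}, MeasurableSet B →
      ∫ ω in B ∩ (A₁ ⁻¹' G ∩ A₂ ⁻¹' G), Z ω ∂P =
        ∫ ω in B, (A₁ ⁻¹' G ∩ A₂ ⁻¹' G).indicator Z ω ∂P := fun _ => by
    rw [setIntegral_indicator hGm']
  have hle' : (sigmaSet A₁ ⊔ sigmaSet A₂) ⊔ sigmaTest h (testIn D N) ≤ mΩ :=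
    sup_le (sup_le hA₁.comap_le hA₂.comap_le) hN
  rw [hrestr (hle' _ hB)]
  refine setIntegral_eq_zero_sup (sup_le hA₁.comap_le hA₂.comap_le) hN (hZ.indicator hGm') ?_ hB
  intro B F hB hF
  have e : ∫ ω in B ∩ F, (A₁ ⁻¹' G ∩ A₂ ⁻¹' G).indicator Z ω ∂P =
      ∫ ω in B, F.indicator ((A₁ ⁻¹' G ∩ A₂ ⁻¹' G).indicator Z) ω ∂P := by
    rw [setIntegral_indicator (hN _ hF)]
  rw [e]
  refine setIntegral_eq_zero_sup hA₁.comap_le hA₂.comap_le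
    ((hZ.indicator hGm').indicator (hN _ hF)) ?_ hB
  rintro _ _ ⟨S, hS, rfl⟩ ⟨T, hT, rfl⟩
  rw [setIntegral_indicator (hN _ hF), setIntegral_indicator hGm', ← basic S T F hS hT hF]
  congr 2
  ext ω
  simp only [mem_inter_iff, mem_preimage]
  tauto

end IsGaussianField

end

section

open scoped Topology ENNReal

/-! ### σ-algebras generated by the field in a random set -/

section LocSigma

variable {Ω : Type*} {D : Opens ℂ}

open Classical in
/-- The σ-algebra generated by `m₀` and the restriction of `h` to the random set `N`. -/
@[reducible]
def locSigma (h : Ω → 𝓓'(D, ℝ)) (m₀ : MeasurableSpace Ω) (N : Ω → Set ℂ) : MeasurableSpace Ω :=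
  m₀ ⊔ ⨆ ρ : 𝓓(D, ℝ), MeasurableSpace.comap
    (fun ω => if tsupport ρ ⊆ N ω then h ω ρ else 0) inferInstance

theorem sigmaNear_eq_locSigma (φ : ℂ → ℍ) (h : Ω → 𝓓'(D, ℝ)) (A : Ω → ClosedSets) (δ : ℝ) :
    sigmaNear φ h A δ = locSigma h (sigmaSet A) fun ω => near D φ (A ω) δ := rfl

open Classical in
theorem measurable_locSigma (h : Ω → 𝓓'(D, ℝ)) (m₀ : MeasurableSpace Ω) (N : Ω → Set ℂ)
    (ρ : 𝓓(D, ℝ)) :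
    Measurable[locSigma h m₀ N] fun ω => if tsupport ρ ⊆ N ω then h ω ρ else 0 := by
  rw [measurable_iff_comap_le]
  exact (le_iSup (fun ρ : 𝓓(D, ℝ) => MeasurableSpace.comap
    (fun ω => if tsupport ρ ⊆ N ω then h ω ρ else 0) inferInstance) ρ).trans le_sup_right

theorem locSigma_mono {h : Ω → 𝓓'(D, ℝ)} {m₀ m₀' : MeasurableSpace Ω} {N N' : Ω → Set ℂ}
    (hm : m₀ ≤ m₀') (hN : ∀ ω, N ω ⊆ N' ω)
    (hmeas : ∀ ρ : 𝓓(D, ℝ), MeasurableSet[m₀'] {ω | tsupport ρ ⊆ N ω}) :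
    locSigma h m₀ N ≤ locSigma h m₀' N' := by
  classical
  refine sup_le (hm.trans le_sup_left) (iSup_le fun ρ => ?_)
  rw [← measurable_iff_comap_le]
  have e : (fun ω => if tsupport ρ ⊆ N ω then h ω ρ else 0) = fun ω =>
      if ω ∈ {ω | tsupport ρ ⊆ N ω} then (if tsupport ρ ⊆ N' ω then h ω ρ else 0) else 0 := by
    ext ω
    by_cases hω : tsupport ρ ⊆ N ω
    · simp [hω, hω.trans (hN ω)]
    · simp [hω]
  rw [e]
  exact Measurable.ite (m := locSigma h m₀' N') ((le_sup_left : m₀' ≤ locSigma h m₀' N') _ (hmeas ρ))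
    (measurable_locSigma h m₀' N' ρ) measurable_const

/-- The sets whose trace on `E` is measurable. -/
@[reducible]
def traceSigma (m : MeasurableSpace Ω) {E : Set Ω} (hE : MeasurableSet[m] E) :
    MeasurableSpace Ω where
  MeasurableSet' B := MeasurableSet[m] (B ∩ E)
  measurableSet_empty := by simp
  measurableSet_compl B hB := by
    rw [show Bᶜ ∩ E = E \ (B ∩ E) by ext; simp; tauto]
    exact MeasurableSet.diff (m := m) hE hB
  measurableSet_iUnion f hf := by
    rw [iUnion_inter]
    exact MeasurableSet.iUnion (m := m) hf

theorem le_traceSigma {m : MeasurableSpace Ω} {E : Set Ω} (hE : MeasurableSet[m] E) :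
    m ≤ traceSigma m hE := fun _ hB => MeasurableSet.inter (m := m) hB hE

theorem comap_le_traceSigma {m : MeasurableSpace Ω} {E : Set Ω} (hE : MeasurableSet[m] E)
    {f g : Ω → ℝ} (hg : Measurable[m] g) (hfg : ∀ ω ∈ E, f ω = g ω) :
    MeasurableSpace.comap f inferInstance ≤ traceSigma m hE := by
  rintro _ ⟨S, hS, rfl⟩
  change MeasurableSet[m] (f ⁻¹' S ∩ E)
  rw [show f ⁻¹' S ∩ E = g ⁻¹' S ∩ E by
    ext ω
    simp only [mem_inter_iff, mem_preimage]
    constructor <;> rintro ⟨h1, h2⟩ <;> refine ⟨?_, h2⟩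
    · rwa [← hfg ω h2]
    · rwa [hfg ω h2]]
  exact MeasurableSet.inter (m := m) (hg hS) hE

/-- On an event where the random set `N` is frozen at `N₀`, each truncated pairing is either the
pairing itself or zero, so the σ-algebra reduces to a deterministic one. -/
theorem locSigma_inter {h : Ω → 𝓓'(D, ℝ)} {m₀ : MeasurableSpace Ω} {N : Ω → Set ℂ} {E : Set Ω}
    (hE : MeasurableSet[m₀] E) {N₀ : Set ℂ} (hN : ∀ ω ∈ E, N ω = N₀) {B : Set Ω}
    (hB : MeasurableSet[locSigma h m₀ N] B) :
    MeasurableSet[m₀ ⊔ sigmaTest h (testIn D N₀)] (B ∩ E) := by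
  classical
  have hE' : MeasurableSet[m₀ ⊔ sigmaTest h (testIn D N₀)] E :=
    (le_sup_left : m₀ ≤ m₀ ⊔ sigmaTest h (testIn D N₀)) _ hE
  have : locSigma h m₀ N ≤ traceSigma (m₀ ⊔ sigmaTest h (testIn D N₀)) hE' := by
    refine sup_le (le_sup_left.trans (le_traceSigma hE')) (iSup_le fun ρ => ?_)
    by_cases hρ : tsupport ρ ⊆ N₀
    · refine comap_le_traceSigma hE' (g := fun ω => h ω ρ)
        ((measurable_sigmaTest h (L := testIn D N₀) hρ).mono le_sup_right le_rfl) fun ω hω => ?_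
      simp [hN ω hω, hρ]
    · refine comap_le_traceSigma hE' (g := fun _ => 0) measurable_const fun ω hω => ?_
      simp [hN ω hω, hρ]
  exact this _ hB

theorem measurable_indicator_locSigma {h : Ω → 𝓓'(D, ℝ)} {m₀ : MeasurableSpace Ω} {N : Ω → Set ℂ}
    {E : Set Ω} (hE : MeasurableSet[m₀] E) {N₀ : Set ℂ} (hN : ∀ ω ∈ E, N₀ ⊆ N ω) {g : Ω → ℝ}
    (hg : Measurable[sigmaTest h (testIn D N₀)] g) :
    Measurable[locSigma h m₀ N] (E.indicator g) := by
  classical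
  have hE' : MeasurableSet[locSigma h m₀ N] E := (le_sup_left : m₀ ≤ locSigma h m₀ N) _ hE
  have hle : sigmaTest h (testIn D N₀) ≤ traceSigma (locSigma h m₀ N) hE' := by
    refine iSup_le fun ρ => ?_
    refine comap_le_traceSigma hE' (measurable_locSigma h m₀ N ρ) fun ω hω => ?_
    have : tsupport (ρ : 𝓓(D, ℝ)) ⊆ N ω := Subset.trans ρ.2 (hN ω hω)
    simp [this]
  intro S hS
  rw [indicator_preimage, Set.ite]
  refine MeasurableSet.union (m := locSigma h m₀ N) (hle _ (hg hS))
    (MeasurableSet.diff (m := locSigma h m₀ N) ?_ hE')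
  by_cases h0 : (0 : ℝ) ∈ S
  · rw [show ((0 : Ω → ℝ) ⁻¹' S) = univ by ext; simp [h0]]
    exact @MeasurableSet.univ _ (locSigma h m₀ N)
  · rw [show ((0 : Ω → ℝ) ⁻¹' S) = ∅ by ext; simp [h0]]
    exact @MeasurableSet.empty _ (locSigma h m₀ N)

end LocSigma

/-! ### Discretization of a random closed set -/

/-- The mesh of the `n`-th discretization. -/
def mesh (n : ℕ) : ℝ := (1 / 4) ^ n

theorem mesh_pos (n : ℕ) : 0 < mesh n := by unfold mesh; positivity

theorem mesh_succ (n : ℕ) : mesh (n + 1) = mesh n / 4 := by unfold mesh; ring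

theorem tendsto_mesh : Filter.Tendsto mesh Filter.atTop (𝓝 0) :=
  tendsto_pow_atTop_nhds_zero_of_lt_one (by norm_num) (by norm_num)

/-- The `n`-th discretization of a closed set. -/
def disc (n : ℕ) : SimpleFunc ClosedSets ClosedSets :=
  (exists_simpleFunc_dist_lt (mesh_pos n)).choose

theorem dist_disc_lt (n : ℕ) (A : ClosedSets) : dist A (disc n A) < mesh n :=
  (exists_simpleFunc_dist_lt (mesh_pos n)).choose_spec A

/-- The neighbourhood attached to the `n`-th discretization. -/
def hood (D : Opens ℂ) (φ : ℂ → ℍ) (n : ℕ) (c : ClosedSets) : Set ℂ := nbhd D φ c (2 * mesh n)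

section Hood

variable {D : Opens ℂ} {φ : ℂ → ℍ}

/-- The ratio `1/4` of the meshes makes the neighbourhoods nested: with `ε = mesh n`, the required
radius is at most `ε/2 + ε/4 + ε`, which is less than `2ε`. -/
theorem hood_succ_subset (n : ℕ) (A : ClosedSets) :
    hood D φ (n + 1) (disc (n + 1) A) ⊆ hood D φ n (disc n A) := by
  refine nbhd_subset_nbhd ?_
  have h1 := dist_disc_lt n A
  have h2 := dist_disc_lt (n + 1) A
  have h3 := dist_triangle_left (disc (n + 1) A) (disc n A) A
  rw [mesh_succ] at *
  linarith [mesh_pos n]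

theorem near_subset_hood (n : ℕ) (A : ClosedSets) :
    near D φ A (mesh n) ⊆ hood D φ n (disc n A) :=
  near_subset_nbhd (by linarith [dist_disc_lt n A])

variable {Ω : Type*} (h : Ω → 𝓓'(D, ℝ)) (A : Ω → ClosedSets)

theorem measurableSet_disc_preimage (n : ℕ) (S : Set ClosedSets) :
    MeasurableSet[sigmaSet A] {ω | disc n (A ω) ∈ S} :=
  ⟨_, (disc n).measurableSet_preimage S, rfl⟩

/-- The σ-algebra generated by `m₀` and the field in the `n`-th neighbourhood of `A`. -/
@[reducible]
def sigmaHood (φ : ℂ → ℍ) (m₀ : MeasurableSpace Ω) (n : ℕ) : MeasurableSpace Ω :=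
  locSigma h m₀ fun ω => hood D φ n (disc n (A ω))

theorem antitone_sigmaHood {m₀ : MeasurableSpace Ω} (hA : sigmaSet A ≤ m₀) :
    Antitone (sigmaHood h A φ m₀) :=
  antitone_nat_of_succ_le fun n => locSigma_mono le_rfl (fun ω => hood_succ_subset n (A ω))
    fun ρ => hA _ (measurableSet_disc_preimage A (n + 1) {c | tsupport ρ ⊆ hood D φ (n + 1) c})

theorem sigmaNear_le_sigmaHood (hφ : ContinuousOn φ D) {m₀ : MeasurableSpace Ω}
    (hA : sigmaSet A ≤ m₀) (n : ℕ) : sigmaNear φ h A (mesh n) ≤ sigmaHood h A φ m₀ n := by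
  rw [sigmaNear_eq_locSigma]
  exact locSigma_mono hA (fun ω => near_subset_hood n (A ω)) fun ρ =>
    hA _ (measurableSet_setOf_tsupport_subset_near hφ ρ _)

theorem sigmaHood_le_sigmaNear {n : ℕ} {δ : ℝ} (hδ : 4 * mesh n ≤ δ) :
    sigmaHood h A φ (sigmaSet A) n ≤ sigmaNear φ h A δ := by
  rw [sigmaNear_eq_locSigma]
  refine locSigma_mono le_rfl (fun ω => ?_) fun ρ =>
    measurableSet_disc_preimage A n {c | tsupport ρ ⊆ hood D φ n c}
  exact nbhd_subset_near (by linarith [dist_disc_lt n (A ω), mesh_pos n])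

theorem sigmaHood_le {mΩ : MeasurableSpace Ω} (hh : Measurable h) (hA : Measurable A)
    {m₀ : MeasurableSpace Ω} (hm₀ : m₀ ≤ mΩ) (n : ℕ) : sigmaHood h A φ m₀ n ≤ mΩ := by
  refine sup_le hm₀ (iSup_le fun ρ => ?_)
  rw [← measurable_iff_comap_le]
  exact Measurable.ite (hA.comap_le _
    (measurableSet_disc_preimage A n {c | tsupport ρ ⊆ hood D φ n c}))
    ((measurable_eval ρ).comp hh) measurable_const

theorem sigmaGerm_le_sigmaHood (hφ : ContinuousOn φ D) {m₀ : MeasurableSpace Ω}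
    (hA : sigmaSet A ≤ m₀) (n : ℕ) : sigmaGerm φ h A ≤ sigmaHood h A φ m₀ n := by
  have := sigmaGerm_le_sigmaNear φ h A (δ := (1 / 4) ^ n) (by positivity)
  have e : (((1 / 4) ^ n : ℚ) : ℝ) = mesh n := by simp [mesh]
  rw [e] at this
  exact this.trans (sigmaNear_le_sigmaHood h A hφ hA n)

/-- The intersection along the discretized neighbourhoods recovers the germ; this is how the
limiting conditional mean is seen to be germ-measurable. -/
theorem iInf_sigmaHood_le_sigmaGerm : ⨅ n, sigmaHood h A φ (sigmaSet A) n ≤ sigmaGerm φ h A := by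
  refine le_iInf₂ fun δ hδ => ?_
  obtain ⟨n, hn⟩ := (tendsto_mesh.eventually (gt_mem_nhds (show (0 : ℝ) < δ / 4 by positivity))).exists
  exact (iInf_le _ n).trans (sigmaHood_le_sigmaNear h A (by linarith))

end Hood

/-! ### Measurability with respect to an intersection of σ-algebras -/

/-- The versions for different `n` differ on null sets. Their limsup is a single version, and it is
unchanged by dropping finitely many terms, so it is measurable for every `m k`. -/
theorem aestronglyMeasurable_iInf {Ω : Type*} {mΩ : MeasurableSpace Ω} {P : Measure Ω}
    {m : ℕ → MeasurableSpace Ω} (hm : Antitone m) {f : Ω → ℝ}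
    (hf : ∀ n, AEStronglyMeasurable[m n] f P) : AEStronglyMeasurable[⨅ n, m n] f P := by
  choose g hg hfg using hf
  refine ⟨fun ω => Filter.limsup (fun n => g n ω) Filter.atTop, ?_, ?_⟩
  · refine Measurable.stronglyMeasurable ?_
    rw [measurable_iff_comap_le]
    refine le_iInf fun k => ?_
    rw [← measurable_iff_comap_le]
    have e : (fun ω => Filter.limsup (fun n => g n ω) Filter.atTop) =
        fun ω => Filter.limsup (fun n => g (n + k) ω) Filter.atTop := by
      ext ω
      exact (Filter.limsup_nat_add (fun n => g n ω) k).symm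
    rw [e]
    have hgk : ∀ n, Measurable[m k] (g (n + k)) := fun n =>
      ((hg (n + k)).measurable).mono (hm (Nat.le_add_left k n)) le_rfl
    exact Measurable.limsup hgk
  · filter_upwards [ae_all_iff.2 hfg] with ω hω
    simp [← hω]

/-! ### Gluing along a discretization -/

theorem apply_simpleFunc_eq_sum {Ω γ E : Type*} {mΩ : MeasurableSpace Ω} [AddCommMonoid E]
    (s : SimpleFunc Ω γ) (Z : γ → Ω → E) :
    (fun ω => Z (s ω) ω) = fun ω => ∑ c ∈ s.range, (s ⁻¹' {c}).indicator (Z c) ω := by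
  ext ω
  rw [Finset.sum_eq_single (s ω)]
  · simp
  · intro c _ hc
    exact indicator_of_notMem (fun h => hc h.symm) _
  · exact fun h => absurd (s.mem_range_self ω) h

end

section

open scoped Topology ENNReal

/-! ### The conditional mean given a union of local sets -/

variable {Ω : Type*} {mΩ : MeasurableSpace Ω}

/-- `A` is the union of the local sets `A₁` and `A₂`, conditionally independent given the field
`h`. -/
structure IsLocalUnion (P : Measure Ω) {D : Opens ℂ} (hI : HasInvLap D) (m : 𝓓(D, ℝ) →ₗ[ℝ] ℝ)
    (h : Ω → 𝓓'(D, ℝ)) (φ : ℂ → ℍ) (A₁ A₂ A : Ω → ClosedSets) : Prop where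
  field : IsGaussianField P hI m h
  mean_lap : ∀ g, m (lap g) = 0
  holomorphic : DifferentiableOn ℂ (fun z => (φ z : ℂ)) D
  measurable₁ : Measurable A₁
  measurable₂ : Measurable A₂
  local₁ : IsLocal P φ h A₁
  local₂ : IsLocal P φ h A₂
  condIndep : CondIndepSets P h A₁ A₂
  eq_sup : ∀ ω, A ω = A₁ ω ⊔ A₂ ω

namespace IsLocalUnion

variable {P : Measure Ω} [IsProbabilityMeasure P] {D : Opens ℂ} {hI : HasInvLap D}
  {m : 𝓓(D, ℝ) →ₗ[ℝ] ℝ} {h : Ω → 𝓓'(D, ℝ)} {φ : ℂ → ℍ} {A₁ A₂ A : Ω → ClosedSets}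

omit [IsProbabilityMeasure P] in
theorem sigmaSet_le (S : IsLocalUnion P hI m h φ A₁ A₂ A) :
    sigmaSet A ≤ sigmaSet A₁ ⊔ sigmaSet A₂ := by
  rw [← measurable_iff_comap_le, funext S.eq_sup]
  exact measurable_sup_closedSets (m := sigmaSet A₁ ⊔ sigmaSet A₂)
    ((comap_measurable A₁).mono le_sup_left le_rfl) ((comap_measurable A₂).mono le_sup_right le_rfl)

omit [IsProbabilityMeasure P] in
theorem pair_le (S : IsLocalUnion P hI m h φ A₁ A₂ A) : sigmaSet A₁ ⊔ sigmaSet A₂ ≤ mΩ :=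
  sup_le S.measurable₁.comap_le S.measurable₂.comap_le

omit [IsProbabilityMeasure P] in
theorem measurable (S : IsLocalUnion P hI m h φ A₁ A₂ A) : Measurable A :=
  measurable_iff_comap_le.2 (S.sigmaSet_le.trans S.pair_le)

omit [IsProbabilityMeasure P] in
theorem continuousOn (S : IsLocalUnion P hI m h φ A₁ A₂ A) : ContinuousOn φ D :=
  continuousOn_chart S.holomorphic

/-- The σ-algebra of the `n`-th neighbourhood of `A`, together with `A₁` and `A₂`. -/
@[reducible]
def pairHood (_ : IsLocalUnion P hI m h φ A₁ A₂ A) (n : ℕ) : MeasurableSpace Ω :=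
  sigmaHood h A φ (sigmaSet A₁ ⊔ sigmaSet A₂) n

/-- The germ σ-algebra of `A`, together with `A₁` and `A₂`. -/
@[reducible]
def pairGerm (_ : IsLocalUnion P hI m h φ A₁ A₂ A) : MeasurableSpace Ω :=
  sigmaGerm φ h A ⊔ (sigmaSet A₁ ⊔ sigmaSet A₂)

omit [IsProbabilityMeasure P] in
theorem pairHood_le (S : IsLocalUnion P hI m h φ A₁ A₂ A) (n : ℕ) : S.pairHood n ≤ mΩ :=
  sigmaHood_le h A S.field.measurable S.measurable S.pair_le n

omit [IsProbabilityMeasure P] in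
theorem pairGerm_le_pairHood (S : IsLocalUnion P hI m h φ A₁ A₂ A) (n : ℕ) :
    S.pairGerm ≤ S.pairHood n :=
  sup_le (sigmaGerm_le_sigmaHood h A S.continuousOn S.sigmaSet_le n) le_sup_left

omit [IsProbabilityMeasure P] in
theorem pairGerm_le (S : IsLocalUnion P hI m h φ A₁ A₂ A) : S.pairGerm ≤ mΩ :=
  (S.pairGerm_le_pairHood 0).trans (S.pairHood_le 0)

/-- The discretization of `A`, as a simple function. -/
def discSet (S : IsLocalUnion P hI m h φ A₁ A₂ A) (n : ℕ) : SimpleFunc Ω ClosedSets :=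
  (disc n).comp A S.measurable

omit [IsProbabilityMeasure P] in
theorem discSet_apply (S : IsLocalUnion P hI m h φ A₁ A₂ A) (n : ℕ) (ω : Ω) :
    S.discSet n ω = disc n (A ω) := rfl

omit [IsProbabilityMeasure P] in
theorem integrable_glue (S : IsLocalUnion P hI m h φ A₁ A₂ A) (n : ℕ) {Z : ClosedSets → Ω → ℂ}
    (hZ : ∀ c, Integrable (Z c) P) : Integrable (fun ω => Z (disc n (A ω)) ω) P := by
  have e := apply_simpleFunc_eq_sum (S.discSet n) Z
  simp only [discSet_apply] at e
  rw [e]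
  exact integrable_finsetSum _ fun c _ => (hZ c).indicator ((S.discSet n).measurableSet_fiber c)

/-- On the event `disc n A = c`, both `A₁` and `A₂` lie in the closed `mesh n`-neighbourhood of `c`,
since their union does. The deterministic statement then applies with `V` the points of `D` beyond
that distance and `N = hood D φ n c`. -/
theorem condExp_glue (S : IsLocalUnion P hI m h φ A₁ A₂ A) (n : ℕ) {Z : ClosedSets → Ω → ℂ}
    (hZ : ∀ c, Integrable (Z c) P)
    (hZm : ∀ c, AEStronglyMeasurable[MeasurableSpace.comap h inferInstance] (Z c) P)
    (h0 : ∀ c, P[Z c | sigmaTest h (testIn D (hood D φ n c))] =ᵐ[P] 0) :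
    P[fun ω => Z (disc n (A ω)) ω | S.pairHood n] =ᵐ[P] 0 := by
  rw [condExp_eq_zero_iff (S.pairHood_le n) (S.integrable_glue n hZ)]
  intro B hB
  have e := apply_simpleFunc_eq_sum (S.discSet n) Z
  simp only [discSet_apply] at e
  rw [e, integral_finsetSum _ fun c _ =>
    ((hZ c).indicator ((S.discSet n).measurableSet_fiber c)).integrableOn]
  refine Finset.sum_eq_zero fun c _ => ?_
  rw [setIntegral_indicator ((S.discSet n).measurableSet_fiber c)]
  set E := S.discSet n ⁻¹' {c} with hE
  have hEc : ∀ ω ∈ E, disc n (A ω) = c := fun ω hω => hω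
  have hEm : MeasurableSet[sigmaSet A₁ ⊔ sigmaSet A₂] E :=
    S.sigmaSet_le _ (measurableSet_disc_preimage A n {c})
  set G : Set ClosedSets :=
    {B | (B : Set HBar) ⊆ {p | Metric.infDist p (c : Set HBar) ≤ mesh n}} with hG
  have hEG : B ∩ E = (B ∩ E) ∩ (A₁ ⁻¹' G ∩ A₂ ⁻¹' G) := by
    refine (inter_eq_left.2 fun ω hω => ?_).symm
    have h1 : (A ω : Set HBar) ⊆ {p | Metric.infDist p (c : Set HBar) ≤ mesh n} := by
      refine subset_thickening_of_dist_le ?_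
      rw [← hEc ω hω.2]
      exact (dist_disc_lt n (A ω)).le
    rw [S.eq_sup] at h1
    exact ⟨Subset.trans (SetLike.coe_subset_coe.2 (le_sup_left : A₁ ω ≤ A₁ ω ⊔ A₂ ω)) h1,
      Subset.trans (SetLike.coe_subset_coe.2 (le_sup_right : A₂ ω ≤ A₁ ω ⊔ A₂ ω)) h1⟩
  rw [hEG]
  refine S.field.setIntegral_eq_zero_of_condIndepSets S.mean_lap S.continuousOn S.measurable₁
    S.measurable₂ S.local₁ S.local₂ S.condIndep
    (coSupp_nbhd_le hI S.holomorphic c (mesh_pos n)) (measurableSet_subset_thickening c (mesh n))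
    (fun a ha => far_subset_off ha) (hZ c) (hZm c) (h0 c) ?_
  exact locSigma_inter hEm (fun ω hω => by rw [hEc ω hω]; rfl) hB

/-- The projection of `x ∈ H(D)` given the field in the `n`-th neighbourhood. -/
def known (_ : IsLocalUnion P hI m h φ A₁ A₂ A) (x : DirichletSpace D) (n : ℕ) (c : ClosedSets) :
    DirichletSpace D := x - (coSupp hI (hood D φ n c)).starProjection x

/-- The conditional mean of the variable attached to `x` given the `n`-th neighbourhood. -/
def approx (S : IsLocalUnion P hI m h φ A₁ A₂ A) (x : DirichletSpace D) (n : ℕ) (ω : Ω) : ℝ :=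
  S.field.white (S.known x n (disc n (A ω))) ω

omit [IsProbabilityMeasure P] in
theorem known_mem (S : IsLocalUnion P hI m h φ A₁ A₂ A) (x : DirichletSpace D) (n : ℕ)
    (c : ClosedSets) : S.known x n c ∈ (coSupp hI (hood D φ n c))ᗮ :=
  Submodule.sub_starProjection_mem_orthogonal (K := coSupp hI (hood D φ n c)) x

omit [IsProbabilityMeasure P] in
theorem white_sub_known (S : IsLocalUnion P hI m h φ A₁ A₂ A) (x : DirichletSpace D) (n : ℕ)
    (c : ClosedSets) : S.field.white ((coSupp hI (hood D φ n c)).starProjection x) =ᵐ[P]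
      S.field.white x - S.field.white (S.known x n c) := by
  have : (coSupp hI (hood D φ n c)).starProjection x = x - S.known x n c := by simp [known]
  rw [this, map_sub]
  exact Lp.coeFn_sub _ _

theorem condExp_sub_approx (S : IsLocalUnion P hI m h φ A₁ A₂ A) (x : DirichletSpace D) (n : ℕ) :
    P[fun ω => ((S.field.white x ω - S.approx x n ω : ℝ) : ℂ) | S.pairHood n] =ᵐ[P] 0 := by
  refine S.condExp_glue n
    (Z := fun c ω => ((S.field.white x ω - S.field.white (S.known x n c) ω : ℝ) : ℂ)) ?_ ?_ ?_
  · exact fun c => integrable_complex_ofReal (((Lp.memLp _).integrable one_le_two).sub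
      ((Lp.memLp _).integrable one_le_two))
  · exact fun c => Complex.continuous_ofReal.comp_aestronglyMeasurable
      ((S.field.aestronglyMeasurable_white_comap _).sub (S.field.aestronglyMeasurable_white_comap _))
  · intro c
    refine condExp_ofReal_eq_zero (sigmaTest_le S.field.measurable _)
      (((Lp.memLp _).integrable one_le_two).sub ((Lp.memLp _).integrable one_le_two)) ?_
    exact (condExp_congr_ae (S.white_sub_known x n c).symm).trans
      (S.field.condExp_white_eq_zero
        (Submodule.starProjection_apply_mem (coSupp hI (hood D φ n c)) x))

theorem condExp_expI_sub_approx (S : IsLocalUnion P hI m h φ A₁ A₂ A) (x : DirichletSpace D)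
    (n : ℕ) :
    P[fun ω => expI (S.field.white x ω) - expI (S.approx x n ω) * (Real.exp
      (-(‖(coSupp hI (hood D φ n (disc n (A ω)))).starProjection x‖ ^ 2 / 2)) : ℂ) |
        S.pairHood n] =ᵐ[P] 0 := by
  refine S.condExp_glue n (Z := fun c ω => expI (S.field.white x ω) -
    expI (S.field.white (S.known x n c) ω) * (Real.exp
      (-(‖(coSupp hI (hood D φ n c)).starProjection x‖ ^ 2 / 2)) : ℂ)) ?_ ?_ ?_
  · exact fun c => (S.field.integrable_expI_white _).sub
      ((S.field.integrable_expI_white _).mul_const _)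
  · exact fun c => (aestronglyMeasurable_expI (S.field.aestronglyMeasurable_white_comap _)).sub
      ((aestronglyMeasurable_expI (S.field.aestronglyMeasurable_white_comap _)).mul
        aestronglyMeasurable_const)
  · intro c
    set y := (coSupp hI (hood D φ n c)).starProjection x with hy
    have e : (fun ω => expI (S.field.white x ω) - expI (S.field.white (S.known x n c) ω) *
        (Real.exp (-(‖y‖ ^ 2 / 2)) : ℂ)) =ᵐ[P] fun ω => expI (S.field.white (S.known x n c) ω) *
          (expI (S.field.white y ω) - (Real.exp (-(‖y‖ ^ 2 / 2)) : ℂ)) := by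
      filter_upwards [S.white_sub_known x n c] with ω hω
      rw [hω, mul_sub, ← expI_add, Pi.sub_apply]
      ring_nf
    refine (condExp_congr_ae e).trans (condExp_mul_eq_zero
      ((S.field.integrable_expI_white _).sub (integrable_const _))
      (S.field.condExp_expI_white_sub
        (Submodule.starProjection_apply_mem (coSupp hI (hood D φ n c)) x))
      (aestronglyMeasurable_expI (S.field.aestronglyMeasurable_white (S.known_mem x n c))) ?_)
    exact Integrable.congr ((S.field.integrable_expI_white _).sub
      ((S.field.integrable_expI_white _).mul_const _)) e

omit [IsProbabilityMeasure P] in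
theorem approx_eq_sum (S : IsLocalUnion P hI m h φ A₁ A₂ A) (x : DirichletSpace D) (n : ℕ) :
    S.approx x n = fun ω => ∑ c ∈ (S.discSet n).range,
      (S.discSet n ⁻¹' {c}).indicator (S.field.white (S.known x n c)) ω :=
  apply_simpleFunc_eq_sum (S.discSet n) fun c => S.field.white (S.known x n c)

omit [IsProbabilityMeasure P] in
theorem memLp_approx (S : IsLocalUnion P hI m h φ A₁ A₂ A) (x : DirichletSpace D) (n : ℕ) :
    MemLp (S.approx x n) 2 P := by
  rw [approx_eq_sum]
  exact memLp_finsetSum _ fun c _ =>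
    (Lp.memLp (S.field.white (S.known x n c))).indicator ((S.discSet n).measurableSet_fiber c)

omit [IsProbabilityMeasure P] in
theorem aestronglyMeasurable_approx (S : IsLocalUnion P hI m h φ A₁ A₂ A) (x : DirichletSpace D)
    (n : ℕ) : AEStronglyMeasurable[sigmaHood h A φ (sigmaSet A) n] (S.approx x n) P := by
  rw [approx_eq_sum]
  have key : ∀ c, AEStronglyMeasurable[sigmaHood h A φ (sigmaSet A) n]
      ((S.discSet n ⁻¹' {c}).indicator (S.field.white (S.known x n c))) P := by
    intro c
    obtain ⟨g, hg, hfg⟩ := S.field.aestronglyMeasurable_white (S.known_mem x n c)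
    refine ⟨(S.discSet n ⁻¹' {c}).indicator g, ?_, ?_⟩
    · refine (measurable_indicator_locSigma (measurableSet_disc_preimage A n {c})
        (N₀ := hood D φ n c) (fun ω hω => ?_) hg.measurable).stronglyMeasurable
      rw [show disc n (A ω) = c from hω]
    · filter_upwards [hfg] with ω hω
      simp only [indicator, hω]
  choose g hg hfg using key
  refine ⟨fun ω => ∑ c ∈ (S.discSet n).range, g c ω,
    Finset.stronglyMeasurable_fun_sum _ fun c _ => hg c, ?_⟩
  filter_upwards [(Finset.eventually_all _).2 fun c (_ : c ∈ (S.discSet n).range) => hfg c] with ω hω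
  exact Finset.sum_congr rfl hω

/-- The conditional mean given the `n`-th neighbourhood, as an element of `L²`. -/
def approxLp (S : IsLocalUnion P hI m h φ A₁ A₂ A) (x : DirichletSpace D) (n : ℕ) : Lp ℝ 2 P :=
  (S.memLp_approx x n).toLp _

omit [IsProbabilityMeasure P] in
theorem coeFn_approxLp (S : IsLocalUnion P hI m h φ A₁ A₂ A) (x : DirichletSpace D) (n : ℕ) :
    S.approxLp x n =ᵐ[P] S.approx x n := MemLp.coeFn_toLp (S.memLp_approx x n)

omit [IsProbabilityMeasure P] in
theorem antitone_sigmaHood_set (_ : IsLocalUnion P hI m h φ A₁ A₂ A) :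
    Antitone (sigmaHood h A φ (sigmaSet A)) := antitone_sigmaHood h A le_rfl

omit [IsProbabilityMeasure P] in
theorem sigmaHood_le_pairHood (S : IsLocalUnion P hI m h φ A₁ A₂ A) (n : ℕ) :
    sigmaHood h A φ (sigmaSet A) n ≤ S.pairHood n :=
  locSigma_mono S.sigmaSet_le (fun _ => Subset.rfl) fun ρ =>
    S.sigmaSet_le _ (measurableSet_disc_preimage A n {c | tsupport ρ ⊆ hood D φ n c})

theorem integral_mul_sub_approx (S : IsLocalUnion P hI m h φ A₁ A₂ A) (x : DirichletSpace D) (n : ℕ)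
    (f : Lp ℝ 2 P) (hf : AEStronglyMeasurable[S.pairHood n] f P) :
    inner ℝ f (S.field.white x - S.approxLp x n) = 0 := by
  have hd : MemLp (fun ω => S.field.white x ω - S.approx x n ω) 2 P :=
    (Lp.memLp _).sub (S.memLp_approx x n)
  have hi : Integrable (fun ω => f ω * (S.field.white x ω - S.approx x n ω)) P :=
    (Lp.memLp f).integrable_mul hd
  have h1 := integral_mul_eq_zero (S.pairHood_le n) (f := fun ω => ((f ω : ℝ) : ℂ))
    (integrable_complex_ofReal (hd.integrable one_le_two))
    (S.condExp_sub_approx x n) (Complex.continuous_ofReal.comp_aestronglyMeasurable hf) (by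
      simp only [← Complex.ofReal_mul]
      exact integrable_complex_ofReal hi)
  simp only [← Complex.ofReal_mul] at h1
  rw [integral_complex_ofReal, Complex.ofReal_eq_zero] at h1
  rw [L2.inner_def, ← h1]
  refine integral_congr_ae ?_
  filter_upwards [Lp.coeFn_sub (S.field.white x) (S.approxLp x n), S.coeFn_approxLp x n]
    with ω h1 h2
  rw [h1, Pi.sub_apply, h2]
  simp [mul_comm]

/-- The approximations are the orthogonal projections of `white x` on the decreasing `L²` spaces of
the neighbourhoods: a reverse martingale in `L²`. Convergence follows by applying the increasing
case to the orthogonal complements. -/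
theorem exists_tendsto_approxLp (S : IsLocalUnion P hI m h φ A₁ A₂ A) (x : DirichletSpace D) :
    ∃ M : Lp ℝ 2 P, Filter.Tendsto (S.approxLp x) Filter.atTop (𝓝 M) := by
  let K : ℕ → Submodule ℝ (Lp ℝ 2 P) := fun n => lpMeas ℝ ℝ (sigmaHood h A φ (sigmaSet A) n) 2 P
  have hle : ∀ n, sigmaHood h A φ (sigmaSet A) n ≤ mΩ := fun n =>
    (S.sigmaHood_le_pairHood n).trans (S.pairHood_le n)
  have hK : ∀ n, CompleteSpace (K n) := fun n => by
    have : Fact (sigmaHood h A φ (sigmaSet A) n ≤ mΩ) := ⟨hle n⟩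
    infer_instance
  have hanti : Antitone K := fun a b hab f hf => by
    rw [mem_lpMeas_iff_aestronglyMeasurable] at hf ⊢
    exact hf.mono (S.antitone_sigmaHood_set hab)
  have hproj : ∀ n, (K n).starProjection (S.field.white x) = S.approxLp x n := by
    intro n
    refine Submodule.eq_starProjection_of_mem_of_inner_eq_zero ?_ fun f hf => ?_
    · rw [mem_lpMeas_iff_aestronglyMeasurable]
      exact (S.aestronglyMeasurable_approx x n).congr (S.coeFn_approxLp x n).symm
    · rw [mem_lpMeas_iff_aestronglyMeasurable] at hf
      rw [real_inner_comm]
      exact S.integral_mul_sub_approx x n f (hf.mono (S.sigmaHood_le_pairHood n))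
  have hmono : Monotone fun n => (K n)ᗮ := fun a b hab => Submodule.orthogonal_le (hanti hab)
  have := Submodule.starProjection_tendsto_closure_iSup (fun n => (K n)ᗮ) hmono (S.field.white x)
  have h2 := (tendsto_const_nhds (x := S.field.white x)).sub this
  refine ⟨_, h2.congr fun n => ?_⟩
  rw [Submodule.starProjection_orthogonal_val, hproj]
  simp

/-- The conditional mean of the variable attached to `x ∈ H(D)` given the germ of `A`. -/
theorem exists_condMean (S : IsLocalUnion P hI m h φ A₁ A₂ A) (x : DirichletSpace D) :
    ∃ M : Ω → ℝ, StronglyMeasurable[sigmaGerm φ h A] M ∧ Integrable M P ∧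
      P[fun ω => S.field.white x ω - M ω | S.pairGerm] =ᵐ[P] 0 ∧
      P[fun ω => expI (S.field.white x ω) - expI (M ω) * (Real.exp
        (-(‖(suppSpace D (off D φ (A ω))).starProjection x‖ ^ 2 / 2)) : ℂ) |
          S.pairGerm] =ᵐ[P] 0 ∧
      ∀ g : 𝓓(D, ℝ), x = toH g → ∀ᵐ ω ∂P, tsupport g ⊆ off D φ (A ω) → M ω = 0 := by
  obtain ⟨M, hM⟩ := S.exists_tendsto_approxLp x
  have hgerm : AEStronglyMeasurable[sigmaGerm φ h A] M P := by
    refine (aestronglyMeasurable_iInf S.antitone_sigmaHood_set fun n => ?_).mono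
      (iInf_sigmaHood_le_sigmaGerm h A)
    have hcl := isClosed_aestronglyMeasurable (F := ℝ) (p := 2) (μ := P)
      ((S.sigmaHood_le_pairHood n).trans (S.pairHood_le n))
    refine hcl.mem_of_tendsto hM ?_
    filter_upwards [Filter.eventually_ge_atTop n] with k hk
    exact ((S.aestronglyMeasurable_approx x k).congr (S.coeFn_approxLp x k).symm).mono
      (S.antitone_sigmaHood_set hk)
  -- Pointwise convergence along a subsequence serves twice: for dominated convergence of the
  -- characteristic functionals, and to identify the limit as zero when `x` is supported off `A`.
  obtain ⟨ns, hns, hae⟩ := (tendstoInMeasure_of_tendsto_Lp hM).exists_seq_tendsto_ae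
  have hae' : ∀ᵐ ω ∂P, Filter.Tendsto (fun k => S.approx x (ns k) ω) Filter.atTop
      (𝓝 (hgerm.mk M ω)) := by
    filter_upwards [hae, ae_all_iff.2 fun n => S.coeFn_approxLp x n, hgerm.ae_eq_mk] with ω h1 h2 h3
    rw [← h3]
    simpa only [h2] using h1
  have hMi : Integrable M P := (Lp.memLp M).integrable one_le_two
  have hMi' : Integrable (hgerm.mk M) P := hMi.congr hgerm.ae_eq_mk
  have hwi : Integrable (S.field.white x) P := (Lp.memLp _).integrable one_le_two
  refine ⟨hgerm.mk M, hgerm.stronglyMeasurable_mk, hMi', ?_, ?_, ?_⟩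
  · refine (condExp_eq_zero_iff S.pairGerm_le (hwi.sub hMi')).2 fun F hF => ?_
    have hF' := S.pairGerm_le _ hF
    have h1 : ∀ n, inner ℝ (indicatorConstLp 2 hF' (measure_ne_top P F) (1 : ℝ))
        (S.field.white x - S.approxLp x n) = 0 := fun n => by
      refine S.integral_mul_sub_approx x n _ ?_
      exact AEStronglyMeasurable.congr ⟨F.indicator fun _ => 1,
        stronglyMeasurable_const.indicator (S.pairGerm_le_pairHood n _ hF),
        Filter.EventuallyEq.rfl⟩ indicatorConstLp_coeFn.symm
    have h2 : inner ℝ (indicatorConstLp 2 hF' (measure_ne_top P F) (1 : ℝ))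
        (S.field.white x - M) = 0 :=
      tendsto_nhds_unique (Filter.Tendsto.inner tendsto_const_nhds (tendsto_const_nhds.sub hM))
        (by simp only [h1]; exact tendsto_const_nhds)
    rw [L2.inner_indicatorConstLp_one] at h2
    rw [← h2]
    refine integral_congr_ae (ae_restrict_of_ae ?_)
    filter_upwards [Lp.coeFn_sub (S.field.white x) M, hgerm.ae_eq_mk] with ω h1 h2
    rw [h1, Pi.sub_apply, Pi.sub_apply, h2]
  · have hmeasD : ∀ n, Measurable fun ω =>
        ‖(coSupp hI (hood D φ n (disc n (A ω)))).starProjection x‖ ^ 2 := fun n => by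
      have := ((S.discSet n).map fun c =>
        ‖(coSupp hI (hood D φ n c)).starProjection x‖ ^ 2).measurable
      rwa [SimpleFunc.coe_map] at this
    have hlim : ∀ ω, Filter.Tendsto
        (fun n => ‖(coSupp hI (hood D φ n (disc n (A ω)))).starProjection x‖ ^ 2) Filter.atTop
          (𝓝 (‖(suppSpace D (off D φ (A ω))).starProjection x‖ ^ 2)) := fun ω =>
      ((tendsto_starProjection_coSupp hI S.holomorphic (A ω) (fun n => disc n (A ω)) mesh_pos
        tendsto_mesh (fun n => dist_disc_lt n (A ω)) x).norm.pow 2)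
    have hmeasL : Measurable fun ω =>
        ‖(suppSpace D (off D φ (A ω))).starProjection x‖ ^ 2 :=
      measurable_of_tendsto_metrizable hmeasD (tendsto_pi_nhds.2 hlim)
    have hb : ∀ (a : ℝ) (y : DirichletSpace D),
        ‖expI a * (Real.exp (-(‖y‖ ^ 2 / 2)) : ℂ)‖ ≤ 1 := fun a y => by
      rw [norm_mul, norm_expI, one_mul, Complex.norm_real, Real.norm_eq_abs, abs_of_pos
        (Real.exp_pos _), Real.exp_le_one_iff]
      have := sq_nonneg ‖y‖
      linarith
    have hapm : ∀ n, AEStronglyMeasurable (fun ω => expI (S.approx x n ω) * (Real.exp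
        (-(‖(coSupp hI (hood D φ n (disc n (A ω)))).starProjection x‖ ^ 2 / 2)) : ℂ)) P := fun n =>
      (aestronglyMeasurable_expI (S.memLp_approx x n).1).mul
        (Complex.measurable_ofReal.comp (Real.measurable_exp.comp
          ((hmeasD n).div_const 2).neg)).aestronglyMeasurable
    have hlm : AEStronglyMeasurable (fun ω => expI (hgerm.mk M ω) * (Real.exp
        (-(‖(suppSpace D (off D φ (A ω))).starProjection x‖ ^ 2 / 2)) : ℂ)) P :=
      (aestronglyMeasurable_expI hMi'.1).mul
        (Complex.measurable_ofReal.comp (Real.measurable_exp.comp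
          (hmeasL.div_const 2).neg)).aestronglyMeasurable
    have hli := integrable_of_bounded (C := 1) hlm fun ω => hb _ _
    refine (condExp_eq_zero_iff S.pairGerm_le ((S.field.integrable_expI_white x).sub hli)).2
      fun F hF => ?_
    have h1 : ∀ n, ∫ ω in F, expI (S.approx x n ω) * (Real.exp
        (-(‖(coSupp hI (hood D φ n (disc n (A ω)))).starProjection x‖ ^ 2 / 2)) : ℂ) ∂P =
          ∫ ω in F, expI (S.field.white x ω) ∂P := fun n => by
      have hi := integrable_of_bounded (C := 1) (hapm n) fun ω => hb _ _
      have := (condExp_eq_zero_iff (S.pairHood_le n) ((S.field.integrable_expI_white x).sub hi)).1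
        (S.condExp_expI_sub_approx x n) F (S.pairGerm_le_pairHood n _ hF)
      simp only [Pi.sub_apply] at this
      rw [integral_sub (S.field.integrable_expI_white x).integrableOn hi.integrableOn,
        sub_eq_zero] at this
      exact this.symm
    have h2 := tendsto_integral_of_dominated_convergence (μ := P.restrict F)
      (F := fun k ω => expI (S.approx x (ns k) ω) * (Real.exp
        (-(‖(coSupp hI (hood D φ (ns k) (disc (ns k) (A ω)))).starProjection x‖ ^ 2 / 2)) : ℂ))
      (f := fun ω => expI (hgerm.mk M ω) * (Real.exp
        (-(‖(suppSpace D (off D φ (A ω))).starProjection x‖ ^ 2 / 2)) : ℂ)) (fun _ => 1)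
      (fun k => (hapm (ns k)).restrict) (integrable_const _) (fun k => .of_forall fun ω => hb _ _)
      (ae_restrict_of_ae (by
        filter_upwards [hae'] with ω hω
        refine ((continuous_expI.tendsto _).comp hω).mul
          ((Complex.continuous_ofReal.tendsto _).comp ((Real.continuous_exp.tendsto _).comp ?_))
        exact (((hlim ω).comp hns.tendsto_atTop).div_const 2).neg))
    simp only [h1] at h2
    have h3 := tendsto_nhds_unique h2 tendsto_const_nhds
    simp only [Pi.sub_apply]
    rw [integral_sub (S.field.integrable_expI_white x).integrableOn hli.integrableOn, h3, sub_self]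
  · rintro g rfl
    -- The value of `white 0` at a point is zero only almost everywhere. The discretizations have
    -- finite range, so one null set covers every `n` and `c`.
    have hz : ∀ᵐ ω ∂P, ∀ n, ∀ c ∈ (S.discSet n).range, S.known (toH g) n c = 0 →
        S.field.white (S.known (toH g) n c) ω = 0 := by
      refine ae_all_iff.2 fun n => (Finset.eventually_all _).2 fun c _ => ?_
      by_cases hc : S.known (toH g) n c = 0
      · rw [hc, map_zero]
        filter_upwards [Lp.coeFn_zero ℝ 2 P] with ω hω _
        rw [hω]; rfl
      · exact .of_forall fun ω h0 => absurd h0 hc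
    filter_upwards [hae', hz] with ω h1 h2 hsupp
    refine tendsto_nhds_unique h1 (tendsto_const_nhds.congr' ?_)
    have h3 := hns.tendsto_atTop.eventually (eventually_disjoint_nbhd S.continuousOn (A ω)
      (fun n => disc n (A ω)) tendsto_mesh (fun n => dist_disc_lt n (A ω)) hsupp)
    filter_upwards [h3] with k hk
    refine (h2 (ns k) (disc (ns k) (A ω)) ((S.discSet (ns k)).mem_range_self ω) ?_).symm
    have := Submodule.starProjection_eq_self_iff.2 (toH_mem_coSupp hI hk)
    rw [known, sub_eq_zero]
    exact this.symm

end IsLocalUnion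

end

/-! ### Random distributions: countable determination, standard Borel structure, conditional laws.
-/

section

open scoped Topology ENNReal

/-! ### Second countability of the spaces of test functions with support in a compact set -/

instance (i : ℕ) : FiniteDimensional ℝ (ContinuousMultilinearMap ℝ (fun _ : Fin i => ℂ) ℝ) :=
  FiniteDimensional.of_injective
    (⟨⟨fun f => f.toMultilinearMap, fun _ _ => rfl⟩, fun _ _ => rfl⟩ :
      ContinuousMultilinearMap ℝ (fun _ : Fin i => ℂ) ℝ →ₗ[ℝ]
        MultilinearMap ℝ (fun _ : Fin i => ℂ) ℝ)
    ContinuousMultilinearMap.toMultilinearMap_injective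

instance (i : ℕ) : SecondCountableTopology (ContinuousMultilinearMap ℝ (fun _ : Fin i => ℂ) ℝ) :=
  have := FiniteDimensional.proper_real (ContinuousMultilinearMap ℝ (fun _ : Fin i => ℂ) ℝ)
  secondCountable_of_proper

theorem induced_eq_induced_of_dist_eq {X Y Z : Type*} [PseudoMetricSpace Y] [PseudoMetricSpace Z]
    (s : X → Y) (t : X → Z) (hst : ∀ x y, dist (s x) (s y) = dist (t x) (t y)) :
    TopologicalSpace.induced s inferInstance = TopologicalSpace.induced t inferInstance := by
  have : PseudoMetricSpace.induced s inferInstance = PseudoMetricSpace.induced t inferInstance := by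
    ext x y
    exact hst x y
  exact congrArg (fun m : PseudoMetricSpace X => m.toUniformSpace.toTopologicalSpace) this

-- The seminorms are suprema over the plane of bounded continuous functions, a space that is not
-- separable. Since all derivatives vanish off `K`, the same topology is induced by restriction to
-- the compact set `K`, where continuous functions form a separable space.
open ContDiffMapSupportedIn in
instance (K : Compacts ℂ) : SecondCountableTopology 𝓓_{K}(ℂ, ℝ) := by
  have key : (ContDiffMapSupportedIn.topologicalSpace : TopologicalSpace 𝓓_{K}(ℂ, ℝ)) =
      ⨅ i : ℕ, TopologicalSpace.induced (fun f : 𝓓_{K}(ℂ, ℝ) =>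
        ((structureMapLM ℝ (⊤ : ℕ∞) i f).toContinuousMap.restrict (K : Set ℂ)))
        inferInstance := by
    refine iInf_congr fun i => ?_
    refine induced_eq_induced_of_dist_eq _ _ fun f g => le_antisymm ?_ ?_
    · refine (BoundedContinuousFunction.dist_le dist_nonneg).2 fun z => ?_
      by_cases hz : z ∈ (K : Set ℂ)
      · exact ContinuousMap.dist_apply_le_dist
          (f := (structureMapLM ℝ (⊤ : ℕ∞) i f).toContinuousMap.restrict (K : Set ℂ))
          (g := (structureMapLM ℝ (⊤ : ℕ∞) i g).toContinuousMap.restrict (K : Set ℂ)) ⟨z, hz⟩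
      · rw [structureMapLM_top_apply, structureMapLM_top_apply,
          f.iteratedFDeriv_zero_on_compl hz, g.iteratedFDeriv_zero_on_compl hz, dist_self]
        exact dist_nonneg
    · refine (ContinuousMap.dist_le dist_nonneg).2 fun z => ?_
      exact BoundedContinuousFunction.dist_coe_le_dist (f := structureMapLM ℝ (⊤ : ℕ∞) i f)
        (g := structureMapLM ℝ (⊤ : ℕ∞) i g) (z : ℂ)
  rw [key]
  exact secondCountableTopology_iInf fun i => secondCountableTopology_induced _ _ _

/-- A continuous additive map is automatically real linear. This is why a countable additive group
of test functions suffices, with no scalar multiplication to track. -/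
theorem exists_continuousLinearMap_extension {E : Type*} [AddCommGroup E] [Module ℝ E]
    [UniformSpace E] [IsUniformAddGroup E] [ContinuousSMul ℝ E] (S : AddSubgroup E)
    (hS : Dense (S : Set E)) (f : S →+ ℝ) (hf : ContinuousAt f 0) :
    ∃ L : E →L[ℝ] ℝ, ∀ s : S, L s = f s := by
  have hu : UniformContinuous f := uniformContinuous_of_continuousAt_zero f hf
  have hc : Continuous (hS.extend f) := (hS.uniformContinuous_extend hu).continuous
  have he : ∀ s : S, hS.extend f (s : E) = f s := hS.extend_of_ind hu
  let g : E →+ ℝ := AddMonoidHom.mk' (hS.extend f) fun a b => by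
    refine isClosed_property2 (e := ((↑) : S → E))
      (p := fun a b => hS.extend f (a + b) = hS.extend f a + hS.extend f b) hS.denseRange_val
      (isClosed_eq (hc.comp continuous_add)
        ((hc.comp continuous_fst).add (hc.comp continuous_snd))) (fun s t => ?_) a b
    have := he (s + t)
    simp only [AddSubgroup.coe_add, map_add] at this
    rw [this, he, he]
  exact ⟨g.toRealLinearMap hc, he⟩

/-! ### A countable set of test functions -/

/-- The finite union of the closed balls of radius `1 / (n + 1)` about the `k`-th point of a
dense sequence, for `(k, n) ∈ F`. -/
def ballUnion (F : Finset (ℕ × ℕ)) : Compacts ℂ :=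
  F.sup fun p => ⟨Metric.closedBall (denseSeq ℂ p.1) (1 / ((p.2 : ℝ) + 1)), isCompact_closedBall _ _⟩

theorem coe_ballUnion (F : Finset (ℕ × ℕ)) : (ballUnion F : Set ℂ) =
    ⋃ p ∈ F, Metric.closedBall (denseSeq ℂ p.1) (1 / ((p.2 : ℝ) + 1)) := by
  simp [ballUnion, Compacts.coe_finset_sup]

theorem ballUnion_mono {F G : Finset (ℕ × ℕ)} (h : F ⊆ G) : ballUnion F ≤ ballUnion G :=
  Finset.sup_mono h

theorem ballUnion_union_subset {F G : Finset (ℕ × ℕ)} {U : Set ℂ}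
    (hF : (ballUnion F : Set ℂ) ⊆ U) (hG : (ballUnion G : Set ℂ) ⊆ U) :
    (ballUnion (F ∪ G) : Set ℂ) ⊆ U := by
  rw [ballUnion, Finset.sup_union, Compacts.coe_sup]
  exact union_subset hF hG

theorem exists_ballUnion {K U : Set ℂ} (hK : IsCompact K) (hU : IsOpen U) (hKU : K ⊆ U) :
    ∃ F : Finset (ℕ × ℕ), K ⊆ ballUnion F ∧ (ballUnion F : Set ℂ) ⊆ U := by
  have hloc : ∀ z ∈ K, ∃ p : ℕ × ℕ, z ∈ Metric.ball (denseSeq ℂ p.1) (1 / ((p.2 : ℝ) + 1)) ∧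
      Metric.closedBall (denseSeq ℂ p.1) (1 / ((p.2 : ℝ) + 1)) ⊆ U := by
    intro z hz
    obtain ⟨ε, hε, hεU⟩ := Metric.isOpen_iff.1 hU z (hKU hz)
    obtain ⟨n, hn⟩ := exists_nat_one_div_lt (half_pos hε)
    obtain ⟨k, hk⟩ := (denseRange_denseSeq ℂ).exists_dist_lt z (Nat.one_div_pos_of_nat (α := ℝ) (n := n))
    refine ⟨(k, n), Metric.mem_ball.2 hk, fun w hw => hεU ?_⟩
    have h1 := dist_triangle w (denseSeq ℂ k) z
    rw [Metric.mem_closedBall] at hw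
    rw [dist_comm] at hk
    rw [Metric.mem_ball]
    dsimp only at hw
    linarith
  choose! p hp hpU using hloc
  obtain ⟨t, htK, ht⟩ := hK.elim_nhds_subcover
    (fun z => Metric.ball (denseSeq ℂ (p z).1) (1 / (((p z).2 : ℝ) + 1)))
    fun z hz => Metric.isOpen_ball.mem_nhds (hp z hz)
  classical
  refine ⟨t.image p, fun z hz => ?_, ?_⟩
  · rw [coe_ballUnion]
    obtain ⟨w, hw, hzw⟩ := mem_iUnion₂.1 (ht hz)
    exact mem_iUnion₂.2 ⟨p w, Finset.mem_image_of_mem _ hw, Metric.ball_subset_closedBall hzw⟩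
  · rw [coe_ballUnion]
    refine iUnion₂_subset fun q hq => ?_
    obtain ⟨w, hw, rfl⟩ := Finset.mem_image.1 hq
    exact hpU w (htK w hw)

variable (D : Opens ℂ)

/-- The finite unions of balls contained in `D`. -/
abbrev BallUnions : Type := {F : Finset (ℕ × ℕ) // (ballUnion F : Set ℂ) ⊆ D}

variable {D} in
/-- Test functions supported in a finite union of balls, as test functions on `D`. -/
def ofBalls (F : BallUnions D) : 𝓓_{ballUnion F}(ℂ, ℝ) →L[ℝ] 𝓓(D, ℝ) :=
  TestFunction.ofSupportedInCLM ℝ F.2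

/-- A countable additive group of test functions on `D`. -/
def rationalTest : Submodule ℤ 𝓓(D, ℝ) :=
  LinearMap.range (Finsupp.linearCombination ℤ fun p : BallUnions D × ℕ =>
    ofBalls p.1 (denseSeq 𝓓_{ballUnion p.1}(ℂ, ℝ) p.2))

instance : Countable (rationalTest D) :=
  (LinearMap.surjective_rangeRestrict (Finsupp.linearCombination ℤ
    fun p : BallUnions D × ℕ => ofBalls p.1 (denseSeq 𝓓_{ballUnion p.1}(ℂ, ℝ) p.2))).countable

variable {D}

/-- The functions in the countable group that are supported in a given finite union of balls. -/
def rationalTestIn (F : BallUnions D) : AddSubgroup 𝓓_{ballUnion F}(ℂ, ℝ) :=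
  (rationalTest D).toAddSubgroup.comap (ofBalls F : 𝓓_{ballUnion F}(ℂ, ℝ) →+ 𝓓(D, ℝ))

theorem mem_rationalTestIn {F : BallUnions D} {f : 𝓓_{ballUnion F}(ℂ, ℝ)} :
    f ∈ rationalTestIn F ↔ ofBalls F f ∈ rationalTest D := Iff.rfl

theorem dense_rationalTestIn (F : BallUnions D) :
    Dense (rationalTestIn F : Set 𝓓_{ballUnion F}(ℂ, ℝ)) := by
  refine (denseRange_denseSeq 𝓓_{ballUnion F}(ℂ, ℝ)).mono ?_
  rintro _ ⟨n, rfl⟩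
  refine ⟨Finsupp.single (F, n) 1, ?_⟩
  simp

theorem exists_ofBalls {ρ : 𝓓(D, ℝ)} {F : BallUnions D} (h : tsupport ρ ⊆ ballUnion F) :
    ∃ f, ofBalls F f = ρ :=
  ⟨.of_support_subset ρ.contDiff (subset_closure.trans h), rfl⟩

theorem tsupport_ofBalls_subset (F : BallUnions D) (f : 𝓓_{ballUnion F}(ℂ, ℝ)) :
    tsupport (ofBalls F f) ⊆ ballUnion F :=
  f.tsupport_subset

theorem ofBalls_injective (F : BallUnions D) : Function.Injective (ofBalls F) := fun f g h => by
  ext z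
  exact DFunLike.congr_fun h z

theorem exists_ballUnions {ρ : 𝓓(D, ℝ)} {U : Set ℂ} (hU : IsOpen U) (hUD : U ⊆ D)
    (hρ : tsupport ρ ⊆ U) : ∃ F : BallUnions D, tsupport ρ ⊆ ballUnion F ∧
      (ballUnion F : Set ℂ) ⊆ U := by
  obtain ⟨F, hF, hFU⟩ := exists_ballUnion ρ.hasCompactSupport hU hρ
  exact ⟨⟨F, hFU.trans hUD⟩, hF, hFU⟩

/-- Every test function supported in an open set is the limit of a sequence of functions in the
countable group with the same property. -/
theorem exists_seq_rationalTest {ρ : 𝓓(D, ℝ)} {U : Set ℂ} (hU : IsOpen U) (hUD : U ⊆ D)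
    (hρ : tsupport ρ ⊆ U) : ∃ q : ℕ → 𝓓(D, ℝ), (∀ n, q n ∈ rationalTest D) ∧
      (∀ n, tsupport (q n) ⊆ U) ∧ Filter.Tendsto q Filter.atTop (𝓝 ρ) := by
  obtain ⟨F, hF, hFU⟩ := exists_ballUnions hU hUD hρ
  obtain ⟨f, rfl⟩ := exists_ofBalls hF
  obtain ⟨q, hq, hqf⟩ := mem_closure_iff_seq_limit.1 (dense_rationalTestIn F f)
  exact ⟨fun n => ofBalls F (q n), hq, fun n => (tsupport_ofBalls_subset F _).trans hFU,
    ((ofBalls F).continuous.tendsto f).comp hqf⟩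

theorem exists_seq_rationalTest' (ρ : 𝓓(D, ℝ)) : ∃ q : ℕ → 𝓓(D, ℝ),
    (∀ n, q n ∈ rationalTest D) ∧ Filter.Tendsto q Filter.atTop (𝓝 ρ) := by
  obtain ⟨q, h1, -, h2⟩ := exists_seq_rationalTest D.isOpen subset_rfl ρ.tsupport_subset
  exact ⟨q, h1, h2⟩

theorem distribution_ext_rationalTest {T S : 𝓓'(D, ℝ)}
    (h : ∀ q ∈ rationalTest D, T q = S q) : T = S := by
  ext ρ
  obtain ⟨q, hq, hqρ⟩ := exists_seq_rationalTest' ρ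
  refine tendsto_nhds_unique ((T.continuous.tendsto ρ).comp hqρ) ?_
  exact ((S.continuous.tendsto ρ).comp hqρ).congr fun n => (h (q n) (hq n)).symm

end

section

open scoped Topology ENNReal

/-! ### The space of distributions is a standard Borel space -/

variable {D : Opens ℂ}

/-- The values of a distribution on the countable group of test functions. -/
def restrictRational (T : 𝓓'(D, ℝ)) : rationalTest D → ℝ := fun q => T q

/-- The inclusion of the countable subgroup for a fixed union of balls in the whole one. -/
def rationalTestInHom (F : BallUnions D) : rationalTestIn F →+ rationalTest D where
  toFun f := ⟨ofBalls F f.1, f.2⟩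
  map_zero' := Subtype.ext (map_zero (ofBalls F))
  map_add' f g := Subtype.ext (map_add (ofBalls F) f.1 g.1)

/-- The additive function extends to a continuous linear form on each space attached to a finite
union of balls. The extensions agree, because any two such unions sit in a third, and they define a
functional on the inductive limit. -/
theorem exists_distribution_extension (x : rationalTest D →+ ℝ)
    (hx : ∀ F : BallUnions D, ContinuousAt (x.comp (rationalTestInHom F)) 0) :
    ∃ T : 𝓓'(D, ℝ), restrictRational T = x := by
  have hL : ∀ F : BallUnions D, ∃ L : 𝓓_{ballUnion F}(ℂ, ℝ) →L[ℝ] ℝ,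
      ∀ s : rationalTestIn F, L s = x (rationalTestInHom F s) := fun F =>
    exists_continuousLinearMap_extension _ (dense_rationalTestIn F) _ (hx F)
  choose L hLx using hL
  have hmono : ∀ F G : BallUnions D, (ballUnion F : Compacts ℂ) ≤ ballUnion G →
      ∀ (f : 𝓓_{ballUnion F}(ℂ, ℝ)) (g : 𝓓_{ballUnion G}(ℂ, ℝ)), ofBalls F f = ofBalls G g →
      L F f = L G g := by
    intro F G hFG f g hfg
    have hincl : ∀ f : 𝓓_{ballUnion F}(ℂ, ℝ),
        ofBalls G (ContDiffMapSupportedIn.monoCLM ℝ f) = ofBalls F f := by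
      intro f
      ext z
      change (ContDiffMapSupportedIn.monoCLM ℝ f : 𝓓_{ballUnion G}(ℂ, ℝ)) z = f z
      rw [ContDiffMapSupportedIn.monoCLM_apply, if_pos ⟨le_rfl, hFG⟩]
    have heq : L F = (L G).comp (ContDiffMapSupportedIn.monoCLM ℝ) := by
      apply ContinuousLinearMap.coeFn_injective
      refine Continuous.ext_on (dense_rationalTestIn F) (L F).continuous
        (ContinuousLinearMap.continuous _) fun s hs => ?_
      have hs' : ContDiffMapSupportedIn.monoCLM ℝ s ∈ rationalTestIn G := by
        rw [mem_rationalTestIn, hincl]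
        exact hs
      have h1 := hLx F ⟨s, hs⟩
      have h2 := hLx G ⟨_, hs'⟩
      have h3 : rationalTestInHom G ⟨_, hs'⟩ = rationalTestInHom F ⟨s, hs⟩ :=
        Subtype.ext (hincl s)
      rw [h3] at h2
      exact h1.trans h2.symm
    rw [heq]
    exact congrArg (L G) (ofBalls_injective G ((hincl f).trans hfg))
  have hcompat : ∀ (F G : BallUnions D) (f : 𝓓_{ballUnion F}(ℂ, ℝ)) (g : 𝓓_{ballUnion G}(ℂ, ℝ)),
      ofBalls F f = ofBalls G g → L F f = L G g := by
    intro F G f g hfg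
    let E : BallUnions D := ⟨F.1 ∪ G.1, ballUnion_union_subset F.2 G.2⟩
    have hF : (ballUnion F : Compacts ℂ) ≤ ballUnion E := ballUnion_mono Finset.subset_union_left
    have hG : (ballUnion G : Compacts ℂ) ≤ ballUnion E := ballUnion_mono Finset.subset_union_right
    obtain ⟨k, hk⟩ := exists_ofBalls (ρ := ofBalls F f) (F := E)
      ((tsupport_ofBalls_subset F f).trans hF)
    rw [hmono F E hF f k hk.symm, hmono G E hG g k (hfg.symm.trans hk.symm)]
  have hex : ∀ ρ : 𝓓(D, ℝ), ∃ (F : BallUnions D) (f : 𝓓_{ballUnion F}(ℂ, ℝ)),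
      ofBalls F f = ρ := by
    intro ρ
    obtain ⟨F, hF, -⟩ := exists_ballUnions D.isOpen subset_rfl ρ.tsupport_subset
    exact ⟨F, exists_ofBalls hF⟩
  choose F f hf using hex
  have hcomp : ∀ K : Compacts ℂ, (K : Set ℂ) ⊆ D → ∃ G : BallUnions D, K ≤ ballUnion G.1 := by
    intro K hK
    obtain ⟨G, hG, hGD⟩ := exists_ballUnion K.isCompact D.isOpen hK
    exact ⟨⟨G, hGD⟩, hG⟩
  have : Nonempty (BallUnions D) := ⟨F 0⟩
  choose! G hG using hcomp
  let T : 𝓓(D, ℝ) →L[ℝ] ℝ := TestFunction.limitCLM ℝ (fun ρ => L (F ρ) (f ρ))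
    (fun K _ => (L (G K)).comp (ContDiffMapSupportedIn.monoCLM ℝ)) (by
      intro K hK g
      refine hcompat _ _ _ _ ?_
      rw [hf]
      ext z
      change g z = (ContDiffMapSupportedIn.monoCLM ℝ g : 𝓓_{ballUnion (G K).1}(ℂ, ℝ)) z
      rw [ContDiffMapSupportedIn.monoCLM_apply, if_pos ⟨le_rfl, hG K hK⟩])
  refine ⟨T, funext fun q => ?_⟩
  change L (F q) (f q) = x q
  have hmem : f q ∈ rationalTestIn (F q) := by
    rw [mem_rationalTestIn, hf]
    exact q.2
  rw [hLx (F q) ⟨f q, hmem⟩]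
  congr 1
  exact Subtype.ext (hf q)

theorem restrictRational_injective : Function.Injective (restrictRational (D := D)) :=
  fun _ _ h => distribution_ext_rationalTest fun q hq => congrFun h ⟨q, hq⟩

theorem measurable_restrictRational : Measurable (restrictRational (D := D)) :=
  measurable_pi_lambda _ fun q => measurable_eval (q : 𝓓(D, ℝ))

theorem comap_restrictRational_eq :
    MeasurableSpace.comap (restrictRational (D := D)) MeasurableSpace.pi =
      (inferInstance : MeasurableSpace 𝓓'(D, ℝ)) := by
  refine le_antisymm measurable_restrictRational.comap_le (iSup_le fun ρ => ?_)
  rw [← measurable_iff_comap_le]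
  obtain ⟨q, hq, hqρ⟩ := exists_seq_rationalTest' ρ
  let _ : MeasurableSpace 𝓓'(D, ℝ) := MeasurableSpace.comap (restrictRational (D := D)) inferInstance
  refine measurable_of_tendsto_metrizable (f := fun n (T : 𝓓'(D, ℝ)) => T (q n))
    (fun n => ?_) (tendsto_pi_nhds.2 fun T => (T.continuous.tendsto ρ).comp hqρ)
  have hp : Measurable fun x : rationalTest D → ℝ => x ⟨q n, hq n⟩ := measurable_pi_apply _
  exact hp.comp (comap_measurable _)

theorem measurableSet_range_restrictRational :
    MeasurableSet (Set.range (restrictRational (D := D))) := by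
  choose V hV using fun F : BallUnions D =>
    (𝓝 (0 : 𝓓_{ballUnion F}(ℂ, ℝ))).exists_antitone_basis
  -- A function on the countable group comes from a distribution exactly when it is additive and
  -- continuous at zero on each fixed support. With countable neighbourhood bases, both conditions
  -- involve countably many operations.
  have key : Set.range (restrictRational (D := D)) =
      (⋂ (p : rationalTest D) (q : rationalTest D), {x | x (p + q) = x p + x q}) ∩
      ⋂ (F : BallUnions D) (j : ℕ), ⋃ k : ℕ, ⋂ (q : rationalTest D)
        (_ : ∃ f ∈ V F k, ofBalls F f = q), {x | |x q| < 1 / ((j : ℝ) + 1)} := by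
    ext x
    simp only [mem_inter_iff, mem_iInter, mem_iUnion]
    constructor
    · rintro ⟨T, rfl⟩
      refine ⟨fun p q => map_add T (p : 𝓓(D, ℝ)) q, fun F j => ?_⟩
      have hc : Filter.Tendsto (fun f => T (ofBalls F f)) (𝓝 0) (𝓝 0) := by
        have h0 : T (ofBalls F 0) = 0 := by rw [map_zero]; exact map_zero T
        have h1 : Filter.Tendsto (fun f => T (ofBalls F f)) (𝓝 0) (𝓝 (T (ofBalls F 0))) :=
          (T.continuous.comp (ofBalls F).continuous).tendsto 0
        rwa [h0] at h1
      have h1 := hc.eventually (Metric.ball_mem_nhds 0 (Nat.one_div_pos_of_nat (α := ℝ) (n := j)))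
      obtain ⟨k, -, hk⟩ := (hV F).1.eventually_iff.1 h1
      refine ⟨k, ?_⟩
      rintro q ⟨f, hf, hfq⟩
      have := hk hf
      rwa [dist_zero_right, hfq] at this
    · rintro ⟨hadd, hcont⟩
      obtain ⟨T, hT⟩ := exists_distribution_extension (AddMonoidHom.mk' x hadd) (by
        intro F
        rw [ContinuousAt, map_zero, Metric.tendsto_nhds]
        intro ε hε
        obtain ⟨j, hj⟩ := exists_nat_one_div_lt hε
        obtain ⟨k, hk⟩ := hcont F j
        have hVk : V F k ∈ 𝓝 ((0 : rationalTestIn F) : 𝓓_{ballUnion F}(ℂ, ℝ)) :=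
          (hV F).1.mem_of_mem trivial
        filter_upwards [continuous_subtype_val.continuousAt.preimage_mem_nhds hVk] with s hs
        rw [dist_zero_right]
        exact (hk (rationalTestInHom F s) ⟨s, hs, rfl⟩).trans hj)
      exact ⟨T, hT⟩
  rw [key]
  refine MeasurableSet.inter (MeasurableSet.iInter fun p => MeasurableSet.iInter fun q => ?_)
    (MeasurableSet.iInter fun F => MeasurableSet.iInter fun j => MeasurableSet.iUnion fun k =>
      MeasurableSet.iInter fun q => MeasurableSet.iInter fun _ => ?_)
  · exact measurableSet_eq_fun (measurable_pi_apply _)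
      ((measurable_pi_apply p).fun_add (measurable_pi_apply q))
  · exact measurableSet_lt (measurable_pi_apply q).norm measurable_const

theorem measurableEmbedding_restrictRational :
    MeasurableEmbedding (restrictRational (D := D)) where
  injective := restrictRational_injective
  measurable := measurable_restrictRational
  measurableSet_image' := by
    intro S hS
    have hS₀ : MeasurableSet[MeasurableSpace.comap (restrictRational (D := D))
        MeasurableSpace.pi] S := by
      rw [comap_restrictRational_eq]
      exact hS
    obtain ⟨S', hS', rfl⟩ := hS₀
    rw [image_preimage_eq_inter_range]
    exact hS'.inter measurableSet_range_restrictRational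

theorem _root_.StandardBorelSpace.of_measurableEquiv {X Y : Type*} [MeasurableSpace X]
    [MeasurableSpace Y] (hY : StandardBorelSpace Y) (e : X ≃ᵐ Y) : StandardBorelSpace X := by
  obtain ⟨τ, hτ, hP⟩ := hY.polish
  refine ⟨TopologicalSpace.induced e τ, ?_, e.toEquiv.polishSpace_induced⟩
  exact @BorelSpace.mk _ (_) _ (by
    rw [borel_comap, ← hτ.measurable_eq]
    exact e.measurableEmbedding.comap_eq.symm)

instance : StandardBorelSpace 𝓓'(D, ℝ) :=
  (measurableSet_range_restrictRational.standardBorel).of_measurableEquiv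
    measurableEmbedding_restrictRational.equivRange

instance : Nonempty 𝓓'(D, ℝ) := ⟨0⟩

end

section

open scoped Topology ENNReal

/-! ### Random distributions with Gaussian pairings -/

section Gaussian

variable {X : Type*} [MeasurableSpace X] {κ : Measure X}

theorem integral_expI_mul_gaussianReal (a : ℝ) (v : ℝ≥0) (t : ℝ) :
    ∫ x, expI (t * x) ∂(gaussianReal a v) = expI (t * a) * Real.exp (-(t ^ 2 * v / 2)) := by
  rw [← charFun_eq_integral_expI, charFun_gaussianReal, expI, Complex.ofReal_exp, ← Complex.exp_add]
  congr 1
  push_cast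
  ring

theorem integral_expI_mul_of_map_eq {Y : X → ℝ} (hY : Measurable Y) {a : ℝ} {v : ℝ≥0}
    (h : κ.map Y = gaussianReal a v) (t : ℝ) :
    ∫ x, expI (t * Y x) ∂κ = expI (t * a) * Real.exp (-(t ^ 2 * v / 2)) := by
  have hm : Measurable fun x => expI (t * x) := measurable_expI.comp (measurable_const_mul t)
  rw [← integral_expI_mul_gaussianReal, ← h, integral_map hY.aemeasurable hm.aestronglyMeasurable]

theorem integrable_and_integral_of_map_eq {Y : X → ℝ} (hY : Measurable Y) {a : ℝ} {v : ℝ≥0}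
    (h : κ.map Y = gaussianReal a v) : Integrable Y κ ∧ ∫ x, Y x ∂κ = a := by
  have h1 := memLp_id_gaussianReal' (μ := a) (v := v) 1 (by simp)
  rw [← h, memLp_map_measure_iff aestronglyMeasurable_id hY.aemeasurable,
    memLp_one_iff_integrable] at h1
  have h2 := integral_map (μ := κ) hY.aemeasurable (f := fun x : ℝ => x) aestronglyMeasurable_id
  rw [h, integral_id_gaussianReal] at h2
  exact ⟨h1, h2.symm⟩

theorem map_eq_gaussianReal [IsProbabilityMeasure κ] {Y : X → ℝ} (hY : Measurable Y) {a : ℝ}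
    {v : ℝ≥0} (h : ∀ t : ℚ, ∫ x, expI (t * Y x) ∂κ =
      expI (t * a) * Real.exp (-((t : ℝ) ^ 2 * v / 2))) :
    κ.map Y = gaussianReal a v := by
  have := Measure.isProbabilityMeasure_map (μ := κ) hY.aemeasurable
  refine Measure.ext_of_charFun ?_
  refine Continuous.ext_on Rat.denseRange_cast (continuous_charFun) (continuous_charFun) ?_
  rintro _ ⟨t, rfl⟩
  have hm : Measurable fun x => expI ((t : ℝ) * x) := measurable_expI.comp (measurable_const_mul _)
  rw [charFun_eq_integral_expI, charFun_eq_integral_expI, integral_expI_mul_gaussianReal,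
    integral_map hY.aemeasurable hm.aestronglyMeasurable, h t]

theorem tendsto_integral_expI [IsFiniteMeasure κ] {ι : Type*} {l : Filter ι}
    [l.IsCountablyGenerated] {Y : ι → X → ℝ} {Z : X → ℝ} (hY : ∀ i, Measurable (Y i))
    (hlim : ∀ x, Filter.Tendsto (fun i => Y i x) l (𝓝 (Z x))) (t : ℝ) :
    Filter.Tendsto (fun i => ∫ x, expI (t * Y i x) ∂κ) l (𝓝 (∫ x, expI (t * Z x) ∂κ)) := by
  refine tendsto_integral_filter_of_dominated_convergence (fun _ => 1)
    (.of_forall fun i => (measurable_expI.comp ((hY i).const_mul t)).aestronglyMeasurable)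
    (.of_forall fun i => .of_forall fun x => (norm_expI _).le) (integrable_const 1)
    (.of_forall fun x => ?_)
  exact (continuous_expI.tendsto _).comp ((hlim x).const_mul t)

/-- The means and variances of Gaussian variables that tend to zero pointwise tend to zero. -/
theorem tendsto_zero_of_map_eq_gaussianReal [IsProbabilityMeasure κ] {ι : Type*} {l : Filter ι}
    [l.IsCountablyGenerated] {Y : ι → X → ℝ} (hY : ∀ i, Measurable (Y i)) {b : ι → ℝ} {w : ι → ℝ≥0}
    (hmap : ∀ i, κ.map (Y i) = gaussianReal (b i) (w i))
    (hlim : ∀ x, Filter.Tendsto (fun i => Y i x) l (𝓝 0)) :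
    Filter.Tendsto b l (𝓝 0) ∧ Filter.Tendsto (fun i => (w i : ℝ)) l (𝓝 0) := by
  have h1 : ∀ t : ℝ, Filter.Tendsto (fun i => expI (t * b i) * Real.exp (-(t ^ 2 * w i / 2))) l
      (𝓝 1) := by
    intro t
    have := tendsto_integral_expI (κ := κ) (Z := fun _ => 0) hY hlim t
    simpa [fun i => integral_expI_mul_of_map_eq (hY i) (hmap i) t, expI_zero] using this
  have hexp : ∀ t : ℝ, Filter.Tendsto (fun i => Real.exp (-(t ^ 2 * w i / 2))) l (𝓝 1) := by
    intro t
    have := (h1 t).norm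
    simpa [norm_expI, abs_of_pos (Real.exp_pos _), -Complex.ofReal_exp] using this
  have hw : Filter.Tendsto (fun i => (w i : ℝ)) l (𝓝 0) := by
    have := ((Real.continuousAt_log one_ne_zero).tendsto.comp (hexp 1)).const_mul (-2)
    simp only [Function.comp_def, Real.log_exp, Real.log_one, mul_zero] at this
    exact this.congr fun i => by ring
  have hb1 : ∀ t : ℝ, Filter.Tendsto (fun i => expI (t * b i)) l (𝓝 1) := by
    intro t
    have h2 := (Complex.continuous_ofReal.tendsto 1).comp (hexp t)
    have h3 := (h1 t).div h2 (by simp)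
    refine (h3.congr fun i => ?_).trans (by simp)
    simp only [Function.comp_apply, Pi.div_apply]
    exact mul_div_cancel_right₀ _ (Complex.ofReal_ne_zero.2 (Real.exp_pos _).ne')
  refine ⟨?_, hw⟩
  -- Averaging `e^{i t b}` over a standard Gaussian `t` gives `exp(-b²/2)`. Its convergence to `1`
  -- forces the means to zero without any prior bound on them.
  have hg : Filter.Tendsto (fun i => ∫ t, expI (t * b i) ∂(gaussianReal 0 1)) l
      (𝓝 (∫ t, (1 : ℂ) ∂(gaussianReal 0 1))) :=
    tendsto_integral_filter_of_dominated_convergence (fun _ => 1)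
      (.of_forall fun i => (measurable_expI.comp (measurable_mul_const (b i))).aestronglyMeasurable)
      (.of_forall fun i => .of_forall fun x => (norm_expI _).le) (integrable_const 1)
      (.of_forall fun t => hb1 t)
  have hg' : ∀ i, ∫ t, expI (t * b i) ∂(gaussianReal 0 1) = (Real.exp (-(b i ^ 2 / 2)) : ℂ) := by
    intro i
    simpa [expI_zero, mul_comm] using integral_expI_mul_gaussianReal 0 1 (b i)
  have hsq : Filter.Tendsto (fun i => b i ^ 2) l (𝓝 0) := by
    have h4 := hg.norm
    simp only [hg', integral_const, probReal_univ, one_smul, Complex.norm_real, Real.norm_eq_abs,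
      abs_of_pos (Real.exp_pos _), norm_one] at h4
    have := ((Real.continuousAt_log one_ne_zero).tendsto.comp h4).const_mul (-2)
    simp only [Function.comp_def, Real.log_exp, Real.log_one, mul_zero] at this
    exact this.congr fun i => by ring
  have := (Real.continuous_sqrt.tendsto 0).comp hsq
  simp only [Function.comp_def, Real.sqrt_sq_eq_abs, Real.sqrt_zero] at this
  exact (tendsto_zero_iff_abs_tendsto_zero _).2 this

end Gaussian

variable {Ω : Type*} [MeasurableSpace Ω] {P : Measure Ω} [IsProbabilityMeasure P] {D : Opens ℂ}
  {hI : HasInvLap D} {m : 𝓓(D, ℝ) →ₗ[ℝ] ℝ} {h : Ω → 𝓓'(D, ℝ)}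

theorem tendsto_apply_sub {ι : Type*} {l : Filter ι} {q : ι → 𝓓(D, ℝ)} {ρ : 𝓓(D, ℝ)}
    (hq : Filter.Tendsto q l (𝓝 ρ)) (T : 𝓓'(D, ℝ)) :
    Filter.Tendsto (fun i => T (q i)) l (𝓝 (T ρ)) :=
  (T.continuous.tendsto ρ).comp hq

/-- Continuity of the energy is obtained from the field itself: each realization of `h` is
continuous, so `(h, q n - ρ)` tends to zero pointwise, and so do the variances `‖-Δ⁻¹(q n - ρ)‖²`.
-/
theorem IsGaussianField.tendsto_energy (hG : IsGaussianField P hI m h) {q : ℕ → 𝓓(D, ℝ)}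
    {ρ : 𝓓(D, ℝ)} (hq : Filter.Tendsto q Filter.atTop (𝓝 ρ)) (U : Set ℂ) :
    Filter.Tendsto (fun n => (energy U (q n) : ℝ)) Filter.atTop (𝓝 (energy U ρ)) := by
  have h0 : Filter.Tendsto (fun n => q n - ρ) Filter.atTop (𝓝 0) := by
    simpa using hq.sub_const ρ
  have h1 := (tendsto_zero_of_map_eq_gaussianReal (l := Filter.atTop)
    (fun n => hG.measurable_pairing (q n - ρ))
    (fun n => hG.map_eval (q n - ρ)) (fun ω => by
      have := tendsto_apply_sub h0 (h ω)
      rwa [show h ω 0 = 0 from map_zero (h ω)] at this)).2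
  have h2 : Filter.Tendsto (fun n => invLapHom hI (q n)) Filter.atTop (𝓝 (invLapHom hI ρ)) := by
    rw [tendsto_iff_norm_sub_tendsto_zero]
    have := (Real.continuous_sqrt.tendsto 0).comp h1
    simp only [Function.comp_def, NNReal.coe_pow, coe_nnnorm, Real.sqrt_sq (norm_nonneg _),
      Real.sqrt_zero, map_sub] at this
    exact this
  simp only [energy_eq hI]
  exact ((((suppSpace D U).starProjection).continuous.tendsto _).comp h2).norm.pow 2

/-- A law on distributions with the right Gaussian pairings on a countable set of test functions is
that of a deterministic distribution plus a zero boundary field. -/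
theorem IsGaussianField.exists_eq_map_add (hG : IsGaussianField P hI m h) {U : Set ℂ}
    (κ : Measure 𝓓'(D, ℝ)) [IsProbabilityMeasure κ] {a : 𝓓(D, ℝ) → ℝ}
    (hκ : ∀ q ∈ rationalTest D, κ.map (fun T => T q) = gaussianReal (a q) (energy U q)) :
    ∃ C : 𝓓'(D, ℝ), (∀ q ∈ rationalTest D, C q = a q) ∧ (∀ ρ, ∫ T, T ρ ∂κ = C ρ) ∧
      ∃ ν : Measure 𝓓'(D, ℝ), IsZeroGFFLaw U ν ∧ κ = ν.map fun T => C + T := by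
  have hall : ∀ ρ, ∃ α, κ.map (fun T => T ρ) = gaussianReal α (energy U ρ) := by
    intro ρ
    obtain ⟨q, hq, hqρ⟩ := exists_seq_rationalTest' ρ
    -- The means of the Gaussian differences `T (q i - q j)`, which tend to zero pointwise, tend to
    -- zero. The limit mean then goes with the limit variance.
    have hcauchy : CauchySeq fun n => a (q n) := by
      rw [cauchySeq_iff_tendsto_dist_atTop_0]
      have h0 : Filter.Tendsto (fun n : ℕ × ℕ => q n.1 - q n.2) Filter.atTop (𝓝 0) := by
        rw [← Filter.prod_atTop_atTop_eq, ← sub_self ρ]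
        exact (hqρ.comp Filter.tendsto_fst).sub (hqρ.comp Filter.tendsto_snd)
      have hsub : ∀ n : ℕ × ℕ, a (q n.1 - q n.2) = a (q n.1) - a (q n.2) := by
        have hmean : ∀ p ∈ rationalTest D, Integrable (fun T : 𝓓'(D, ℝ) => T p) κ ∧
            ∫ T, T p ∂κ = a p := fun p hp =>
          integrable_and_integral_of_map_eq (measurable_eval p) (hκ p hp)
        intro n
        obtain ⟨i1, e1⟩ := hmean _ (hq n.1)
        obtain ⟨i2, e2⟩ := hmean _ (hq n.2)
        rw [← (hmean _ (sub_mem (hq n.1) (hq n.2))).2, ← e1, ← e2, ← integral_sub i1 i2]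
        exact integral_congr_ae (.of_forall fun T => map_sub T _ _)
      have := (tendsto_zero_of_map_eq_gaussianReal (κ := κ) (l := Filter.atTop)
        (fun n : ℕ × ℕ => measurable_eval (q n.1 - q n.2))
        (fun n => hκ _ (sub_mem (hq n.1) (hq n.2))) (fun T => by
          have := tendsto_apply_sub h0 T
          rwa [show T 0 = 0 from map_zero T] at this)).1
      simp only [hsub] at this
      simpa [Real.dist_eq] using this.abs
    obtain ⟨α, hα⟩ := cauchySeq_tendsto_of_complete hcauchy
    refine ⟨α, map_eq_gaussianReal (measurable_eval ρ) fun t => ?_⟩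
    have h1 := tendsto_integral_expI (κ := κ) (fun n => measurable_eval (q n))
      (fun T => tendsto_apply_sub hqρ T) t
    refine tendsto_nhds_unique h1 ?_
    simp only [fun n => integral_expI_mul_of_map_eq (measurable_eval (q n)) (hκ _ (hq n)) (t : ℝ)]
    refine ((continuous_expI.tendsto _).comp (hα.const_mul _)).mul
      ((Complex.continuous_ofReal.tendsto _).comp ((Real.continuous_exp.tendsto _).comp ?_))
    exact (((hG.tendsto_energy hqρ U).const_mul _).div_const 2).neg
  choose α hα using hall
  have hint : ∀ ρ, Integrable (fun T : 𝓓'(D, ℝ) => T ρ) κ ∧ ∫ T, T ρ ∂κ = α ρ := fun ρ =>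
    integrable_and_integral_of_map_eq (measurable_eval ρ) (hα ρ)
  have hadd : ∀ f g, α (f + g) = α f + α g := by
    intro f g
    rw [← (hint _).2, ← (hint f).2, ← (hint g).2, ← integral_add (hint f).1 (hint g).1]
    exact integral_congr_ae (.of_forall fun T => map_add T _ _)
  have hsmul : ∀ (c : ℝ) f, α (c • f) = c • α f := by
    intro c f
    rw [← (hint _).2, ← (hint f).2, ← integral_smul]
    exact integral_congr_ae (.of_forall fun T => map_smul T _ _)
  -- The means inherit continuity from the distributions: Gaussian variables tending to zero
  -- pointwise have means tending to zero, and the neighbourhood filter of zero in test functions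
  -- supported in `K` is countably generated, as dominated convergence requires.
  have hcont : ∀ (K : Compacts ℂ) (hK : (K : Set ℂ) ⊆ D),
      Continuous (α ∘ TestFunction.ofSupportedIn hK) := by
    intro K hK
    let f : 𝓓_{K}(ℂ, ℝ) →+ ℝ := AddMonoidHom.mk' (α ∘ TestFunction.ofSupportedIn hK)
      fun f g => hadd (TestFunction.ofSupportedIn hK f) (TestFunction.ofSupportedIn hK g)
    refine continuous_of_continuousAt_zero f ?_
    rw [ContinuousAt, map_zero]
    have h0 : Filter.Tendsto (fun g : 𝓓_{K}(ℂ, ℝ) => (TestFunction.ofSupportedIn hK g : 𝓓(D, ℝ)))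
        (𝓝 0) (𝓝 0) := (TestFunction.continuous_ofSupportedIn hK).tendsto 0
    exact (tendsto_zero_of_map_eq_gaussianReal (κ := κ) (l := 𝓝 (0 : 𝓓_{K}(ℂ, ℝ)))
        (fun g => measurable_eval (TestFunction.ofSupportedIn hK g))
        (fun g => hα _) (fun T => by
          have := tendsto_apply_sub h0 T
          rwa [show T 0 = 0 from map_zero T] at this)).1
  obtain ⟨C, hC⟩ : ∃ C : 𝓓'(D, ℝ), ∀ ρ, C ρ = α ρ :=
    ⟨TestFunction.mkCLM ℝ α hadd hsmul hcont, fun _ => rfl⟩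
  have hm := measurable_const_add_distribution (-C)
  refine ⟨C, fun q hq => ?_, fun ρ => (hint ρ).2.trans (hC ρ).symm, κ.map fun T => -C + T,
    ⟨Measure.isProbabilityMeasure_map hm.aemeasurable, fun ρ => ?_⟩, ?_⟩
  · rw [hC, ← (hint q).2]
    exact (integrable_and_integral_of_map_eq (measurable_eval q) (hκ q hq)).2
  · rw [Measure.map_map (measurable_eval ρ) hm]
    have : ((fun T : 𝓓'(D, ℝ) => T ρ) ∘ fun T => -C + T) =
        (fun x => -α ρ + x) ∘ fun T : 𝓓'(D, ℝ) => T ρ := by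
      funext T
      rw [← hC]
      rfl
    rw [this, ← Measure.map_map (measurable_const_add _) (measurable_eval ρ), hα,
      gaussianReal_map_const_add, add_neg_cancel]
  · rw [Measure.map_map (measurable_const_add_distribution C) hm]
    have : ((fun T : 𝓓'(D, ℝ) => C + T) ∘ fun T => -C + T) = id :=
      funext fun T => add_neg_cancel_left C T
    rw [this, Measure.map_id]

end

section

open scoped Topology ENNReal

/-! ### The conditional law given a union of local sets -/

variable {Ω : Type*}

theorem exists_kernel_condExp {m mΩ : MeasurableSpace Ω} {P : Measure Ω} [IsProbabilityMeasure P]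
    (hm : m ≤ mΩ) {D : Opens ℂ} {h : Ω → 𝓓'(D, ℝ)} (hh : Measurable h) :
    ∃ κ : Kernel[m] Ω 𝓓'(D, ℝ), IsMarkovKernel κ ∧
      (∀ S : Set 𝓓'(D, ℝ), MeasurableSet S → (fun ω => (κ ω).real S) =ᵐ[P] P⟦h ⁻¹' S|m⟧) ∧
      (∀ f : 𝓓'(D, ℝ) → ℂ, Measurable f → Integrable (fun ω => f (h ω)) P →
        P[fun ω => f (h ω) | m] =ᵐ[P] fun ω => ∫ T, f T ∂κ ω) ∧
      (∀ f : 𝓓'(D, ℝ) → ℝ, Measurable f → Integrable (fun ω => f (h ω)) P →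
        P[fun ω => f (h ω) | m] =ᵐ[P] fun ω => ∫ T, f T ∂κ ω) := by
  have hid : Measurable[mΩ, m] (id : Ω → Ω) := measurable_id'' hm
  have hcomap : m.comap (id : Ω → Ω) = m := MeasurableSpace.comap_id
  have e1 := fun S hS => condDistrib_ae_eq_condExp (mβ := m) (s := S) (μ := P) hid hh hS
  have e2 := fun (f : 𝓓'(D, ℝ) → ℂ) (hf : Measurable f) hfi =>
    condExp_ae_eq_integral_condDistrib (mβ := m) (μ := P) hid hh.aemeasurable
      hf.stronglyMeasurable hfi
  have e3 := fun (f : 𝓓'(D, ℝ) → ℝ) (hf : Measurable f) hfi =>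
    condExp_ae_eq_integral_condDistrib (mβ := m) (μ := P) hid hh.aemeasurable
      hf.stronglyMeasurable hfi
  rw [hcomap] at e1 e2 e3
  exact ⟨@condDistrib _ _ _ _ _ _ mΩ m h id P _, @instIsMarkovKernelCondDistrib .., e1, e2, e3⟩

theorem ae_eq_condExp_of_le {E : Type*} [NormedAddCommGroup E] [NormedSpace ℝ E] [CompleteSpace E]
    {m m' mΩ : MeasurableSpace Ω} {P : Measure Ω} [IsFiniteMeasure P] (hm : m ≤ m') (hm' : m' ≤ mΩ)
    {f g : Ω → E} (hg : StronglyMeasurable[m] g) (hfg : P[f | m'] =ᵐ[P] g) : P[f | m] =ᵐ[P] g := by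
  have hgi : Integrable g P := integrable_condExp.congr hfg
  calc P[f | m] =ᵐ[P] P[P[f | m'] | m] := (condExp_condExp_of_le hm hm').symm
    _ =ᵐ[P] P[g | m] := condExp_congr_ae hfg
    _ = g := condExp_of_stronglyMeasurable (hm.trans hm') hg hgi

theorem isOpen_off {D : Opens ℂ} {φ : ℂ → ℍ} (hφ : ContinuousOn φ D) (A : ClosedSets) :
    IsOpen (off D φ A) :=
  (continuous_ofUpper.comp_continuousOn hφ).isOpen_inter_preimage D.isOpen
    A.isCompact.isClosed.isOpen_compl

theorem continuous_lap {D : Opens ℂ} : Continuous (lap : 𝓓(D, ℝ) → 𝓓(D, ℝ)) :=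
  ((LineDeriv.continuous_lineDerivOp _).comp (LineDeriv.continuous_lineDerivOp _)).add
    ((LineDeriv.continuous_lineDerivOp _).comp (LineDeriv.continuous_lineDerivOp _))

namespace IsLocalUnion

variable {𝒢 mΩ : MeasurableSpace Ω} {P : Measure Ω} [IsProbabilityMeasure P] {D : Opens ℂ}
  {hI : HasInvLap D} {m : 𝓓(D, ℝ) →ₗ[ℝ] ℝ} {h : Ω → 𝓓'(D, ℝ)} {φ : ℂ → ℍ}
  {A₁ A₂ A : Ω → ClosedSets}

/-- The conditional mean of `(h, ρ)`. -/
def condMean (S : IsLocalUnion P hI m h φ A₁ A₂ A) (ρ : 𝓓(D, ℝ)) (ω : Ω) : ℝ :=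
  m ρ + (S.exists_condMean (invLapHom hI ρ)).choose ω

omit [IsProbabilityMeasure P] in
theorem germ_le (S : IsLocalUnion P hI m h φ A₁ A₂ A) : sigmaGerm φ h A ≤ mΩ :=
  sigmaGerm_le S.continuousOn S.field.measurable S.measurable

theorem stronglyMeasurable_condMean (S : IsLocalUnion P hI m h φ A₁ A₂ A) (ρ : 𝓓(D, ℝ)) :
    StronglyMeasurable[sigmaGerm φ h A] (S.condMean ρ) :=
  (S.exists_condMean (invLapHom hI ρ)).choose_spec.1.const_add (m ρ)

theorem integrable_pairing (S : IsLocalUnion P hI m h φ A₁ A₂ A) (ρ : 𝓓(D, ℝ)) :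
    Integrable (fun ω => h ω ρ) P := by
  have := ((S.field.memLp_centred ρ).integrable one_le_two).add (integrable_const (m ρ))
  refine this.congr (.of_forall fun ω => ?_)
  simp

/-- The intermediate σ-algebra `𝒢` covers both conclusions at once. The mean is germ-measurable and
correct given the larger σ-algebra, so the tower property gives it for everything in between. -/
theorem condExp_pairing (S : IsLocalUnion P hI m h φ A₁ A₂ A)
    (h1 : sigmaGerm φ h A ≤ 𝒢) (h2 : 𝒢 ≤ S.pairGerm) (ρ : 𝓓(D, ℝ)) :
    P[fun ω => h ω ρ | 𝒢] =ᵐ[P] S.condMean ρ := by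
  refine ae_eq_condExp_of_le h2 S.pairGerm_le ((S.stronglyMeasurable_condMean ρ).mono h1) ?_
  obtain ⟨hM, hMi, hz, -⟩ := (S.exists_condMean (invLapHom hI ρ)).choose_spec
  have hW : Integrable (fun ω => S.field.white (invLapHom hI ρ) ω) P :=
    (Lp.memLp (S.field.white (invLapHom hI ρ))).integrable one_le_two
  have hcm : Integrable (S.condMean ρ) P := (integrable_const (m ρ)).add hMi
  have e : (fun ω => h ω ρ) =ᵐ[P] (fun ω => S.field.white (invLapHom hI ρ) ω -
      (S.exists_condMean (invLapHom hI ρ)).choose ω) + S.condMean ρ := by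
    filter_upwards [S.field.coeFn_white_invLapHom ρ] with ω hω
    simp only [Pi.add_apply, hω, condMean]
    ring
  refine (condExp_congr_ae e).trans ((condExp_add (hW.sub hMi) hcm _).trans ?_)
  have e2 := condExp_of_stronglyMeasurable S.pairGerm_le
    ((S.stronglyMeasurable_condMean ρ).mono le_sup_left) hcm
  filter_upwards [hz] with ω hω
  rw [Pi.add_apply, e2]
  exact (congrArg (· + S.condMean ρ ω) hω).trans (zero_add _)

theorem condExp_expI_pairing (S : IsLocalUnion P hI m h φ A₁ A₂ A)
    (h1 : sigmaGerm φ h A ≤ 𝒢) (h2 : 𝒢 ≤ S.pairGerm) (ρ : 𝓓(D, ℝ)) :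
    P[fun ω => expI (h ω ρ) | 𝒢] =ᵐ[P] fun ω =>
      expI (S.condMean ρ ω) * Real.exp (-(energy (off D φ (A ω)) ρ / 2)) := by
  have hmeas : StronglyMeasurable[sigmaGerm φ h A] fun ω =>
      expI (S.condMean ρ ω) * (Real.exp (-(energy (off D φ (A ω)) ρ / 2)) : ℂ) := by
    have hA : Measurable[sigmaGerm φ h A] A :=
      measurable_iff_comap_le.2 (sigmaSet_le_sigmaGerm φ h A)
    have hE : Measurable[sigmaGerm φ h A] fun ω => energy (off D φ (A ω)) ρ :=
      (measurable_energy_off S.continuousOn ρ).comp hA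
    exact ((measurable_expI.comp (S.stronglyMeasurable_condMean ρ).measurable).mul
      (Complex.measurable_ofReal.comp (Real.measurable_exp.comp
        ((hE.coe_nnreal_real.div_const 2).neg)))).stronglyMeasurable
  refine ae_eq_condExp_of_le h2 S.pairGerm_le (hmeas.mono h1) ?_
  obtain ⟨hM, hMi, -, hz, -⟩ := (S.exists_condMean (invLapHom hI ρ)).choose_spec
  have hbound : ∀ ω, ‖expI (S.condMean ρ ω) *
      (Real.exp (-(energy (off D φ (A ω)) ρ / 2)) : ℂ)‖ ≤ 1 := by
    intro ω
    rw [norm_mul, norm_expI, one_mul, Complex.norm_real, Real.norm_eq_abs,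
      abs_of_pos (Real.exp_pos _), Real.exp_le_one_iff, neg_nonpos]
    positivity
  have hint := integrable_of_bounded (P := P) (hmeas.mono S.germ_le).aestronglyMeasurable hbound
  have hsub := (S.field.integrable_expI ρ).sub hint
  have e : ((fun ω => expI (h ω ρ)) - fun ω => expI (S.condMean ρ ω) *
      (Real.exp (-(energy (off D φ (A ω)) ρ / 2)) : ℂ)) =ᵐ[P] fun ω => expI (m ρ) *
      (expI (S.field.white (invLapHom hI ρ) ω) -
        expI ((S.exists_condMean (invLapHom hI ρ)).choose ω) * (Real.exp
        (-(‖(suppSpace D (off D φ (A ω))).starProjection (invLapHom hI ρ)‖ ^ 2 / 2)) : ℂ)) := by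
    filter_upwards [S.field.expI_pairing_ae_eq ρ] with ω hω
    rw [Pi.sub_apply, hω, condMean, expI_add, energy_eq hI]
    ring
  have e3 : P[(fun ω => expI (h ω ρ)) - fun ω => expI (S.condMean ρ ω) *
      (Real.exp (-(energy (off D φ (A ω)) ρ / 2)) : ℂ) | S.pairGerm] =ᵐ[P] 0 := by
    refine (condExp_congr_ae e).trans ((condExp_smul (𝕜 := ℂ) (expI (m ρ)) _ _).trans ?_)
    filter_upwards [hz] with ω hω
    rw [Pi.smul_apply, hω]
    simp
  have e4 := condExp_sub (S.field.integrable_expI ρ) hint S.pairGerm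
  have e5 := condExp_of_stronglyMeasurable S.pairGerm_le (hmeas.mono le_sup_left) hint
  filter_upwards [e3, e4] with ω h3 h4
  rw [h4, Pi.sub_apply, e5] at h3
  exact sub_eq_zero.1 h3

theorem condMean_smul (S : IsLocalUnion P hI m h φ A₁ A₂ A) (r : ℝ) (ρ : 𝓓(D, ℝ)) :
    ∀ᵐ ω ∂P, S.condMean (r • ρ) ω = r * S.condMean ρ ω := by
  have e : (fun ω => h ω (r • ρ)) = r • fun ω => h ω ρ :=
    funext fun ω => map_smul (h ω) r ρ
  have h1 := S.condExp_pairing le_rfl le_sup_left (r • ρ)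
  rw [e] at h1
  filter_upwards [h1, S.condExp_pairing le_rfl le_sup_left ρ,
    condExp_smul (μ := P) r (fun ω => h ω ρ) (sigmaGerm φ h A)] with ω h1 h2 h3
  rw [← h1, h3, Pi.smul_apply, h2, smul_eq_mul]

theorem condMean_lap (S : IsLocalUnion P hI m h φ A₁ A₂ A) (g : 𝓓(D, ℝ)) :
    ∀ᵐ ω ∂P, tsupport g ⊆ off D φ (A ω) → S.condMean (lap g) ω = 0 := by
  have hg : invLapHom hI (lap g) = toH (-g) := by
    rw [invLapHom_lap]
    simpa using (toH_smul (-1) g).symm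
  filter_upwards [(S.exists_condMean (invLapHom hI (lap g))).choose_spec.2.2.2.2 (-g) hg]
    with ω hω hsupp
  have : tsupport (-g : 𝓓(D, ℝ)) ⊆ off D φ (A ω) := by
    refine subset_trans (closure_mono ?_) hsupp
    intro z hz hgz
    exact hz (by simp [hgz])
  rw [condMean, S.mean_lap, hω this, add_zero]

theorem energy_smul (hI : HasInvLap D) (U : Set ℂ) (r : ℝ) (ρ : 𝓓(D, ℝ)) :
    (energy U (r • ρ) : ℝ) = r ^ 2 * energy U ρ := by
  rw [energy_eq hI, energy_eq hI, map_smul, map_smul, norm_smul, mul_pow, Real.norm_eq_abs, sq_abs]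

/-- For countably many test functions and rational frequencies, the conditional characteristic
functions are those of Gaussians outside one null set. The remaining test functions are then handled
separately for each `ω` by `exists_eq_map_add`. -/
theorem exists_kernel (S : IsLocalUnion P hI m h φ A₁ A₂ A)
    (h1 : sigmaGerm φ h A ≤ 𝒢) (h2 : 𝒢 ≤ S.pairGerm) :
    ∃ κ : Kernel[𝒢] Ω 𝓓'(D, ℝ), IsMarkovKernel κ ∧
      (∀ F : Set 𝓓'(D, ℝ), MeasurableSet F → (fun ω => (κ ω).real F) =ᵐ[P] P⟦h ⁻¹' F|𝒢⟧) ∧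
      (∀ ρ : 𝓓(D, ℝ), P[fun ω => h ω ρ | 𝒢] =ᵐ[P] fun ω => ∫ T, T ρ ∂κ ω) ∧
      ∀ᵐ ω ∂P, ∃ C : 𝓓'(D, ℝ), (∀ q ∈ rationalTest D, C q = S.condMean q ω) ∧
        (∀ ρ, ∫ T, T ρ ∂κ ω = C ρ) ∧
        ∃ ν : Measure 𝓓'(D, ℝ), IsZeroGFFLaw (off D φ (A ω)) ν ∧ κ ω = ν.map fun T => C + T := by
  obtain ⟨κ, hκ, hset, hexp, hreal⟩ := exists_kernel_condExp (P := P) (h2.trans S.pairGerm_le)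
    S.field.measurable
  refine ⟨κ, hκ, hset, fun ρ => hreal _ (measurable_eval ρ) (S.integrable_pairing ρ), ?_⟩
  have key : ∀ (q : rationalTest D) (t : ℚ), ∀ᵐ ω ∂P, ∫ T, expI (t * T q) ∂κ ω =
      expI (t * S.condMean q ω) *
        Real.exp (-((t : ℝ) ^ 2 * energy (off D φ (A ω)) (q : 𝓓(D, ℝ)) / 2)) := by
    intro q t
    filter_upwards [S.condMean_smul t q, S.condExp_expI_pairing h1 h2 ((t : ℝ) • (q : 𝓓(D, ℝ))),
      hexp (fun T => expI (T ((t : ℝ) • (q : 𝓓(D, ℝ))))) (measurable_expI.comp (measurable_eval _))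
        (S.field.integrable_expI _)] with ω e1 e2 e3
    rw [e3, e1, energy_smul hI] at e2
    rw [← e2]
    refine integral_congr_ae (.of_forall fun T => ?_)
    exact congrArg expI (map_smul T (t : ℝ) (q : 𝓓(D, ℝ))).symm
  filter_upwards [ae_all_iff.2 fun q => ae_all_iff.2 fun t => key q t] with ω hω
  have := hκ.isProbabilityMeasure ω
  exact S.field.exists_eq_map_add (κ ω) (a := fun ρ => S.condMean ρ ω) fun q hq =>
    map_eq_gaussianReal (measurable_eval q) (hω ⟨q, hq⟩)

/-- Any random distribution with the right values on the countable group of test functions gives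
the conditional law of the field. -/
theorem hasCondLaw (S : IsLocalUnion P hI m h φ A₁ A₂ A)
    (h1 : sigmaGerm φ h A ≤ 𝒢) (h2 : 𝒢 ≤ S.pairGerm) {C : Ω → 𝓓'(D, ℝ)}
    (hC : ∀ᵐ ω ∂P, ∀ q ∈ rationalTest D, C ω q = S.condMean q ω) :
    HasCondLaw P h 𝒢 C fun ω => off D φ (A ω) := by
  obtain ⟨κ, hκ, hset, -, hlaw⟩ := S.exists_kernel h1 h2
  refine ⟨κ, hκ, hset, ?_⟩
  filter_upwards [hC, hlaw] with ω h3 h4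
  obtain ⟨C', hC', -, ν, hν, hmap⟩ := h4
  have : C ω = C' := distribution_ext_rationalTest fun q hq => (h3 q hq).trans (hC' q hq).symm
  rw [this]
  exact ⟨ν, hν, hmap⟩

/-- The values of the conditional mean on the countable group form a germ-measurable sequence, which
almost surely comes from a distribution. A measurable left inverse of `restrictRational`, defined
everywhere, turns it into a random distribution that is exactly germ-measurable, without completing
the σ-algebra. -/
theorem exists_isCondExpField (S : IsLocalUnion P hI m h φ A₁ A₂ A) :
    ∃ C : Ω → 𝓓'(D, ℝ), IsCondExpField P h (sigmaGerm φ h A) C := by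
  obtain ⟨r, hr, hrid⟩ := (measurableEmbedding_restrictRational (D := D)).exists_measurable_extend
    measurable_id fun _ => inferInstance
  have hx : Measurable[sigmaGerm φ h A] fun ω (q : rationalTest D) => S.condMean q ω :=
    @measurable_pi_lambda _ _ _ (sigmaGerm φ h A) _ _
      fun q => (S.stronglyMeasurable_condMean (q : 𝓓(D, ℝ))).measurable
  refine ⟨fun ω => r fun q => S.condMean q ω, hr.comp hx, fun ρ => ?_⟩
  obtain ⟨κ, hκ, -, hint, hlaw⟩ := S.exists_kernel le_rfl le_sup_left
  filter_upwards [hint ρ, hlaw] with ω h3 h4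
  obtain ⟨C, hC, hCint, -⟩ := h4
  have : (fun q : rationalTest D => S.condMean q ω) = restrictRational C :=
    funext fun q => (hC q q.2).symm
  rw [h3, hCint, this]
  exact congrArg (fun T : 𝓓'(D, ℝ) => T ρ) (congrFun hrid C)

theorem eq_condMean (S : IsLocalUnion P hI m h φ A₁ A₂ A) {C : Ω → 𝓓'(D, ℝ)}
    (hC : IsCondExpField P h (sigmaGerm φ h A) C) :
    ∀ᵐ ω ∂P, ∀ q ∈ rationalTest D, C ω q = S.condMean q ω := by
  have : ∀ q : rationalTest D, ∀ᵐ ω ∂P, C ω q = S.condMean q ω := fun q =>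
    (hC.2 q).trans (S.condExp_pairing le_rfl le_sup_left q)
  filter_upwards [ae_all_iff.2 this] with ω hω q hq
  exact hω ⟨q, hq⟩

/-- For fixed `g`, `condMean_lap` gives the identity up to a null set. Countably many `g` suffice,
because every test function supported in the open set `D ∖ A` is a limit of members of the countable
group supported there. -/
theorem isHarmonicOn (S : IsLocalUnion P hI m h φ A₁ A₂ A) {C : Ω → 𝓓'(D, ℝ)}
    (hC : IsCondExpField P h (sigmaGerm φ h A) C) :
    ∀ᵐ ω ∂P, IsHarmonicOn (C ω) (off D φ (A ω)) := by
  have hlap : ∀ g : rationalTest D, ∀ᵐ ω ∂P,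
      tsupport (g : 𝓓(D, ℝ)) ⊆ off D φ (A ω) → C ω (lap (g : 𝓓(D, ℝ))) = 0 := by
    intro g
    filter_upwards [hC.2 (lap g), S.condExp_pairing le_rfl le_sup_left (lap (g : 𝓓(D, ℝ))),
      S.condMean_lap g] with ω h3 h4 h5 hsupp
    rw [h3, h4, h5 hsupp]
  filter_upwards [ae_all_iff.2 hlap] with ω hω g hg
  have hoff : IsOpen (off D φ (A ω)) := isOpen_off S.continuousOn _
  obtain ⟨q, hq, hqU, hqg⟩ := exists_seq_rationalTest hoff (fun z hz => hz.1) hg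
  refine tendsto_nhds_unique (tendsto_apply_sub ((continuous_lap.tendsto g).comp hqg) (C ω)) ?_
  refine tendsto_const_nhds.congr fun n => ?_
  exact (hω ⟨q n, hq n⟩ (hqU n)).symm

end IsLocalUnion

end

end GFF

end

theorem mainTheorem6 {Ω : Type*} [MeasurableSpace Ω] (P : Measure Ω) [IsProbabilityMeasure P]
    (D : Opens ℂ) (hD : IsSimplyConnected (D : Set ℂ))
    (φ : ℂ → ℍ) (hφ : DifferentiableOn ℂ (fun z => (φ z : ℂ)) D) (hφinj : InjOn φ D)
    (u : ℂ → ℝ) (hu : InnerProductSpace.HarmonicOnNhd u (D : Set ℂ))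
    (h : Ω → 𝓓'(D, ℝ)) (hh : GFF.IsGFF P u h)
    (A₁ A₂ : Ω → GFF.ClosedSets) (hA₁ : Measurable A₁) (hA₂ : Measurable A₂)
    (hloc₁ : GFF.IsLocal P φ h A₁) (hloc₂ : GFF.IsLocal P φ h A₂)
    (hindep : GFF.CondIndepSets P h A₁ A₂) :
    GFF.IsLocal P φ h (fun ω => A₁ ω ⊔ A₂ ω) ∧
      (∃ C : Ω → 𝓓'(D, ℝ),
        GFF.IsCondExpField P h (GFF.sigmaGerm φ h (fun ω => A₁ ω ⊔ A₂ ω)) C) ∧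
      ∀ C : Ω → 𝓓'(D, ℝ),
        GFF.IsCondExpField P h (GFF.sigmaGerm φ h (fun ω => A₁ ω ⊔ A₂ ω)) C →
        (∀ᵐ ω ∂P, GFF.IsHarmonicOn (C ω) (GFF.off D φ (A₁ ω ⊔ A₂ ω))) ∧
        GFF.HasCondLaw P h
          (GFF.sigmaGerm φ h (fun ω => A₁ ω ⊔ A₂ ω) ⊔ (GFF.sigmaSet A₁ ⊔ GFF.sigmaSet A₂))
          C (fun ω => GFF.off D φ (A₁ ω ⊔ A₂ ω)) := by
  have hI := GFF.hasInvLap_of_chart hφ hφinj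
  have S : GFF.IsLocalUnion P hI (GFF.meanHom hu) h φ A₁ A₂ fun ω => A₁ ω ⊔ A₂ ω :=
    ⟨hh.isGaussianField hu hI, fun g => GFF.integral_harmonic_mul_lap hu g, hφ, hA₁, hA₂, hloc₁,
      hloc₂, hindep, fun _ => rfl⟩
  obtain ⟨C, hC⟩ := S.exists_isCondExpField
  -- The two ends of the range allowed for `𝒢` are used: the germ of `A` for locality, and the germ
  -- joined with the pair for the last claim.
  exact ⟨⟨C, hC.1, S.isHarmonicOn hC, S.hasCondLaw le_rfl le_sup_left (S.eq_condMean hC)⟩, ⟨C, hC⟩,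
    fun C' hC' => ⟨S.isHarmonicOn hC', S.hasCondLaw le_sup_left le_rfl (S.eq_condMean hC')⟩⟩
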